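/- Let $(Z_t)_{t\in\mathbb R}$ be a jointly measurable $\mathbb R^n$-valued process on a probability space with $\mathbb E|Z_t|<\infty$ for all $t$ and with stationary increments. Assume $Z$ is a regular integrator: for each $k=1,\dots,n$ there is a linear map $I_k=\int\cdot\,dZ^k : L^1\cap L^2\to L^1(\mathbb P)$ such that (i) $I_k(\mathbf 1_{(s,t]})=Z^k_t-Z^k_s$ for $s<t$, and (ii) for every finite Borel measure $\mu$ on $\mathbb R$ with finite first moment and every $t$, almost surely $I_k\big(\int f_r(t-\cdot)\,\mu(dr)\big)=\int I_k(f_r(t-\cdot))\,\mu(dr)$, where $f_r=\mathbf 1_{[0,\infty)}(\cdot-r)-\mathbf 1_{[0,\infty)}$ (so that $I_k(f_r(t-\cdot))=Z^k_{t-r}-Z^k_t$). Let $0\le q<p$ be integers and let $P(z)=I_nz^p+A_1z^{p-1}+\dots+A_p$ and $Q(z)=I_nz^q+B_{q-1}z^{q-1}+\dots+B_0$ with real $n\times n$ matrix coefficients, $\det P(iy)\neq0$ for all $y\in\mathbb R$, and $\det Q(z)\neq 0$ for all $z\in\mathbb C$ with $\operatorname{Re} z\ge 0$. For a real matrix function with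 integrable entries write $\mathcal F[f](y)=\int_{\mathbb R} e^{iyu}f(u)\,du$. The $Z$-driven MCARMA($p,q$) process is $X_t=\int\tilde g(t-u)\,dZ_u$, i.e. $X^j_t=\sum_k I_k(\tilde g_{jk}(t-\cdot))$ almost surely for each $t$, where $\tilde g\in L^1\cap L^2$ satisfies $\mathcal F[\tilde g](y)=P(-iy)^{-1}Q(-iy)$ for all $y$; it is determined up to modification. Put $m=p-q$. For real $n\times n$ matrices $C_0,\dots,C_{m-1}$ and an integrable $f:\mathbb R\to\mathbb R^{n\times n}$, a solution of the $m$-th order MSDDE $$dX^{(m-1)}_t=-\sum_{j=0}^{m-1}C_jX^{(j)}_t\,dt+\Big(\int_0^\infty f(u)X_{t-u}\,du\Big)dt+dZ_t\qquad(*)$$ is a strictly stationary, integrable, jointly measurable $\mathbb R^n$-valued process $X$ which is $m-1$ times differentiable and satisfies the integrated form of $(*)$ over $[s,t]$ almost surely, for each $s<t$. Differentiability means that there are jointly measurable processes $X^{(0)}=X,X^{(1)},\dots,X^{(m-1)}$ with locally integrable paths such that for $0\le j<m-1$, almost surely, $X^{(j)}_t-X^{(j)}_s=\int_s^tX^{(j+1)}_u\,du$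 for all $s<t$. Then: 1. There is exactly one polynomial $R(z)=I_nz^{m}+C_{m-1}z^{m-1}+\dots+C_0$ with real $n\times n$ matrix coefficients such that $QR-P$ has degree at most $q-1$ (is zero if $q=0$). 2. There is an integrable $f:\mathbb R\to\mathbb R^{n\times n}$, unique up to Lebesgue null sets, with $\mathcal F[f](y)=R(-iy)-Q(-iy)^{-1}P(-iy)$ for all $y\in\mathbb R$. Moreover $f\in L^2$, $\int u^2|f_{jk}(u)|\,du<\infty$ for all $j,k$, and $f$ can be chosen to vanish on $(-\infty,0)$. 3. The $Z$-driven MCARMA($p,q$) process $X$ exists, and with these $C_j$ and $f$ it is, up to modification, the unique solution of $(*)$: $X$ has a modification which is a solution of $(*)$, and every solution $Y$ of $(*)$ satisfies $Y_t=X_t$ almost surely for each $t$. -/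

import Mathlib

open MeasureTheory ProbabilityTheory Filter

noncomputable section

namespace MCARMA

/-- Real `n × n` matrices. -/
abbrev Mat (n : ℕ) : Type := Matrix (Fin n) (Fin n) ℝ

/-- The value `A(z) = ∑ A_k z^k` in `ℂ^{n × n}` of a polynomial with real matrix coefficients. -/
def evalC {n : ℕ} (A : Polynomial (Mat n)) (z : ℂ) : Matrix (Fin n) (Fin n) ℂ :=
  A.sum fun k M => z ^ k • M.map ((↑) : ℝ → ℂ)

/-- The entrywise Fourier transform `F[f](y) = ∫ e^{iyu} f(u) du` (for integrable entries). -/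
def fourierMat {n : ℕ} (f : ℝ → Mat n) (y : ℝ) : Matrix (Fin n) (Fin n) ℂ :=
  Matrix.of fun j k => ∫ u : ℝ, Complex.exp (Complex.I * y * u) * ((f u j k : ℝ) : ℂ)

section Processes

variable {Ω : Type*} [MeasurableSpace Ω]

/-- Strict stationarity: the finite dimensional distributions are invariant under time shifts. -/
def IsStationary {n : ℕ} (Pr : Measure Ω) (X : ℝ → Ω → Fin n → ℝ) : Prop :=
  ∀ (h : ℝ) (N : ℕ) (t : Fin N → ℝ),
    IdentDistrib (fun ω i => X (t i + h) ω) (fun ω i => X (t i) ω) Pr Pr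

/-- Stationary increments: the law of `(Z_{t+h} - Z_h)_{t ∈ ℝ}` does not depend on `h`. -/
def HasStationaryIncrements {n : ℕ} (Pr : Measure Ω) (Z : ℝ → Ω → Fin n → ℝ) : Prop :=
  ∀ (h : ℝ) (N : ℕ) (t : Fin N → ℝ),
    IdentDistrib (fun ω i => Z (t i + h) ω - Z h ω) (fun ω i => Z (t i) ω - Z 0 ω) Pr Pr

/-- An integrable, jointly measurable process with stationary increments. -/
structure IsNoise {n : ℕ} (Pr : Measure Ω) (Z : ℝ → Ω → Fin n → ℝ) : Prop where
  measurable : Measurable fun x : ℝ × Ω => Z x.1 x.2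
  integrable : ∀ t k, Integrable (fun ω => Z t ω k) Pr
  stationaryIncrements : HasStationaryIncrements Pr Z

/-- The space `L¹ ∩ L²` of (classes of) real functions on `ℝ`. -/
abbrev L1L2 : Submodule ℝ (ℝ →ₘ[(volume : Measure ℝ)] ℝ) :=
  Lp.LpSubmodule ℝ ℝ 1 volume ⊓ Lp.LpSubmodule ℝ ℝ 2 volume

/-- The class in `L¹ ∩ L²` of a function. -/
def L1L2.mk (φ : ℝ → ℝ) (h₁ : MemLp φ 1 volume) (h₂ : MemLp φ 2 volume) : L1L2 :=
  ⟨AEEqFun.mk φ h₁.1, (h₁.toLp φ).2, (h₂.toLp φ).2⟩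

open Classical in
/-- `I(φ)` for a function `φ` in `L¹ ∩ L²`, as a random variable (a representative of a class in
`L¹(Pr)`); the value for other `φ` is irrelevant. -/
def stochInt {Pr : Measure Ω} (I : L1L2 →ₗ[ℝ] Lp ℝ 1 Pr) (φ : ℝ → ℝ) : Ω → ℝ :=
  if h : MemLp φ 1 volume ∧ MemLp φ 2 volume then I (L1L2.mk φ h.1 h.2) else 0

/-- `f_r(x) = 1_{[0,∞)}(x - r) - 1_{[0,∞)}(x)`. -/
def stepDiff (r x : ℝ) : ℝ :=
  Set.indicator (Set.Ici 0) 1 (x - r) - Set.indicator (Set.Ici 0) 1 x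

/-- The linear maps `I_k : L¹ ∩ L² → L¹(Pr)` make `Z` a regular integrator, `I_k = ∫ · dZ^k`.
In `fubini` the integrand `I_k(f_r(t - ·))` of the right-hand side is written as
`Z^k_{t-r} - Z^k_t`, which it equals almost surely for each `r` by `interval`, and which is
jointly measurable in `(r, ω)`. -/
structure IsRegularIntegrator {n : ℕ} (Pr : Measure Ω) (Z : ℝ → Ω → Fin n → ℝ)
    (I : Fin n → (L1L2 →ₗ[ℝ] Lp ℝ 1 Pr)) : Prop where
  interval : ∀ (k : Fin n) (s t : ℝ), s < t →
    stochInt (I k) (Set.indicator (Set.Ioc s t) 1) =ᵐ[Pr] fun ω => Z t ω k - Z s ω k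
  fubini : ∀ (k : Fin n) (ν : Measure ℝ) [IsFiniteMeasure ν], Integrable (fun r => r) ν →
    ∀ t : ℝ, stochInt (I k) (fun u => ∫ r, stepDiff r (t - u) ∂ν)
      =ᵐ[Pr] fun ω => ∫ r, (Z (t - r) ω k - Z t ω k) ∂ν

/-- `g` is the MCARMA kernel of `(P, Q)`: `g ∈ L¹ ∩ L²` and `F[g](y) = P(-iy)⁻¹ Q(-iy)`. -/
structure IsKernel {n : ℕ} (P Q : Polynomial (Mat n)) (g : ℝ → Mat n) : Prop where
  memL1 : ∀ j k, MemLp (fun u => g u j k) 1 volume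
  memL2 : ∀ j k, MemLp (fun u => g u j k) 2 volume
  fourier : ∀ y : ℝ, fourierMat g y =
    (evalC P (-(Complex.I * y)))⁻¹ * evalC Q (-(Complex.I * y))

/-- `X` is (a version of) the `Z`-driven MCARMA process `X_t = ∫ g(t - u) dZ_u`. -/
def IsMCARMA {n : ℕ} {Pr : Measure Ω} (P Q : Polynomial (Mat n))
    (I : Fin n → (L1L2 →ₗ[ℝ] Lp ℝ 1 Pr)) (X : ℝ → Ω → Fin n → ℝ) : Prop :=
  ∃ g : ℝ → Mat n, IsKernel P Q g ∧
    ∀ (t : ℝ) (j : Fin n), (fun ω => X t ω j)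
      =ᵐ[Pr] fun ω => ∑ k, stochInt (I k) (fun u => g (t - u) j k) ω

/-- `R` is a monic polynomial of degree `p - q` such that `QR - P` has degree at most `q - 1`
(that is, vanishes if `q = 0`). -/
structure IsResidue {n : ℕ} (p q : ℕ) (P Q R : Polynomial (Mat n)) : Prop where
  monic : R.Monic
  natDegree : R.natDegree = p - q
  degree_lt : (Q * R - P).degree < (q : WithBot ℕ)

/-- `f` is integrable with `F[f](y) = R(-iy) - Q(-iy)⁻¹ P(-iy)`. -/
structure IsDelayKernel {n : ℕ} (P Q R : Polynomial (Mat n)) (f : ℝ → Mat n) : Prop where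
  integrable : ∀ j k, Integrable (fun u => f u j k) volume
  fourier : ∀ y : ℝ, fourierMat f y = evalC R (-(Complex.I * y)) -
    (evalC Q (-(Complex.I * y)))⁻¹ * evalC P (-(Complex.I * y))

/-- `D 0 = X, D 1, …, D (m - 1)` are the successive derivatives of `X`: each is a jointly
measurable process with locally integrable paths and, almost surely, each path of `D j` is the
integral of the path of `D (j + 1)`. Thus paths are `m - 2` times continuously differentiable, and
the derivative of order `m - 2` is absolutely continuous with derivative `D (m - 1)`. (The last
derivative may jump, as it does for a driving Lévy process with jumps, so that one cannot ask for
a two-sided derivative at every point of a path.) -/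
structure IsDerivChain {n : ℕ} (Pr : Measure Ω) (m : ℕ) (X : ℝ → Ω → Fin n → ℝ)
    (D : ℕ → ℝ → Ω → Fin n → ℝ) : Prop where
  zero : D 0 = X
  measurable : ∀ j < m, Measurable fun x : ℝ × Ω => D j x.1 x.2
  integrable : ∀ j < m, ∀ᵐ ω ∂Pr, ∀ s t : ℝ,
    IntervalIntegrable (fun u => D j u ω) volume s t
  deriv : ∀ j, j + 1 < m → ∀ᵐ ω ∂Pr, ∀ s t : ℝ, s < t →
    D j t ω - D j s ω = ∫ u in s..t, D (j + 1) u ω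

/-- `X` is a (stationary, integrable, measurable) solution of the `m`-th order MSDDE
`dX^{(m-1)}_t = -∑_{j<m} C_j X^{(j)}_t dt + (∫_0^∞ f(v) X_{t-v} dv) dt + dZ_t`. -/
structure IsSolution {n : ℕ} (Pr : Measure Ω) (m : ℕ) (C : ℕ → Mat n) (f : ℝ → Mat n)
    (Z X : ℝ → Ω → Fin n → ℝ) : Prop where
  measurable : Measurable fun x : ℝ × Ω => X x.1 x.2
  integrable : ∀ t k, Integrable (fun ω => X t ω k) Pr
  stationary : IsStationary Pr X
  delay_integrable : ∀ s t : ℝ, s < t → ∀ᵐ ω ∂Pr,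
    IntegrableOn (fun x : ℝ × ℝ => (f x.2).mulVec (X (x.1 - x.2) ω))
      (Set.Ioc s t ×ˢ Set.Ioi 0) (volume.prod volume)
  equation : ∃ D : ℕ → ℝ → Ω → Fin n → ℝ, IsDerivChain Pr m X D ∧
    ∀ s t : ℝ, s < t → ∀ᵐ ω ∂Pr,
      D (m - 1) t ω - D (m - 1) s ω =
        -(∑ j ∈ Finset.range m, ∫ u in s..t, (C j).mulVec (D j u ω))
        + (∫ u in s..t, ∫ v in Set.Ioi 0, (f v).mulVec (X (u - v) ω))
        + (Z t ω - Z s ω)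

end Processes

end MCARMA

end

open MeasureTheory ProbabilityTheory Filter

noncomputable section

namespace MCARMA

/-! ### Convolution of rapidly decreasing kernels with tempered functions -/

section Kernels

variable {𝕜 : Type*} [RCLike 𝕜]

/-! Put `z = -iy`. For `j < m = p - q` the quotient `z^j P(z)⁻¹ Q(z)` is strictly proper without
imaginary poles, hence the Fourier transform of a rapidly decreasing kernel `k_j`; for `j = m` the
identity matrix is subtracted first. Thus `k_0` is the MCARMA kernel, `k_{j+1}` is the density of
the derivative of `k_j`, and the only unit jump sits in `k_{m-1}`. Likewise `R - Q⁻¹P = Q⁻¹(QR - P)`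
is strictly proper with poles in the open left half-plane, which gives a causal `f`. Since `Q⁻¹P`
and `P⁻¹Q` are inverse to each other on both sides, two identities hold in the time domain: `k_m + ∑
C_j k_j = f * k_0` and `k_m + ∑ k_j C_j = k_0 * f` (`exists_isKernelSystem`).

The probability is then reduced to paths. Subadditivity of `E|Z_t - Z_0|` bounds the growth of first
moments, so almost every path is integrable against `(1 + t²)⁻²` and can be convolved with rapid
kernels. Since `k_0` is the mixture of the `f_r` with weight `k_1(r)`, the regular integrator
property identifies `X_t` with `∫ k_1(r) (Z_{t-r} - Z_t) dr`, which is `k_1 * Z`, plus `Z_t` if `m =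
1` (`IsMCARMA.ae_eq_derivPath`).

Existence: convolve the first identity with a path of `Z` and take increments
(`derivPath_equation`); stationarity follows by approximating the integral by averages of increments
(`isStationary_incAverage`).

Uniqueness: the difference of two solutions solves the noise-free equation, and convolving that with
`k_0` and using the second identity leaves only the difference itself. Its higher derivatives are
merely locally integrable and cannot be convolved, so the equation is first smoothed by moving
integrals until only the function itself, under differences and integrals, remains
(`ae_eq_zero_of_homogeneous`). `IsSolution.ae_eq` then passes from almost every time to every time.
-/

lemma one_add_sq_add_le (s t : ℝ) : 1 + (s + t) ^ 2 ≤ 2 * (1 + s ^ 2) * (1 + t ^ 2) := by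
  nlinarith [sq_nonneg (s - t), sq_nonneg (s * t)]

/-- Measurable functions bounded by a multiple of `(1 + u²)⁻³`. -/
def IsRapid (k : ℝ → 𝕜) : Prop :=
  Measurable k ∧ ∃ C : ℝ, ∀ u, ‖k u‖ ≤ C * ((1 + u ^ 2) ^ 3)⁻¹

/-- Measurable functions integrable with respect to the weight `(1 + s²)⁻²`. -/
def IsTempered (z : ℝ → 𝕜) : Prop :=
  Measurable z ∧ Integrable fun s => ‖z s‖ * ((1 + s ^ 2) ^ 2)⁻¹

/-- Convolution of scalar functions on the line. -/
def cnv (k z : ℝ → 𝕜) (t : ℝ) : 𝕜 := ∫ s, k s * z (t - s)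

lemma cnv_eq_convolution (k z : ℝ → 𝕜) :
    cnv k z = convolution k z (ContinuousLinearMap.mul 𝕜 𝕜) volume := rfl

lemma cnv_swap (k z : ℝ → 𝕜) (t : ℝ) : cnv k z t = ∫ s, k (t - s) * z s := by
  rw [cnv_eq_convolution, convolution_eq_swap]; rfl

lemma integrable_inv_one_add_sq_pow (n : ℕ) :
    Integrable fun u : ℝ => ((1 + u ^ 2) ^ (n + 1))⁻¹ := by
  refine integrable_inv_one_add_sq.mono' (by fun_prop) (ae_of_all _ fun u => ?_)
  rw [Real.norm_of_nonneg (by positivity)]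
  gcongr
  exact le_self_pow₀ (by nlinarith [sq_nonneg u]) (by simp)

namespace IsRapid

lemma exists_pos {k : ℝ → 𝕜} (hk : IsRapid k) :
    ∃ C : ℝ, 0 ≤ C ∧ ∀ u, ‖k u‖ ≤ C * ((1 + u ^ 2) ^ 3)⁻¹ := by
  obtain ⟨_, C, hC⟩ := hk
  refine ⟨C, ?_, hC⟩
  simpa using (norm_nonneg _).trans (hC 0)

lemma zero : IsRapid (fun _ : ℝ => (0 : 𝕜)) := ⟨measurable_const, 0, by simp⟩

lemma add {k l : ℝ → 𝕜} (hk : IsRapid k) (hl : IsRapid l) : IsRapid fun u => k u + l u := by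
  obtain ⟨hk, C, hC⟩ := hk
  obtain ⟨hl, D, hD⟩ := hl
  refine ⟨hk.add hl, C + D, fun u => (norm_add_le _ _).trans ?_⟩
  rw [add_mul]
  exact add_le_add (hC u) (hD u)

lemma const_mul {k : ℝ → 𝕜} (hk : IsRapid k) (c : 𝕜) : IsRapid fun u => c * k u := by
  obtain ⟨hk, C, hC⟩ := hk
  refine ⟨hk.const_mul c, ‖c‖ * C, fun u => ?_⟩
  rw [norm_mul, mul_assoc]
  gcongr
  exact hC u

lemma sub {k l : ℝ → 𝕜} (hk : IsRapid k) (hl : IsRapid l) : IsRapid fun u => k u - l u := by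
  simpa [sub_eq_add_neg] using hk.add (hl.const_mul (-1))

lemma sum {ι : Type*} (s : Finset ι) {k : ι → ℝ → 𝕜} (hk : ∀ i ∈ s, IsRapid (k i)) :
    IsRapid fun u => ∑ i ∈ s, k i u := by
  classical
  induction s using Finset.induction_on with
  | empty => simpa using zero
  | insert i s hi ih =>
    simp only [Finset.sum_insert hi]
    exact (hk i (by simp)).add (ih fun j hj => hk j (by simp [hj]))

lemma norm {k : ℝ → 𝕜} (hk : IsRapid k) : IsRapid fun u => ‖k u‖ :=
  ⟨hk.1.norm, by simpa using hk.2⟩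

lemma ofReal_re {k : ℝ → ℂ} (hk : IsRapid k) : IsRapid fun u => (k u).re := by
  obtain ⟨hk, C, hC⟩ := hk
  exact ⟨by fun_prop, C, fun u => (Complex.abs_re_le_norm _).trans (hC u)⟩

/-- The third power in `IsRapid` is chosen for this: after the tempered weight of order two is paid,
one factor `(1 + u²)⁻¹` is left for integrability. -/
lemma integrable_weight {k : ℝ → 𝕜} (hk : IsRapid k) :
    Integrable fun u => (1 + u ^ 2) ^ 2 * ‖k u‖ := by
  have hm := hk.1
  obtain ⟨C, hC0, hC⟩ := hk.exists_pos
  refine (integrable_inv_one_add_sq.const_mul C).mono' (by fun_prop) (ae_of_all _ fun u => ?_)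
  rw [Real.norm_of_nonneg (by positivity)]
  have h1 : (0 : ℝ) < 1 + u ^ 2 := by positivity
  calc (1 + u ^ 2) ^ 2 * ‖k u‖ ≤ (1 + u ^ 2) ^ 2 * (C * ((1 + u ^ 2) ^ 3)⁻¹) := by
        gcongr; exact hC u
    _ = C * (1 + u ^ 2)⁻¹ := by field_simp

lemma integrable {k : ℝ → 𝕜} (hk : IsRapid k) : Integrable k := by
  have hm := hk.1
  refine hk.integrable_weight.mono' (by fun_prop) (ae_of_all _ fun u => ?_)
  refine le_mul_of_one_le_left (norm_nonneg _) (one_le_pow₀ ?_)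
  nlinarith [sq_nonneg u]

lemma bounded {k : ℝ → 𝕜} (hk : IsRapid k) : ∃ C : ℝ, ∀ u, ‖k u‖ ≤ C := by
  obtain ⟨C, hC0, hC⟩ := hk.exists_pos
  refine ⟨C, fun u => (hC u).trans (mul_le_of_le_one_right hC0 (inv_le_one_of_one_le₀ ?_))⟩
  exact one_le_pow₀ (by nlinarith [sq_nonneg u])

lemma memLp_one {k : ℝ → 𝕜} (hk : IsRapid k) : MemLp k 1 volume :=
  memLp_one_iff_integrable.2 hk.integrable

lemma memLp_two {k : ℝ → 𝕜} (hk : IsRapid k) : MemLp k 2 volume := by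
  obtain ⟨C, hC⟩ := hk.bounded
  have htop : MemLp k ⊤ volume := memLp_top_of_bound hk.1.aestronglyMeasurable C (ae_of_all _ hC)
  rw [memLp_two_iff_integrable_sq_norm hk.1.aestronglyMeasurable]
  have hm := hk.1
  refine (hk.integrable.norm.const_mul C).mono' (by fun_prop) (ae_of_all _ fun u => ?_)
  rw [norm_pow, norm_norm, sq]
  gcongr
  exact hC u

lemma integrable_sq_mul {k : ℝ → ℝ} (hk : IsRapid k) : Integrable fun u => u ^ 2 * k u := by
  have hm := hk.1
  refine hk.integrable_weight.mono' (by fun_prop) (ae_of_all _ fun u => ?_)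
  rw [norm_mul, Real.norm_of_nonneg (sq_nonneg u)]
  exact mul_le_mul_of_nonneg_right (by nlinarith [sq_nonneg u, sq_nonneg (u ^ 2)]) (norm_nonneg _)

lemma integrable_mul_self {k : ℝ → ℝ} (hk : IsRapid k) : Integrable fun u => |u| * |k u| := by
  have hm := hk.1
  refine hk.integrable_weight.mono' (by fun_prop) (ae_of_all _ fun u => ?_)
  rw [norm_mul, Real.norm_eq_abs, Real.norm_eq_abs, Real.norm_eq_abs, abs_abs, abs_abs]
  gcongr
  nlinarith [sq_nonneg (|u| - 1), sq_abs u, sq_nonneg (u ^ 2)]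

lemma of_bounded_of_support {k : ℝ → 𝕜} (hk : Measurable k) {C a : ℝ} (hC : ∀ u, ‖k u‖ ≤ C)
    (ha : ∀ u, a < |u| → k u = 0) : IsRapid k := by
  have hC0 : 0 ≤ C := (norm_nonneg _).trans (hC 0)
  refine ⟨hk, C * (1 + a ^ 2) ^ 3, fun u => ?_⟩
  have h1 : (0 : ℝ) < 1 + u ^ 2 := by positivity
  rcases lt_or_ge a |u| with h | h
  · rw [ha u h, norm_zero]; positivity
  · refine (hC u).trans ?_
    rw [← div_eq_mul_inv, le_div_iff₀ (by positivity)]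
    gcongr C * (1 + ?_) ^ 3
    exact sq_le_sq.2 (h.trans (le_abs_self a))

lemma isTempered {k : ℝ → 𝕜} (hk : IsRapid k) : IsTempered k := by
  have hm := hk.1
  refine ⟨hk.1, hk.integrable.norm.mono' (by fun_prop) (ae_of_all _ fun u => ?_)⟩
  rw [Real.norm_of_nonneg (by positivity)]
  refine mul_le_of_le_one_right (norm_nonneg _) (inv_le_one_of_one_le₀ ?_)
  exact one_le_pow₀ (by nlinarith [sq_nonneg u])

end IsRapid

namespace IsTempered

lemma add {y z : ℝ → 𝕜} (hy : IsTempered y) (hz : IsTempered z) :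
    IsTempered fun s => y s + z s := by
  have h1 := hy.1
  have h2 := hz.1
  refine ⟨hy.1.add hz.1, (hy.2.add hz.2).mono' (by fun_prop) (ae_of_all _ fun s => ?_)⟩
  rw [Real.norm_of_nonneg (by positivity), Pi.add_apply, ← add_mul]
  gcongr
  exact norm_add_le _ _

lemma const_mul {z : ℝ → 𝕜} (hz : IsTempered z) (c : 𝕜) : IsTempered fun s => c * z s := by
  refine ⟨hz.1.const_mul c, ?_⟩
  simpa [mul_assoc] using hz.2.const_mul ‖c‖

lemma sub {y z : ℝ → 𝕜} (hy : IsTempered y) (hz : IsTempered z) :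
    IsTempered fun s => y s - z s := by
  simpa [sub_eq_add_neg] using hy.add (hz.const_mul (-1))

lemma zero : IsTempered (fun _ : ℝ => (0 : 𝕜)) := IsRapid.zero.isTempered

lemma sum {ι : Type*} (s : Finset ι) {z : ι → ℝ → 𝕜} (hz : ∀ i ∈ s, IsTempered (z i)) :
    IsTempered fun u => ∑ i ∈ s, z i u := by
  classical
  induction s using Finset.induction_on with
  | empty => simpa using zero
  | insert i s hi ih =>
    simp only [Finset.sum_insert hi]
    exact (hz i (by simp)).add (ih fun j hj => hz j (by simp [hj]))

lemma norm {z : ℝ → 𝕜} (hz : IsTempered z) : IsTempered fun u => ‖z u‖ :=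
  ⟨hz.1.norm, by simpa using hz.2⟩

lemma shift {z : ℝ → 𝕜} (hz : IsTempered z) (h : ℝ) : IsTempered fun s => z (s - h) := by
  have hm := hz.1
  refine ⟨by fun_prop, ((hz.2.comp_sub_right h).const_mul ((2 * (1 + h ^ 2)) ^ 2)).mono'
    (by fun_prop) (ae_of_all _ fun s => ?_)⟩
  rw [Real.norm_of_nonneg (by positivity), mul_left_comm]
  gcongr
  rw [← div_eq_mul_inv, le_div_iff₀ (by positivity), inv_mul_le_iff₀ (by positivity), ← mul_pow]
  gcongr
  have := one_add_sq_add_le s (-h)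
  rw [neg_sq, ← sub_eq_add_neg] at this
  linarith

lemma locallyIntegrable {z : ℝ → 𝕜} (hz : IsTempered z) : LocallyIntegrable z := by
  have h : LocallyIntegrable
      (fun s => (‖z s‖ * ((1 + s ^ 2) ^ 2)⁻¹) • ((1 + s ^ 2) ^ 2)) (volume : Measure ℝ) :=
    hz.2.locallyIntegrable.smul_continuous (g := fun s : ℝ => (1 + s ^ 2) ^ 2) (by fun_prop)
  have h2 : LocallyIntegrable (fun s => ‖z s‖) (volume : Measure ℝ) := by
    refine h.congr (ae_of_all _ fun s => ?_)
    have : (0 : ℝ) < 1 + s ^ 2 := by positivity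
    simp only [smul_eq_mul]
    field_simp
  exact (h2.mono hz.1.aestronglyMeasurable (ae_of_all _ fun s => by simp))

lemma intervalIntegrable {z : ℝ → 𝕜} (hz : IsTempered z) (a b : ℝ) :
    IntervalIntegrable z volume a b :=
  (hz.locallyIntegrable.integrableOn_isCompact isCompact_uIcc).intervalIntegrable

end IsTempered

/-- Since `1 + s² ≤ 2 (1 + t²) (1 + (t - s)²)`, the decay of `k` at `t - s` dominates the weight at
`s`, up to a constant depending on `t`. -/
lemma integrable_cnv_swap {k z : ℝ → 𝕜} (hk : IsRapid k) (hz : IsTempered z) (t : ℝ) :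
    Integrable fun s => k (t - s) * z s := by
  have hm := hk.1
  have hm' := hz.1
  obtain ⟨C, hC0, hC⟩ := hk.exists_pos
  refine (hz.2.const_mul (C * (2 * (1 + t ^ 2)) ^ 2)).mono' (by fun_prop)
    (ae_of_all _ fun s => ?_)
  rw [norm_mul, mul_comm ‖z s‖, ← mul_assoc]
  gcongr
  refine (hC _).trans ?_
  rw [mul_assoc]
  gcongr
  rw [← div_eq_mul_inv, le_div_iff₀ (by positivity), inv_mul_le_iff₀ (by positivity)]
  have h1 : 1 + s ^ 2 ≤ 2 * (1 + t ^ 2) * (1 + (t - s) ^ 2) := by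
    have := one_add_sq_add_le t (s - t)
    rw [add_sub_cancel, show (s - t) ^ 2 = (t - s) ^ 2 by ring] at this
    exact this
  calc (1 + s ^ 2) ^ 2 ≤ (2 * (1 + t ^ 2) * (1 + (t - s) ^ 2)) ^ 2 := by gcongr
    _ = (1 + (t - s) ^ 2) ^ 2 * (2 * (1 + t ^ 2)) ^ 2 := by ring
    _ ≤ (1 + (t - s) ^ 2) ^ 3 * (2 * (1 + t ^ 2)) ^ 2 := by
      gcongr
      · nlinarith [sq_nonneg (t - s)]
      · norm_num

lemma integrable_cnv {k z : ℝ → 𝕜} (hk : IsRapid k) (hz : IsTempered z) (t : ℝ) :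
    Integrable fun s => k s * z (t - s) := by
  simpa using (integrable_cnv_swap hk hz t).comp_sub_left t

lemma measurable_cnv {k z : ℝ → 𝕜} (hk : Measurable k) (hz : Measurable z) :
    Measurable (cnv k z) := by
  have : StronglyMeasurable (Function.uncurry fun t s : ℝ => k s * z (t - s)) :=
    Measurable.stronglyMeasurable (by
      unfold Function.uncurry
      fun_prop)
  exact this.integral_prod_right.measurable

/-- The weight in `t` splits into a growing weight on `k` and the tempered weight on `z`, so the
integrand is dominated by that of a convolution of two integrable functions. Temperedness of `k * z`
and integrability over strips both come from here. -/
lemma integrable_prod_weight_cnv {k z : ℝ → 𝕜} (hk : IsRapid k) (hz : IsTempered z) :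
    Integrable (fun p : ℝ × ℝ => ((1 + p.1 ^ 2) ^ 2)⁻¹ * ‖k p.2 * z (p.1 - p.2)‖)
      (volume.prod volume) := by
  have hm := hk.1
  have hm' := hz.1
  refine ((hk.integrable_weight.const_mul 4).convolution_integrand (ContinuousLinearMap.mul ℝ ℝ)
    hz.2).mono' (Measurable.aestronglyMeasurable (by fun_prop)) (ae_of_all _ fun p => ?_)
  obtain ⟨t, s⟩ := p
  simp only [ContinuousLinearMap.mul_apply']
  rw [Real.norm_of_nonneg (by positivity), norm_mul,
    show 4 * ((1 + s ^ 2) ^ 2 * ‖k s‖) * (‖z (t - s)‖ * ((1 + (t - s) ^ 2) ^ 2)⁻¹)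
      = 4 * (1 + s ^ 2) ^ 2 * ((1 + (t - s) ^ 2) ^ 2)⁻¹ * (‖k s‖ * ‖z (t - s)‖) by ring]
  gcongr
  rw [← div_eq_mul_inv, le_div_iff₀ (by positivity), inv_mul_le_iff₀ (by positivity)]
  have h1 := one_add_sq_add_le t (-s)
  rw [neg_sq, ← sub_eq_add_neg] at h1
  calc (1 + (t - s) ^ 2) ^ 2 ≤ (2 * (1 + t ^ 2) * (1 + s ^ 2)) ^ 2 := by gcongr
    _ = _ := by ring

lemma IsTempered.cnv {k z : ℝ → 𝕜} (hk : IsRapid k) (hz : IsTempered z) :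
    IsTempered (cnv k z) := by
  have hmc := measurable_cnv hk.1 hz.1
  refine ⟨hmc, (integrable_prod_weight_cnv hk hz).integral_prod_left.mono' (by fun_prop)
    (ae_of_all _ fun t => ?_)⟩
  rw [Real.norm_of_nonneg (by positivity), mul_comm]
  simp only
  rw [integral_const_mul]
  gcongr
  exact norm_integral_le_integral_norm _

lemma integrableOn_prod_cnv {k z : ℝ → 𝕜} (hk : IsRapid k) (hz : IsTempered z) (a b : ℝ)
    {S : Set ℝ} (hS : MeasurableSet S) :
    IntegrableOn (fun p : ℝ × ℝ => k p.2 * z (p.1 - p.2)) (Set.Ioc a b ×ˢ S)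
      (volume.prod volume) := by
  have hm := hk.1
  have hm' := hz.1
  have h1 := ((integrable_prod_weight_cnv hk hz).const_mul ((1 + (|a| + |b|) ^ 2) ^ 2)).integrableOn
    (s := Set.Ioc a b ×ˢ S)
  refine h1.mono' (Measurable.aestronglyMeasurable (by fun_prop)) ?_
  filter_upwards [ae_restrict_mem (measurableSet_Ioc.prod hS)] with p hp
  rw [← mul_assoc]
  refine le_mul_of_one_le_left (norm_nonneg _) ?_
  rw [← div_eq_mul_inv, one_le_div (by positivity)]
  gcongr (1 + ?_) ^ 2
  rw [sq_le_sq, abs_of_nonneg (add_nonneg (abs_nonneg a) (abs_nonneg b))]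
  have h2 := hp.1.1
  have h3 := hp.1.2
  refine abs_le.2 ⟨?_, ?_⟩
  · linarith [neg_abs_le a, abs_nonneg b]
  · linarith [le_abs_self b, abs_nonneg a]

/-- Either `s` or `t - s` is of the order of `t`, so one of the two decay factors yields the decay
in `t` and the other stays integrable. The constant is `32 = 2³ · 4`, from `(a + b)³ ≤ 4 (a³ + b³)`.
-/
lemma IsRapid.cnv {k l : ℝ → 𝕜} (hk : IsRapid k) (hl : IsRapid l) : IsRapid (cnv k l) := by
  obtain ⟨C, hC0, hC⟩ := hk.exists_pos
  obtain ⟨D, hD0, hD⟩ := hl.exists_pos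
  have hW := integrable_inv_one_add_sq_pow 2
  refine ⟨measurable_cnv hk.1 hl.1,
    C * D * 32 * ((∫ u : ℝ, ((1 + u ^ 2) ^ 3)⁻¹) + ∫ u : ℝ, ((1 + u ^ 2) ^ 3)⁻¹), fun t => ?_⟩
  have key : ∀ s, ‖k s * l (t - s)‖ ≤ C * D * 32 *
      (((1 + s ^ 2) ^ 3)⁻¹ + ((1 + (t - s) ^ 2) ^ 3)⁻¹) * ((1 + t ^ 2) ^ 3)⁻¹ := by
    intro s
    rw [norm_mul]
    refine (mul_le_mul (hC s) (hD _) (norm_nonneg _) (by positivity)).trans ?_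
    have ha : (0 : ℝ) < 1 + s ^ 2 := by positivity
    have hb : (0 : ℝ) < 1 + (t - s) ^ 2 := by positivity
    have ht : (0 : ℝ) < 1 + t ^ 2 := by positivity
    have h1 : 1 + t ^ 2 ≤ 2 * ((1 + s ^ 2) + (1 + (t - s) ^ 2)) := by
      nlinarith [sq_nonneg (s - (t - s))]
    have h2 : (1 + t ^ 2) ^ 3 ≤ 32 * ((1 + s ^ 2) ^ 3 + (1 + (t - s) ^ 2) ^ 3) := by
      generalize 1 + s ^ 2 = a at *
      generalize 1 + (t - s) ^ 2 = b at *
      calc (1 + t ^ 2) ^ 3 ≤ (2 * (a + b)) ^ 3 := by gcongr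
        _ ≤ 32 * (a ^ 3 + b ^ 3) := by
          nlinarith [mul_nonneg (add_pos ha hb).le (sq_nonneg (a - b))]
    rw [show C * D * 32 * (((1 + s ^ 2) ^ 3)⁻¹ + ((1 + (t - s) ^ 2) ^ 3)⁻¹) * ((1 + t ^ 2) ^ 3)⁻¹
      = C * D * ((((1 + s ^ 2) ^ 3)⁻¹ * ((1 + (t - s) ^ 2) ^ 3)⁻¹) *
        ((32 * ((1 + s ^ 2) ^ 3 + (1 + (t - s) ^ 2) ^ 3)) / (1 + t ^ 2) ^ 3)) by
        field_simp; ring]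
    rw [show C * ((1 + s ^ 2) ^ 3)⁻¹ * (D * ((1 + (t - s) ^ 2) ^ 3)⁻¹)
      = C * D * (((1 + s ^ 2) ^ 3)⁻¹ * ((1 + (t - s) ^ 2) ^ 3)⁻¹) by ring]
    refine mul_le_mul_of_nonneg_left ?_ (by positivity)
    refine le_mul_of_one_le_right (by positivity) ?_
    rw [one_le_div (by positivity)]
    exact h2
  have hi : Integrable fun s : ℝ => C * D * 32 *
      (((1 + s ^ 2) ^ 3)⁻¹ + ((1 + (t - s) ^ 2) ^ 3)⁻¹) * ((1 + t ^ 2) ^ 3)⁻¹ :=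
    ((hW.add (hW.comp_sub_left t)).const_mul _).mul_const _
  refine (norm_integral_le_of_norm_le hi (ae_of_all _ key)).trans_eq ?_
  rw [integral_mul_const, integral_const_mul, integral_add hW (hW.comp_sub_left t),
    integral_sub_left_eq_self (fun u : ℝ => ((1 + u ^ 2) ^ (2 + 1))⁻¹)]

lemma cnv_assoc {k l z : ℝ → 𝕜} (hk : IsRapid k) (hl : IsRapid l) (hz : IsTempered z) :
    cnv (cnv k l) z = cnv k (cnv l z) := by
  funext t
  have := convolution_assoc (μ := volume) (ν := volume) (f := k) (g := l) (k := z)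
    (ContinuousLinearMap.mul 𝕜 𝕜) (ContinuousLinearMap.mul 𝕜 𝕜) (ContinuousLinearMap.mul 𝕜 𝕜)
    (ContinuousLinearMap.mul 𝕜 𝕜) (fun x y z => mul_assoc x y z) (x₀ := t)
    hk.1.aestronglyMeasurable hl.1.aestronglyMeasurable hz.1.aestronglyMeasurable
    (ae_of_all _ fun y => integrable_cnv hk hl.isTempered y)
    (ae_of_all _ fun y => integrable_cnv hl.norm hz.norm y)
    (integrable_cnv hk.norm (IsTempered.cnv hl.norm hz.norm) t)
  exact this

lemma cnv_comm (k l : ℝ → 𝕜) : cnv k l = cnv l k := by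
  funext t
  rw [cnv_swap]
  exact integral_congr_ae (ae_of_all _ fun s => mul_comm _ _)

lemma cnv_congr_ae {k l z : ℝ → 𝕜} (h : k =ᵐ[volume] l) : cnv k z = cnv l z := by
  funext t
  exact integral_congr_ae (h.mono fun s hs => by simp only [hs])

lemma cnv_congr_ae_right {k y z : ℝ → 𝕜} (h : y =ᵐ[volume] z) : cnv k y = cnv k z := by
  rw [cnv_comm, cnv_comm k]; exact cnv_congr_ae h

lemma cnv_add_left {k l z : ℝ → 𝕜} (hk : IsRapid k) (hl : IsRapid l) (hz : IsTempered z) (t : ℝ) :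
    cnv (fun u => k u + l u) z t = cnv k z t + cnv l z t := by
  simp only [cnv, add_mul]
  exact integral_add (integrable_cnv hk hz t) (integrable_cnv hl hz t)

lemma cnv_add_right {k y z : ℝ → 𝕜} (hk : IsRapid k) (hy : IsTempered y) (hz : IsTempered z)
    (t : ℝ) : cnv k (fun u => y u + z u) t = cnv k y t + cnv k z t := by
  simp only [cnv, mul_add]
  exact integral_add (integrable_cnv hk hy t) (integrable_cnv hk hz t)

lemma cnv_const_mul_left (k z : ℝ → 𝕜) (c : 𝕜) (t : ℝ) :
    cnv (fun u => c * k u) z t = c * cnv k z t := by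
  simp only [cnv, mul_assoc, integral_const_mul]

lemma cnv_const_mul_right (k z : ℝ → 𝕜) (c : 𝕜) (t : ℝ) :
    cnv k (fun u => c * z u) t = c * cnv k z t := by
  simp only [cnv, mul_left_comm, integral_const_mul]

lemma cnv_sub_left {k l z : ℝ → 𝕜} (hk : IsRapid k) (hl : IsRapid l) (hz : IsTempered z) (t : ℝ) :
    cnv (fun u => k u - l u) z t = cnv k z t - cnv l z t := by
  simp only [cnv, sub_mul]
  exact integral_sub (integrable_cnv hk hz t) (integrable_cnv hl hz t)

lemma cnv_sub_right {k y z : ℝ → 𝕜} (hk : IsRapid k) (hy : IsTempered y) (hz : IsTempered z)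
    (t : ℝ) : cnv k (fun u => y u - z u) t = cnv k y t - cnv k z t := by
  simp only [cnv, mul_sub]
  exact integral_sub (integrable_cnv hk hy t) (integrable_cnv hk hz t)

lemma cnv_sum_left {ι : Type*} (s : Finset ι) {k : ι → ℝ → 𝕜} {z : ℝ → 𝕜}
    (hk : ∀ i ∈ s, IsRapid (k i)) (hz : IsTempered z) (t : ℝ) :
    cnv (fun u => ∑ i ∈ s, k i u) z t = ∑ i ∈ s, cnv (k i) z t := by
  simp only [cnv, Finset.sum_mul]
  exact integral_finsetSum s fun i hi => integrable_cnv (hk i hi) hz t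

lemma cnv_sum_right {ι : Type*} (s : Finset ι) {k : ℝ → 𝕜} {z : ι → ℝ → 𝕜}
    (hk : IsRapid k) (hz : ∀ i ∈ s, IsTempered (z i)) (t : ℝ) :
    cnv k (fun u => ∑ i ∈ s, z i u) t = ∑ i ∈ s, cnv k (z i) t := by
  simp only [cnv, Finset.mul_sum]
  exact integral_finsetSum s fun i hi => integrable_cnv hk (hz i hi) t

lemma cnv_shift (k z : ℝ → 𝕜) (h t : ℝ) : cnv k (fun s => z (s - h)) t = cnv k z (t - h) := by
  simp only [cnv]
  exact integral_congr_ae (ae_of_all _ fun s => by simp only [sub_right_comm])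

lemma cnv_shift_left (k z : ℝ → 𝕜) (h t : ℝ) :
    cnv (fun s => k (s - h)) z t = cnv k z (t - h) := by
  rw [cnv_comm, cnv_shift, cnv_comm]

lemma IsRapid.shift {k : ℝ → 𝕜} (hk : IsRapid k) (h : ℝ) : IsRapid fun s => k (s - h) := by
  have hm := hk.1
  obtain ⟨C, hC0, hC⟩ := hk.exists_pos
  refine ⟨by fun_prop, C * (2 * (1 + h ^ 2)) ^ 3, fun s => (hC _).trans ?_⟩
  rw [mul_assoc]
  gcongr
  rw [← div_eq_mul_inv, le_div_iff₀ (by positivity), inv_mul_le_iff₀ (by positivity), ← mul_pow]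
  gcongr
  have := one_add_sq_add_le (s - h) h
  rw [sub_add_cancel] at this
  linarith

end Kernels

/-! ### Fourier transforms of rapid kernels and of rational functions -/

section FourierTransform

/-- The Fourier transform `∫ e^{iyu} k(u) du`. -/
def ft (k : ℝ → ℂ) (y : ℝ) : ℂ := ∫ u : ℝ, Complex.exp (Complex.I * y * u) * k u

lemma norm_exp_I_mul_mul (y u : ℝ) : ‖Complex.exp (Complex.I * y * u)‖ = 1 := by
  rw [show Complex.I * (y : ℂ) * u = ((y * u : ℝ) : ℂ) * Complex.I by push_cast; ring]
  exact Complex.norm_exp_ofReal_mul_I _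

lemma integrable_exp_mul {k : ℝ → ℂ} (hk : Integrable k) (y : ℝ) :
    Integrable fun u : ℝ => Complex.exp (Complex.I * y * u) * k u :=
  hk.bdd_mul (c := 1) (by fun_prop) (ae_of_all _ fun u => (norm_exp_I_mul_mul y u).le)

lemma ft_add {k l : ℝ → ℂ} (hk : Integrable k) (hl : Integrable l) (y : ℝ) :
    ft (fun u => k u + l u) y = ft k y + ft l y := by
  simp only [ft, mul_add]
  exact integral_add (integrable_exp_mul hk y) (integrable_exp_mul hl y)

lemma ft_sub {k l : ℝ → ℂ} (hk : Integrable k) (hl : Integrable l) (y : ℝ) :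
    ft (fun u => k u - l u) y = ft k y - ft l y := by
  simp only [ft, mul_sub]
  exact integral_sub (integrable_exp_mul hk y) (integrable_exp_mul hl y)

lemma ft_const_mul (k : ℝ → ℂ) (c : ℂ) (y : ℝ) : ft (fun u => c * k u) y = c * ft k y := by
  simp only [ft, mul_left_comm, integral_const_mul]

lemma ft_sum {ι : Type*} (s : Finset ι) {k : ι → ℝ → ℂ} (hk : ∀ i ∈ s, Integrable (k i)) (y : ℝ) :
    ft (fun u => ∑ i ∈ s, k i u) y = ∑ i ∈ s, ft (k i) y := by
  simp only [ft, Finset.mul_sum]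
  exact integral_finsetSum s fun i hi => integrable_exp_mul (hk i hi) y

lemma ft_congr_ae {k l : ℝ → ℂ} (h : k =ᵐ[volume] l) (y : ℝ) : ft k y = ft l y :=
  integral_congr_ae (h.mono fun u hu => by simp only [hu])

lemma ft_shift (k : ℝ → ℂ) (h y : ℝ) :
    ft (fun u => k (u - h)) y = Complex.exp (Complex.I * y * h) * ft k y := by
  simp only [ft]
  rw [← integral_const_mul,
    ← integral_add_right_eq_self (fun u : ℝ => Complex.exp (Complex.I * y * u) * k (u - h)) h]
  refine integral_congr_ae (ae_of_all _ fun u => ?_)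
  simp only [add_sub_cancel_right, ← mul_assoc, ← Complex.exp_add]
  congr 2
  push_cast
  ring

/-- Dictionary between the convention `e^{iyu}` and the one with `e^{-2πi}`, so that the convolution
theorem can be borrowed. -/
lemma ft_eq_fourier (k : ℝ → ℂ) (y : ℝ) :
    ft k y = FourierTransform.fourier k (-y / (2 * Real.pi)) := by
  rw [Real.fourier_real_eq_integral_exp_smul, ft]
  refine integral_congr_ae (ae_of_all _ fun u => ?_)
  simp only [smul_eq_mul]
  congr 2
  have : (Real.pi : ℂ) ≠ 0 := by exact_mod_cast Real.pi_ne_zero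
  push_cast
  field_simp

lemma ft_cnv {k l : ℝ → ℂ} (hk : Integrable k) (hl : Integrable l) (y : ℝ) :
    ft (cnv k l) y = ft k y * ft l y := by
  simp only [ft_eq_fourier]
  exact Real.fourier_mul_convolution_eq hk hl _

lemma continuous_ft {k : ℝ → ℂ} (hk : Integrable k) : Continuous (ft k) := by
  refine continuous_of_dominated (fun y => (integrable_exp_mul hk y).1)
    (fun y => ae_of_all _ fun u => ?_) hk.norm (ae_of_all _ fun u => by fun_prop)
  rw [norm_mul, norm_exp_I_mul_mul, one_mul]

lemma ofReal_cnv (k l : ℝ → ℝ) (t : ℝ) :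
    ((cnv k l t : ℝ) : ℂ) = cnv (fun u => (k u : ℂ)) (fun u => (l u : ℂ)) t := by
  simp only [cnv]
  rw [← integral_complex_ofReal]
  push_cast
  rfl

/-- The Fourier transform of a real function. -/
def rft (k : ℝ → ℝ) (y : ℝ) : ℂ := ft (fun u => (k u : ℂ)) y

lemma fourierMat_apply {n : ℕ} (f : ℝ → Mat n) (y : ℝ) (a b : Fin n) :
    fourierMat f y a b = rft (fun u => f u a b) y := rfl

lemma rft_add {k l : ℝ → ℝ} (hk : Integrable k) (hl : Integrable l) (y : ℝ) :
    rft (fun u => k u + l u) y = rft k y + rft l y := by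
  simp only [rft, Complex.ofReal_add]
  exact ft_add hk.ofReal hl.ofReal y

lemma rft_sub {k l : ℝ → ℝ} (hk : Integrable k) (hl : Integrable l) (y : ℝ) :
    rft (fun u => k u - l u) y = rft k y - rft l y := by
  simp only [rft, Complex.ofReal_sub]
  exact ft_sub hk.ofReal hl.ofReal y

lemma rft_const_mul (k : ℝ → ℝ) (c : ℝ) (y : ℝ) : rft (fun u => c * k u) y = c * rft k y := by
  simp only [rft, Complex.ofReal_mul]
  exact ft_const_mul _ _ y

lemma rft_sum {ι : Type*} (s : Finset ι) {k : ι → ℝ → ℝ} (hk : ∀ i ∈ s, Integrable (k i)) (y : ℝ) :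
    rft (fun u => ∑ i ∈ s, k i u) y = ∑ i ∈ s, rft (k i) y := by
  simp only [rft, Complex.ofReal_sum]
  exact ft_sum s (fun i hi => (hk i hi).ofReal) y

lemma rft_shift (k : ℝ → ℝ) (h y : ℝ) :
    rft (fun u => k (u - h)) y = Complex.exp (Complex.I * y * h) * rft k y :=
  ft_shift (fun u => (k u : ℂ)) h y

lemma rft_cnv {k l : ℝ → ℝ} (hk : Integrable k) (hl : Integrable l) (y : ℝ) :
    rft (cnv k l) y = rft k y * rft l y := by
  simp only [rft, ofReal_cnv]
  exact ft_cnv hk.ofReal hl.ofReal y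

lemma continuous_rft {k : ℝ → ℝ} (hk : Integrable k) : Continuous (rft k) :=
  continuous_ft hk.ofReal

lemma charFun_withDensity {k : ℝ → ℝ} (hk : Measurable k) (h0 : ∀ u, 0 ≤ k u) (y : ℝ) :
    charFun (volume.withDensity fun u => ENNReal.ofReal (k u)) y = rft k y := by
  rw [charFun_apply_real, integral_withDensity_eq_integral_toReal_smul (by fun_prop)
    (ae_of_all _ fun u => ENNReal.ofReal_lt_top), rft, ft]
  refine integral_congr_ae (ae_of_all _ fun u => ?_)
  simp only [ENNReal.toReal_ofReal (h0 u), Complex.real_smul]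
  rw [mul_comm]
  congr 2
  ring

/-- The positive and negative parts are densities of finite measures with equal characteristic
functions. The value at `y = 0` is recovered by continuity; leaving it out of the hypothesis allows
division by `-iy` in later identities. -/
lemma ae_eq_zero_of_rft {k : ℝ → ℝ} (hk : Integrable k) (h : ∀ y, y ≠ 0 → rft k y = 0) :
    k =ᵐ[volume] 0 := by
  wlog hm : Measurable k generalizing k
  · obtain ⟨l, hl, hkl⟩ := hk.1.aemeasurable
    have := this (hk.congr hkl) (fun y hy => ?_) hl
    · exact hkl.trans this
    · rw [← h y hy]
      exact (ft_congr_ae (hkl.mono fun u hu => by simp only [hu]) y).symm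
  have h' : ∀ y, rft k y = 0 := by
    have hd : Dense ({0}ᶜ : Set ℝ) := dense_compl_singleton 0
    exact fun y => congrFun ((continuous_rft hk).ext_on hd continuous_const h) y
  set p : ℝ → ℝ := fun u => max (k u) 0 with hp
  set q : ℝ → ℝ := fun u => max (-k u) 0 with hq
  have hpi : Integrable p := hk.pos_part
  have hqi : Integrable q := hk.neg_part
  have hpm : Measurable p := hm.max measurable_const
  have hqm : Measurable q := hm.neg.max measurable_const
  have hpq : ∀ u, k u = p u - q u := fun u => (max_zero_sub_max_neg_zero_eq_self (k u)).symm
  have := isFiniteMeasure_withDensity_ofReal hpi.2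
  have := isFiniteMeasure_withDensity_ofReal hqi.2
  have heq : (volume.withDensity fun u => ENNReal.ofReal (p u))
      = volume.withDensity fun u => ENNReal.ofReal (q u) := by
    refine Measure.ext_of_charFun (funext fun y => ?_)
    rw [charFun_withDensity hpm (fun u => le_max_right _ _),
      charFun_withDensity hqm (fun u => le_max_right _ _), ← sub_eq_zero, ← rft_sub hpi hqi, ← h' y]
    congr 1
    funext u
    exact (hpq u).symm
  rw [withDensity_eq_iff_of_sigmaFinite (by fun_prop) (by fun_prop)] at heq
  filter_upwards [heq] with u hu
  rw [ENNReal.ofReal_eq_ofReal_iff (le_max_right _ _) (le_max_right _ _)] at hu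
  rw [hpq u, Pi.zero_apply, sub_eq_zero]
  exact hu

lemma ae_eq_of_rft {k l : ℝ → ℝ} (hk : Integrable k) (hl : Integrable l)
    (h : ∀ y, y ≠ 0 → rft k y = rft l y) : k =ᵐ[volume] l := by
  have := ae_eq_zero_of_rft (hk.sub hl) fun y hy => by
    have h1 := rft_sub hk hl y
    rw [h y hy, sub_self] at h1
    exact h1
  filter_upwards [this] with u hu
  exact sub_eq_zero.1 hu

/-- The indicator function of `[0, h)`. -/
def box (h : ℝ) : ℝ → ℝ := Set.indicator (Set.Ico 0 h) 1

lemma isRapid_box (h : ℝ) : IsRapid (box h) := by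
  refine IsRapid.of_bounded_of_support (measurable_one.indicator measurableSet_Ico) (C := 1)
    (a := |h|) (fun u => ?_) fun u hu => ?_
  · unfold box Set.indicator
    split_ifs <;> simp
  · refine Set.indicator_of_notMem (fun hm => ?_) _
    rw [abs_of_nonneg hm.1] at hu
    linarith [hm.2, le_abs_self h]

/-- Convolution with `box h` integrates over `(t - h, t]`. In terms of transforms: differentiating
and then integrating gives the difference over a step `h`. -/
lemma rft_box {h : ℝ} (hh : 0 ≤ h) {y : ℝ} (hy : y ≠ 0) :
    -(Complex.I * y) * rft (box h) y = 1 - Complex.exp (Complex.I * y * h) := by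
  have hy' : Complex.I * (y : ℂ) ≠ 0 := mul_ne_zero Complex.I_ne_zero (by exact_mod_cast hy)
  have : rft (box h) y = ∫ u in (0 : ℝ)..h, Complex.exp (Complex.I * y * u) := by
    rw [intervalIntegral.integral_of_le hh, ← integral_Ico_eq_integral_Ioc,
      ← integral_indicator measurableSet_Ico, rft, ft]
    refine integral_congr_ae (ae_of_all _ fun u => ?_)
    by_cases hu : u ∈ Set.Ico 0 h
    · simp [box, hu]
    · simp [box, hu]
  rw [this, integral_exp_mul_complex hy']
  rw [neg_mul, mul_div_cancel₀ _ hy']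
  simp

lemma cnv_box (z : ℝ → ℝ) {h : ℝ} (hh : 0 ≤ h) (t : ℝ) :
    cnv (box h) z t = ∫ u in (t - h)..t, z u := by
  have h1 : cnv (box h) z t = ∫ u in (0 : ℝ)..h, z (t - u) := by
    rw [intervalIntegral.integral_of_le hh, ← integral_Ico_eq_integral_Ioc,
      ← integral_indicator measurableSet_Ico, cnv]
    refine integral_congr_ae (ae_of_all _ fun u => ?_)
    by_cases hu : u ∈ Set.Ico 0 h
    · simp [box, hu]
    · simp [box, hu]
  rw [h1, intervalIntegral.integral_comp_sub_left (fun u => z u), sub_zero]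

lemma exists_pow_mul_exp_le {δ : ℝ} (hδ : 0 < δ) :
    ∃ C : ℝ, ∀ u : ℝ, 0 ≤ u → Real.exp (-(δ * u)) ≤ C * ((1 + u ^ 2) ^ 3)⁻¹ := by
  have hc : Continuous fun u : ℝ => (1 + u ^ 2) ^ 3 * Real.exp (-(δ * u)) := by fun_prop
  have ht : Tendsto (fun u : ℝ => (1 + u ^ 2) ^ 3 * Real.exp (-(δ * u))) atTop (nhds 0) := by
    have h : ∀ m : ℕ, Tendsto (fun u : ℝ => u ^ m * Real.exp (-δ * u)) atTop (nhds 0) := fun m => by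
      have := tendsto_rpow_mul_exp_neg_mul_atTop_nhds_zero (m : ℝ) δ hδ
      simpa only [Real.rpow_natCast] using this
    have := (((h 0).add ((h 2).const_mul 3)).add ((h 4).const_mul 3)).add (h 6)
    simp only [mul_zero, add_zero] at this
    refine this.congr fun u => ?_
    rw [neg_mul]
    ring
  obtain ⟨C₁, hC₁⟩ : ∃ C₁, ∀ᶠ u in atTop, (1 + u ^ 2) ^ 3 * Real.exp (-(δ * u)) ≤ C₁ :=
    ⟨1, ht.eventually_le_const one_pos⟩
  obtain ⟨a, ha⟩ := eventually_atTop.1 hC₁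
  obtain ⟨C₂, hC₂⟩ := (isCompact_Icc (a := 0) (b := a)).bddAbove_image hc.continuousOn
  refine ⟨max C₁ C₂, fun u hu => ?_⟩
  rw [← div_eq_mul_inv, le_div_iff₀ (by positivity), mul_comm]
  rcases le_total a u with h | h
  · exact (ha u h).trans (le_max_left _ _)
  · exact (hC₂ ⟨u, ⟨hu, h⟩, rfl⟩).trans (le_max_right _ _)

/-- A rapidly decreasing function with Fourier transform `(-iy - c)⁻¹`, which is causal if
`Re c < 0`. -/
lemma exists_isRapid_ft_inv {c : ℂ} (hc : c.re ≠ 0) :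
    ∃ k : ℝ → ℂ, IsRapid k ∧ (c.re < 0 → ∀ u < 0, k u = 0) ∧
      ∀ y : ℝ, ft k y = (-(Complex.I * y) - c)⁻¹ := by
  have hexp : ∀ u : ℝ, ‖Complex.exp (c * u)‖ = Real.exp (c.re * u) := fun u => by
    rw [Complex.norm_exp]; simp
  rcases lt_or_gt_of_ne hc with h | h
  · obtain ⟨C, hC⟩ := exists_pow_mul_exp_le (neg_pos.2 h)
    have hC0 : 0 ≤ C := by simpa using (Real.exp_pos _).le.trans (hC 0 le_rfl)
    refine ⟨Set.indicator (Set.Ici 0) fun u : ℝ => Complex.exp (c * u), ⟨?_, C, fun u => ?_⟩,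
      fun _ u hu => Set.indicator_of_notMem (by simpa using hu) _, fun y => ?_⟩
    · exact Measurable.indicator (by fun_prop) measurableSet_Ici
    · by_cases hu : 0 ≤ u
      · rw [Set.indicator_of_mem (show u ∈ Set.Ici 0 from hu), hexp]
        simpa using hC u hu
      · rw [Set.indicator_of_notMem (by simpa using hu), norm_zero]
        positivity
    · have hre : (Complex.I * y + c).re < 0 := by simpa using h
      have := integral_exp_mul_complex_Ioi hre 0
      rw [Complex.ofReal_zero, mul_zero, Complex.exp_zero] at this
      rw [show -(Complex.I * (y : ℂ)) - c = -(Complex.I * y + c) by ring, inv_neg, ← one_div,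
        ← neg_div, ← this, ← integral_Ici_eq_integral_Ioi, ← integral_indicator measurableSet_Ici, ft]
      refine integral_congr_ae (ae_of_all _ fun u => ?_)
      by_cases hu : u ∈ Set.Ici (0 : ℝ)
      · simp only [Set.indicator_of_mem hu, ← Complex.exp_add, ← add_mul]
      · simp only [Set.indicator_of_notMem hu, mul_zero]
  · obtain ⟨C, hC⟩ := exists_pow_mul_exp_le h
    have hC0 : 0 ≤ C := by simpa using (Real.exp_pos _).le.trans (hC 0 le_rfl)
    -- A pole in the right half-plane forces the anticausal exponential on `(-∞, 0]`.
    refine ⟨Set.indicator (Set.Iic 0) fun u : ℝ => -Complex.exp (c * u), ⟨?_, C, fun u => ?_⟩,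
      fun h' => absurd h' h.not_gt, fun y => ?_⟩
    · exact Measurable.indicator (by fun_prop) measurableSet_Iic
    · by_cases hu : u ≤ 0
      · rw [Set.indicator_of_mem (show u ∈ Set.Iic 0 from hu), norm_neg, hexp]
        simpa using hC (-u) (by linarith)
      · rw [Set.indicator_of_notMem (by simpa using hu), norm_zero]
        positivity
    · have hre : 0 < (Complex.I * y + c).re := by simpa using h
      have := integral_exp_mul_complex_Iic hre 0
      rw [Complex.ofReal_zero, mul_zero, Complex.exp_zero] at this
      rw [show -(Complex.I * (y : ℂ)) - c = -(Complex.I * y + c) by ring, inv_neg, ← one_div,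
        ← this, ← integral_neg, ← integral_indicator measurableSet_Iic, ft]
      refine integral_congr_ae (ae_of_all _ fun u => ?_)
      by_cases hu : u ∈ Set.Iic (0 : ℝ)
      · simp only [Set.indicator_of_mem hu, mul_neg, ← Complex.exp_add, ← add_mul]
      · simp only [Set.indicator_of_notMem hu, mul_zero]

lemma cnv_causal {k l : ℝ → ℂ} (hk : ∀ u < 0, k u = 0) (hl : ∀ u < 0, l u = 0) :
    ∀ u < 0, cnv k l u = 0 := by
  intro u hu
  rw [cnv, ← integral_zero ℝ ℂ (μ := volume)]
  refine integral_congr_ae (ae_of_all _ fun s => ?_)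
  rcases lt_or_ge s 0 with h | h
  · simp only [hk s h, zero_mul]
  · simp only [hl (u - s) (by linarith), mul_zero]

/-- Strictly proper rational functions without imaginary poles are Fourier transforms of rapidly
decreasing functions. -/
lemma exists_isRapid_ft_multiset (s : Multiset ℂ) (hs : ∀ c ∈ s, c.re ≠ 0) (N : Polynomial ℂ)
    (hN : N.degree < (Multiset.card s : WithBot ℕ)) :
    ∃ k : ℝ → ℂ, IsRapid k ∧ ((∀ c ∈ s, c.re < 0) → ∀ u < 0, k u = 0) ∧
      ∀ y : ℝ, ft k y = N.eval (-(Complex.I * y)) / (s.map fun c => -(Complex.I * y) - c).prod := by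
  induction s using Multiset.induction_on generalizing N with
  | empty =>
    have : N = 0 := by
      rw [← Polynomial.degree_eq_bot]
      by_contra h
      rw [Polynomial.degree_eq_natDegree (by rwa [Ne, ← Polynomial.degree_eq_bot])] at hN
      simp at hN
    subst this
    exact ⟨fun _ => 0, IsRapid.zero, fun _ _ _ => rfl, fun y => by simp [ft]⟩
  | cons c s ih =>
    obtain ⟨e, he, hec, hef⟩ := exists_isRapid_ft_inv (hs c (by simp))
    set D : Polynomial ℂ := (s.map fun c => Polynomial.X - Polynomial.C c).prod with hD
    have hDm : D.Monic := Polynomial.monic_multiset_prod_of_monic _ _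
      fun c _ => Polynomial.monic_X_sub_C c
    have hDd : D.degree = (Multiset.card s : WithBot ℕ) := by
      rw [Polynomial.degree_eq_natDegree hDm.ne_zero, hD,
        Polynomial.natDegree_multiset_prod_X_sub_C_eq_card]
    have hDe : ∀ z : ℂ, D.eval z = (s.map fun c => z - c).prod := fun z => by
      rw [hD, Polynomial.eval_multiset_prod, Multiset.map_map]
      simp
    have hmod : (N %ₘ D).degree < (Multiset.card s : WithBot ℕ) :=
      hDd ▸ Polynomial.degree_modByMonic_lt N hDm
    obtain ⟨a, ha⟩ : ∃ a, N /ₘ D = Polynomial.C a := by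
      refine ⟨_, Polynomial.eq_C_of_natDegree_le_zero ?_⟩
      rw [Polynomial.natDegree_divByMonic _ hDm, hD,
        Polynomial.natDegree_multiset_prod_X_sub_C_eq_card]
      have : N.natDegree < Multiset.card s + 1 := by
        rcases eq_or_ne N 0 with rfl | h0
        · simp
        · rw [Polynomial.degree_eq_natDegree h0, Multiset.card_cons] at hN
          exact_mod_cast hN
      omega
    obtain ⟨l, hl, hlc, hlf⟩ := ih (fun c hc => hs c (by simp [hc])) (N %ₘ D) hmod
    refine ⟨fun u => a * e u + cnv l e u, (he.const_mul a).add (hl.cnv he), fun hneg u hu => ?_,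
      fun y => ?_⟩
    · beta_reduce
      rw [hec (hneg c (by simp)) u hu,
        cnv_causal (hlc fun c hc => hneg c (by simp [hc])) (hec (hneg c (by simp))) u hu]
      simp
    · rw [ft_add (he.const_mul a).integrable (hl.cnv he).integrable, ft_const_mul,
        ft_cnv hl.integrable he.integrable, hlf, hef, Multiset.map_cons, Multiset.prod_cons]
      have hne : ∀ c : ℂ, c.re ≠ 0 → -(Complex.I * (y : ℂ)) - c ≠ 0 := fun c hc h0 => by
        apply hc
        have := congrArg Complex.re h0
        simpa using this
      have h1 := hne c (hs c (by simp))
      have h2 : (s.map fun c => -(Complex.I * (y : ℂ)) - c).prod ≠ 0 := by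
        rw [Ne, Multiset.prod_eq_zero_iff, Multiset.mem_map]
        rintro ⟨c', hc', h0⟩
        exact hne c' (hs c' (by simp [hc'])) h0
      have h3 := congrArg (Polynomial.eval (-(Complex.I * (y : ℂ))))
        (Polynomial.modByMonic_add_div N D)
      rw [Polynomial.eval_add, Polynomial.eval_mul, hDe, ha, Polynomial.eval_C] at h3
      rw [← h3]
      field_simp
      ring

/-- The real version of `exists_isRapid_ft_multiset`. -/
lemma exists_isRapid_rft_rational (N D : Polynomial ℝ) (hND : N.degree < D.degree)
    (hD : ∀ y : ℝ, Polynomial.aeval (Complex.I * y) D ≠ 0) :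
    ∃ k : ℝ → ℝ, IsRapid k ∧
      ((∀ z : ℂ, 0 ≤ z.re → Polynomial.aeval z D ≠ 0) → ∀ u < 0, k u = 0) ∧
      ∀ y : ℝ, rft k y = Polynomial.aeval (-(Complex.I * (y : ℂ))) N /
        Polynomial.aeval (-(Complex.I * (y : ℂ))) D := by
  have hD0 : D ≠ 0 := by rintro rfl; simpa using hD 0
  set E : Polynomial ℂ := D.map (algebraMap ℝ ℂ) with hE
  have hE0 : E ≠ 0 := by
    rw [hE, Ne, Polynomial.map_eq_zero_iff (algebraMap ℝ ℂ).injective]; exact hD0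
  have haev : ∀ (p : Polynomial ℝ) (z : ℂ),
      Polynomial.aeval z p = (p.map (algebraMap ℝ ℂ)).eval z :=
    fun p z => by rw [Polynomial.aeval_def, Polynomial.eval_map]
  have hsplit := IsAlgClosed.splits E
  have hcard : (Multiset.card E.roots : WithBot ℕ) = D.degree := by
    rw [← Polynomial.degree_map D (algebraMap ℝ ℂ), Polynomial.degree_eq_natDegree hE0,
      hsplit.natDegree_eq_card_roots]
  have hEe : ∀ z : ℂ, E.eval z = E.leadingCoeff * (E.roots.map fun c => z - c).prod := fun z => by
    conv_lhs => rw [hsplit.eq_prod_roots]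
    rw [Polynomial.eval_mul, Polynomial.eval_C, Polynomial.eval_multiset_prod, Multiset.map_map]
    simp
  have hroot : ∀ c ∈ E.roots, Polynomial.aeval c D = 0 := fun c hc => by
    rw [haev]; exact (Polynomial.mem_roots hE0).1 hc
  obtain ⟨k, hk, hkc, hkf⟩ := exists_isRapid_ft_multiset E.roots (fun c hc h0 => by
      refine hD c.im ?_
      rw [← hroot c hc, show Complex.I * (c.im : ℂ) = c by apply Complex.ext <;> simp [h0]])
    (Polynomial.C (E.leadingCoeff⁻¹) * N.map (algebraMap ℝ ℂ)) (by
      rw [hcard, Polynomial.degree_mul,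
        Polynomial.degree_C (inv_ne_zero (Polynomial.leadingCoeff_ne_zero.2 hE0)), zero_add,
        Polynomial.degree_map]
      exact hND)
  have hkf' : ∀ y : ℝ, ft k y = Polynomial.aeval (-(Complex.I * (y : ℂ))) N /
        Polynomial.aeval (-(Complex.I * (y : ℂ))) D := fun y => by
    rw [hkf, haev D, ← hE, hEe, haev N, Polynomial.eval_mul, Polynomial.eval_C]
    rw [mul_comm, ← div_eq_mul_inv, div_div]
  refine ⟨fun u => (k u).re, hk.ofReal_re, fun hneg u hu => ?_, fun y => ?_⟩
  · beta_reduce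
    rw [hkc (fun c hc => ?_) u hu, Complex.zero_re]
    by_contra h
    exact hneg c (not_lt.1 h) (hroot c hc)
  -- Conjugating `k` conjugates the transform and reflects `y`; a quotient of real polynomials at
  -- `-iy` is invariant under both together. Hence `k` may be replaced by its real part.
  · have hconj : ft (fun u => (starRingEnd ℂ) (k u)) y = ft k y := by
      have h1 : ft (fun u => (starRingEnd ℂ) (k u)) y = (starRingEnd ℂ) (ft k (-y)) := by
        rw [ft, ft, ← integral_conj]
        refine integral_congr_ae (ae_of_all _ fun u => ?_)
        simp only [map_mul, ← Complex.exp_conj]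
        simp
      have h2 : ∀ p : Polynomial ℝ, (starRingEnd ℂ) (Polynomial.aeval (-(Complex.I * ((-y : ℝ) : ℂ))) p)
          = Polynomial.aeval (-(Complex.I * (y : ℂ))) p := fun p => by
        rw [← Polynomial.aeval_conj]
        congr 1
        simp
      rw [h1, hkf', hkf', map_div₀, h2, h2]
    rw [← hkf' y, rft]
    have h3 : (fun u => (((k u).re : ℝ) : ℂ))
        = fun u => (1 / 2 : ℂ) * (k u + (starRingEnd ℂ) (k u)) := by
      funext u
      rw [Complex.add_conj]
      push_cast
      ring
    have hci : Integrable fun u => (starRingEnd ℂ) (k u) := by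
      have hm := hk.1
      exact hk.integrable.mono (by fun_prop) (ae_of_all _ fun u => by simp)
    rw [h3, ft_const_mul, ft_add hk.integrable hci, hconj]
    ring

end FourierTransform

/-! ### Polynomials with matrix coefficients -/

section MatrixPolynomials

variable {n : ℕ}

/-- Seen as a matrix of polynomials, `A` is evaluated entrywise by an algebra homomorphism.
Multiplicativity and compatibility with determinants and adjugates then come for free. -/
lemma evalC_eq (A : Polynomial (Mat n)) (z : ℂ) :
    evalC A z = (Polynomial.aeval z : Polynomial ℝ →ₐ[ℝ] ℂ).mapMatrix (matPolyEquiv.symm A) := by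
  ext a b
  have hdeg : (matPolyEquiv.symm A a b).natDegree < A.natDegree + 1 := by
    rw [Nat.lt_succ_iff, Polynomial.natDegree_le_iff_coeff_eq_zero]
    intro k hk
    rw [matPolyEquiv_symm_apply_coeff, Polynomial.coeff_eq_zero_of_natDegree_lt hk]
    rfl
  rw [evalC, Polynomial.sum_over_range _ (fun k => by ext; simp), AlgHom.mapMatrix_apply,
    Matrix.map_apply, Polynomial.aeval_eq_sum_range' hdeg, Matrix.sum_apply]
  refine Finset.sum_congr rfl fun k _ => ?_
  rw [matPolyEquiv_symm_apply_coeff, Matrix.smul_apply, Matrix.map_apply, smul_eq_mul,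
    Complex.real_smul, mul_comm]

lemma evalC_mul (A B : Polynomial (Mat n)) (z : ℂ) : evalC (A * B) z = evalC A z * evalC B z := by
  simp only [evalC_eq, map_mul]

lemma evalC_sub (A B : Polynomial (Mat n)) (z : ℂ) : evalC (A - B) z = evalC A z - evalC B z := by
  simp only [evalC_eq, map_sub]

lemma evalC_X_pow (j : ℕ) (z : ℂ) :
    evalC (Polynomial.X ^ j : Polynomial (Mat n)) z = z ^ j • 1 := by
  rw [evalC_eq, map_pow, matPolyEquiv_symm_X, map_pow, AlgHom.mapMatrix_apply,
    Matrix.diagonal_map (map_zero _), Matrix.diagonal_pow, Matrix.smul_one_eq_diagonal]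
  congr 1
  funext i
  simp

lemma evalC_eq_sum {A : Polynomial (Mat n)} {N : ℕ} (hN : A.natDegree < N) (z : ℂ) :
    evalC A z = ∑ j ∈ Finset.range N, z ^ j • (A.coeff j).map ((↑) : ℝ → ℂ) :=
  Polynomial.sum_over_range' _ (fun k => by ext; simp) _ hN

/-- Leibniz expansion: each summand is a product of `n` entries, and its coefficient of order `n *
p` only sees their coefficients of order `p`. -/
lemma natDegree_det_le_and_coeff {M : Matrix (Fin n) (Fin n) (Polynomial ℝ)} {p : ℕ}
    (h : ∀ i j, (M i j).natDegree ≤ p) :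
    M.det.natDegree ≤ n * p ∧ M.det.coeff (n * p) = (Matrix.of fun i j => (M i j).coeff p).det := by
  constructor
  · rw [Matrix.det_apply]
    refine Polynomial.natDegree_sum_le_of_forall_le _ _ fun σ _ => ?_
    refine (Polynomial.natDegree_smul_le _ _).trans ?_
    refine (Polynomial.natDegree_prod_le _ _).trans ?_
    refine (Finset.sum_le_sum fun i _ => h (σ i) i).trans ?_
    simp
  · rw [Matrix.det_apply, Matrix.det_apply, Polynomial.finsetSum_coeff]
    refine Finset.sum_congr rfl fun σ _ => ?_
    rw [Polynomial.coeff_smul]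
    congr 1
    have := Polynomial.coeff_prod_of_natDegree_le Finset.univ (fun i => M (σ i) i) p
      (fun i _ => h _ _)
    simpa using this

/-- A strictly proper matrix quotient `A⁻¹ B` without imaginary poles is the Fourier transform of
a matrix function with rapidly decreasing entries. -/
lemma exists_isRapid_fourierMat {A B : Polynomial (Mat n)} (hA : A.Monic)
    (hBA : B.degree < A.degree) (hdet : ∀ y : ℝ, (evalC A (Complex.I * y)).det ≠ 0) :
    ∃ k : ℝ → Mat n, (∀ a b, IsRapid fun u => k u a b) ∧
      ((∀ z : ℂ, 0 ≤ z.re → (evalC A z).det ≠ 0) → ∀ u < 0, k u = 0) ∧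
      ∀ y : ℝ, fourierMat k y =
        (evalC A (-(Complex.I * y)))⁻¹ * evalC B (-(Complex.I * y)) := by
  set A' := matPolyEquiv.symm A with hA'
  set B' := matPolyEquiv.symm B with hB'
  have hAc : ∀ i j k, (A' i j).coeff k = A.coeff k i j :=
    fun i j k => matPolyEquiv_symm_apply_coeff A i j k
  have hBc : ∀ i j k, (B' i j).coeff k = B.coeff k i j :=
    fun i j k => matPolyEquiv_symm_apply_coeff B i j k
  have hAd : ∀ i j, (A' i j).natDegree ≤ A.natDegree := fun i j => by
    rw [Polynomial.natDegree_le_iff_coeff_eq_zero]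
    intro k hk
    rw [hAc, Polynomial.coeff_eq_zero_of_natDegree_lt hk]; rfl
  have hB0 : ∀ k, A.natDegree ≤ k → B.coeff k = 0 := fun k hk =>
    Polynomial.coeff_eq_zero_of_degree_lt (hBA.trans_le
      (Polynomial.degree_le_natDegree.trans (by exact_mod_cast hk)))
  have hBd : ∀ i j, (B' i j).natDegree ≤ A.natDegree := fun i j => by
    rw [Polynomial.natDegree_le_iff_coeff_eq_zero]
    intro k hk
    rw [hBc, hB0 k hk.le]; rfl
  have hlead : A.coeff A.natDegree = 1 := hA
  have hD : A'.det.coeff (n * A.natDegree) = 1 := by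
    rw [(natDegree_det_le_and_coeff hAd).2]
    simp only [hAc, hlead]
    exact Matrix.det_one
  have hDdeg : ((n * A.natDegree : ℕ) : WithBot ℕ) ≤ A'.det.degree :=
    Polynomial.le_degree_of_ne_zero (by rw [hD]; exact one_ne_zero)
  have hdet' : ∀ z : ℂ, (evalC A z).det = Polynomial.aeval z A'.det := fun z => by
    rw [evalC_eq, AlgHom.map_det]
  -- By Cramer's rule the numerator is the determinant of `A` with one column taken from `B`. That
  -- column has no coefficient of order `deg A`, so the coefficient of order `n * deg A` vanishes,
  -- whereas for `det A` it is `1`.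
  have hN : ∀ a b, ((A'.adjugate * B') a b).degree < A'.det.degree := fun a b => by
    refine lt_of_lt_of_le ?_ hDdeg
    have h1 : (A'.adjugate * B') a b = (A'.updateCol a fun i => B' i b).det := by
      rw [← Matrix.cramer_apply, Matrix.cramer_eq_adjugate_mulVec]
      rfl
    have h2 : ∀ i j, ((A'.updateCol a fun i => B' i b) i j).natDegree ≤ A.natDegree := by
      intro i j
      rw [Matrix.updateCol_apply]
      split_ifs
      · exact hBd _ _
      · exact hAd _ _
    obtain ⟨h3, h4⟩ := natDegree_det_le_and_coeff h2
    rw [h1, Polynomial.degree_lt_iff_coeff_zero]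
    intro m hm
    rcases hm.eq_or_lt with rfl | hm
    · rw [h4]
      refine Matrix.det_eq_zero_of_column_eq_zero a fun i => ?_
      simp [hBc, hB0]
    · exact Polynomial.coeff_eq_zero_of_natDegree_lt (h3.trans_lt hm)
  choose k hk hkc hkf using fun a b => exists_isRapid_rft_rational _ _ (hN a b)
    (fun y => by rw [← hdet']; exact hdet y)
  refine ⟨fun u => Matrix.of fun a b => k a b u, hk, fun hc u hu => ?_, fun y => ?_⟩
  · ext a b
    exact hkc a b (fun z hz => by rw [← hdet']; exact hc z hz) u hu
  · ext a b
    have h1 : fourierMat (fun u => Matrix.of fun a b => k a b u) y a b = rft (k a b) y := rfl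
    have h2 : (evalC A (-(Complex.I * (y : ℂ)))).adjugate * evalC B (-(Complex.I * (y : ℂ)))
        = (Polynomial.aeval (-(Complex.I * (y : ℂ))) : Polynomial ℝ →ₐ[ℝ] ℂ).mapMatrix
          (A'.adjugate * B') := by
      rw [map_mul, AlgHom.map_adjugate, evalC_eq, evalC_eq]
    rw [h1, hkf, Matrix.inv_def, Matrix.smul_mul, h2, hdet', Matrix.smul_apply,
      Ring.inverse_eq_inv', smul_eq_mul, div_eq_inv_mul]
    rfl

/-- Rules out `n = 0`, where every polynomial is zero. -/
lemma nontrivial_mat_of_natDegree_pos {P : Polynomial (Mat n)} (hP : 0 < P.natDegree) :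
    Nontrivial (Mat n) := by
  by_contra h
  rw [not_nontrivial_iff_subsingleton] at h
  rw [Subsingleton.elim P 0, Polynomial.natDegree_zero] at hP
  exact lt_irrefl _ hP

/-- Division with remainder by a monic polynomial also works over a noncommutative ring. The
convention `P = P %ₘ Q + Q * (P /ₘ Q)` puts the quotient on the required side. -/
lemma exists_isResidue {p q : ℕ} (hqp : q < p) {P Q : Polynomial (Mat n)} (hP : P.Monic)
    (hPdeg : P.natDegree = p) (hQ : Q.Monic) (hQdeg : Q.natDegree = q) :
    ∃ R, IsResidue p q P Q R ∧ ∀ R', IsResidue p q P Q R' → R' = R := by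
  have hnt : Nontrivial (Mat n) := nontrivial_mat_of_natDegree_pos (P := P) (by omega)
  have hQd : Q.degree = (q : WithBot ℕ) := by
    rw [Polynomial.degree_eq_natDegree hQ.ne_zero, hQdeg]
  have hPd : P.degree = (p : WithBot ℕ) := by
    rw [Polynomial.degree_eq_natDegree hP.ne_zero, hPdeg]
  have hmod := Polynomial.degree_modByMonic_lt P hQ
  have hsub : Q * (P /ₘ Q) - P = -(P %ₘ Q) := by
    conv_lhs => rw [← Polynomial.modByMonic_add_div P Q]
    rw [sub_eq_iff_eq_add, Polynomial.modByMonic_add_div]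
    rw [← sub_eq_iff_eq_add'.2 (Polynomial.modByMonic_add_div P Q).symm]
    abel
  refine ⟨P /ₘ Q, ⟨?_, ?_, ?_⟩, fun R' hR' => ?_⟩
  · refine hQ.of_mul_monic_left ?_
    rw [show Q * (P /ₘ Q) = P - P %ₘ Q from
      eq_sub_of_add_eq' (Polynomial.modByMonic_add_div P Q)]
    refine hP.sub_of_left (hmod.trans ?_)
    rw [hQd, hPd]
    exact_mod_cast hqp
  · rw [Polynomial.natDegree_divByMonic P hQ, hPdeg, hQdeg]
  · rw [hsub, Polynomial.degree_neg, ← hQd]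
    exact hmod
  · refine (Polynomial.div_modByMonic_unique R' (P - Q * R') hQ ⟨sub_add_cancel _ _, ?_⟩).1.symm
    rw [← Polynomial.degree_neg, neg_sub, hQd]
    exact hR'.degree_lt

end MatrixPolynomials

/-! ### Mixtures of the step functions `f_r` -/

section StepFunctions

lemma stepDiff_of_nonneg {r : ℝ} (hr : 0 ≤ r) (x : ℝ) : stepDiff r x = -box r x := by
  unfold stepDiff box Set.indicator
  simp only [Set.mem_Ici, Set.mem_Ico, sub_nonneg, Pi.one_apply]
  split_ifs <;> first | (norm_num; done) | (exfalso; grind)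

lemma stepDiff_of_neg {r : ℝ} (hr : r < 0) (x : ℝ) : stepDiff r x = box (-r) (x - r) := by
  unfold stepDiff box Set.indicator
  simp only [Set.mem_Ici, Set.mem_Ico, sub_nonneg, Pi.one_apply]
  split_ifs <;> first | (norm_num; done) | (exfalso; grind)

lemma measurable_stepDiff : Measurable fun x : ℝ × ℝ => stepDiff x.2 x.1 := by
  unfold stepDiff
  have h : Measurable (Set.indicator (Set.Ici (0 : ℝ)) (1 : ℝ → ℝ)) :=
    measurable_one.indicator measurableSet_Ici
  exact (h.comp (measurable_fst.sub measurable_snd)).sub (h.comp measurable_fst)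

lemma measurable_stepDiff_left (x : ℝ) : Measurable fun r => stepDiff r x :=
  measurable_stepDiff.comp (measurable_const.prodMk measurable_id)

lemma abs_stepDiff_le (r x : ℝ) : |stepDiff r x| ≤ 1 := by
  unfold stepDiff Set.indicator
  split_ifs <;> simp

lemma integral_box {h : ℝ} (hh : 0 ≤ h) : ∫ u, box h u = h := by
  rw [box, integral_indicator measurableSet_Ico]
  simp [hh]

lemma box_nonneg (h u : ℝ) : 0 ≤ box h u := Set.indicator_nonneg (by simp) u

lemma integrable_stepDiff (r : ℝ) : Integrable fun x => stepDiff r x := by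
  rcases le_or_gt 0 r with h | h
  · simp only [stepDiff_of_nonneg h]
    exact (isRapid_box r).integrable.neg
  · simp only [stepDiff_of_neg h]
    exact (isRapid_box (-r)).integrable.comp_sub_right r

lemma integral_abs_stepDiff (r : ℝ) : ∫ x, |stepDiff r x| = |r| := by
  rcases le_or_gt 0 r with h | h
  · simp only [stepDiff_of_nonneg h, abs_neg, abs_of_nonneg (box_nonneg _ _), integral_box h,
      abs_of_nonneg h]
  · simp only [stepDiff_of_neg h, abs_of_nonneg (box_nonneg _ _), abs_of_neg h]
    rw [integral_sub_right_eq_self (fun x => box (-r) x), integral_box (by linarith)]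

lemma rft_stepDiff (r : ℝ) {y : ℝ} (hy : y ≠ 0) :
    -(Complex.I * y) * rft (fun x => stepDiff r x) y = Complex.exp (Complex.I * y * r) - 1 := by
  rcases le_or_gt 0 r with h | h
  · simp only [stepDiff_of_nonneg h]
    have h1 : rft (fun x => -box r x) y = -rft (box r) y := by
      have := rft_const_mul (box r) (-1) y
      simpa using this
    rw [h1, mul_neg, rft_box h hy]
    ring
  · simp only [stepDiff_of_neg h]
    rw [rft_shift, mul_left_comm, rft_box (by linarith) hy, mul_sub, ← Complex.exp_add]
    simp

/-- The `L¹` norm of `f_r` is `|r|`, so a finite first moment of `l` is what joint integrability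
needs. -/
lemma integrable_stepDiff_mul {l : ℝ → ℝ} (hl : IsRapid l) :
    Integrable (Function.uncurry fun x r : ℝ => stepDiff r x * l r) (volume.prod volume) := by
  have hm := hl.1
  have hmeas : AEStronglyMeasurable (Function.uncurry fun x r : ℝ => stepDiff r x * l r)
      (volume.prod volume) :=
    (measurable_stepDiff.mul (hm.comp measurable_snd)).aestronglyMeasurable
  rw [integrable_prod_iff' hmeas]
  refine ⟨ae_of_all _ fun r => (integrable_stepDiff r).mul_const (l r), ?_⟩
  refine hl.integrable_mul_self.congr (ae_of_all _ fun r => ?_)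
  simp only [Function.uncurry_apply_pair, norm_mul, Real.norm_eq_abs]
  rw [integral_mul_const, integral_abs_stepDiff]

/-- The function `x ↦ ∫ f_r(x) l(r) dr`. -/
def stepMix (l : ℝ → ℝ) (x : ℝ) : ℝ := ∫ r, stepDiff r x * l r

lemma integrable_stepMix {l : ℝ → ℝ} (hl : IsRapid l) : Integrable (stepMix l) :=
  (integrable_stepDiff_mul hl).integral_prod_left

/-- Fubini applied to the transform `(e^{iyr} - 1) / (-iy)` of `f_r`. Thus `stepMix l` is a
primitive of `l` once the total mass of `l` is compensated by an atom at zero. -/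
lemma rft_stepMix {l : ℝ → ℝ} (hl : IsRapid l) {y : ℝ} (hy : y ≠ 0) :
    -(Complex.I * y) * rft (stepMix l) y = rft l y - rft l 0 := by
  have hi : Integrable (Function.uncurry fun x r : ℝ =>
      Complex.exp (Complex.I * y * x) * ((stepDiff r x * l r : ℝ) : ℂ)) (volume.prod volume) :=
    (integrable_stepDiff_mul hl).ofReal.bdd_mul (c := 1)
      (Measurable.aestronglyMeasurable (by fun_prop))
      (ae_of_all _ fun x => (norm_exp_I_mul_mul y x.1).le)
  have h1 : rft (stepMix l) y = ∫ r, rft (fun x => stepDiff r x) y * (l r : ℂ) := by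
    rw [rft, ft]
    calc ∫ x : ℝ, Complex.exp (Complex.I * y * x) * ((stepMix l x : ℝ) : ℂ)
        = ∫ x : ℝ, ∫ r : ℝ, Complex.exp (Complex.I * y * x) * ((stepDiff r x * l r : ℝ) : ℂ) := by
          refine integral_congr_ae (ae_of_all _ fun x => ?_)
          simp only [stepMix]
          rw [integral_const_mul, integral_complex_ofReal]
      _ = ∫ r : ℝ, ∫ x : ℝ, Complex.exp (Complex.I * y * x) * ((stepDiff r x * l r : ℝ) : ℂ) :=
          integral_integral_swap hi
      _ = _ := by
          refine integral_congr_ae (ae_of_all _ fun r => ?_)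
          simp only [rft, ft, Complex.ofReal_mul, ← mul_assoc]
          rw [integral_mul_const]
  rw [h1, ← integral_const_mul]
  simp only [← mul_assoc, rft_stepDiff _ hy, sub_mul, one_mul]
  refine (integral_sub (integrable_exp_mul hl.integrable.ofReal y) hl.integrable.ofReal).trans ?_
  simp [rft, ft]

lemma rft_zero (l : ℝ → ℝ) : rft l 0 = ((∫ u, l u : ℝ) : ℂ) := by
  simp only [rft, ft, Complex.ofReal_zero, mul_zero, zero_mul, Complex.exp_zero, one_mul]
  exact integral_complex_ofReal

end StepFunctions

/-! ### The delay kernel and the kernels of the derivatives -/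

section KernelSystem

variable {n : ℕ}

/-- The kernels `k 0, …, k m` of an MCARMA process: `k 0` is the MCARMA kernel, `k (j + 1)` is the
density of the derivative of `k j`, and `k (m - 1)` has a jump of size one at the origin. -/
structure IsKernelSystem (m : ℕ) (C : ℕ → Mat n) (f : ℝ → Mat n) (k : ℕ → ℝ → Mat n) : Prop where
  rapid : ∀ j ≤ m, ∀ a b, IsRapid fun u => k j u a b
  rapid_delay : ∀ a b, IsRapid fun u => f u a b
  causal : ∀ u < 0, f u = 0
  left : ∀ a b, ∀ᵐ u, k m u a b + ∑ j ∈ Finset.range m, ∑ c, C j a c * k j u c b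
    = ∑ c, cnv (fun u => f u a c) (fun u => k 0 u c b) u
  right : ∀ a b, ∀ᵐ u, k m u a b + ∑ j ∈ Finset.range m, ∑ c, C j c b * k j u a c
    = ∑ c, cnv (fun u => k 0 u a c) (fun u => f u c b) u
  step : ∀ j < m, ∀ h, 0 ≤ h → ∀ a b, ∀ᵐ u, k j u a b - k j (u - h) a b
    = (if j + 1 = m ∧ a = b then 1 else 0) * box h u + cnv (box h) (fun u => k (j + 1) u a b) u
  mix : ∀ a b, ∀ᵐ x, k 0 x a b = stepMix (fun r => k 1 r a b) x
  integral : ∀ a b, ∫ r, k 1 r a b = -(if 1 = m ∧ a = b then 1 else 0)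

/-- `R - Q⁻¹P = Q⁻¹(QR - P)` is strictly proper by the choice of `R`, and its poles are zeros of
`det Q`, all in the open left half-plane; this gives causality. -/
lemma exists_isDelayKernel [Nontrivial (Mat n)] {p q : ℕ} {P Q R : Polynomial (Mat n)} (hQ : Q.Monic)
    (hQdeg : Q.natDegree = q) (hQdet : ∀ z : ℂ, 0 ≤ z.re → (evalC Q z).det ≠ 0)
    (hR : IsResidue p q P Q R) :
    ∃ f : ℝ → Mat n, IsDelayKernel P Q R f ∧ (∀ a b, IsRapid fun u => f u a b) ∧
      ∀ u < 0, f u = 0 := by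
  obtain ⟨f, hf, hfc, hff⟩ := exists_isRapid_fourierMat (A := Q) (B := Q * R - P) hQ (by
    rw [Polynomial.degree_eq_natDegree hQ.ne_zero, hQdeg]
    exact hR.degree_lt) (fun y => hQdet _ (by simp))
  refine ⟨f, ⟨fun j k => (hf j k).integrable, fun y => ?_⟩, hf, hfc hQdet⟩
  have hdet : IsUnit (evalC Q (-(Complex.I * y))).det := (hQdet _ (by simp)).isUnit
  rw [hff, evalC_sub, evalC_mul, mul_sub, ← mul_assoc, Matrix.nonsing_inv_mul _ hdet, one_mul]

/-- With `K = P⁻¹Q` at `z = -iy`, the kernel `k j` is determined by its transform `z^j K`, less the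
identity when `j = m`. Every field of the system is an identity of transforms for `y ≠ 0`, or the
value of a transform at `y = 0`. -/
lemma exists_isKernelSystem {p q : ℕ} (hqp : q < p) {P Q R : Polynomial (Mat n)}
    (hP : P.Monic) (hPdeg : P.natDegree = p) (hQ : Q.Monic) (hQdeg : Q.natDegree = q)
    (hPdet : ∀ y : ℝ, (evalC P (Complex.I * y)).det ≠ 0)
    (hQdet : ∀ z : ℂ, 0 ≤ z.re → (evalC Q z).det ≠ 0) (hR : IsResidue p q P Q R)
    {f : ℝ → Mat n} (hf : IsDelayKernel P Q R f) (hfr : ∀ a b, IsRapid fun u => f u a b)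
    (hfc : ∀ u < 0, f u = 0) :
    ∃ k : ℕ → ℝ → Mat n, IsKernel P Q (k 0) ∧ IsKernelSystem (p - q) R.coeff f k := by
  have hnt : Nontrivial (Mat n) := nontrivial_mat_of_natDegree_pos (P := P) (by omega)
  obtain ⟨m, hm⟩ : ∃ m, m = p - q := ⟨_, rfl⟩
  rw [← hm]
  have hQd : Q.degree = (q : WithBot ℕ) := by
    rw [Polynomial.degree_eq_natDegree hQ.ne_zero, hQdeg]
  have hPd : P.degree = (p : WithBot ℕ) := by
    rw [Polynomial.degree_eq_natDegree hP.ne_zero, hPdeg]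
  have hXQm : ∀ j, (Polynomial.X ^ j * Q).Monic := fun j => (Polynomial.monic_X_pow j).mul hQ
  have hXQ : ∀ j, (Polynomial.X ^ j * Q).degree = ((j + q : ℕ) : WithBot ℕ) := fun j => by
    rw [Polynomial.degree_eq_natDegree (hXQm j).ne_zero,
      (Polynomial.monic_X_pow j).natDegree_mul hQ, Polynomial.natDegree_X_pow, hQdeg]
  set z : ℝ → ℂ := fun y => -(Complex.I * y) with hz
  set K : ℝ → Matrix (Fin n) (Fin n) ℂ := fun y => (evalC P (z y))⁻¹ * evalC Q (z y) with hK
  have hPunit : ∀ y, IsUnit (evalC P (z y)).det := fun y => by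
    have := (hPdet (-y)).isUnit
    rwa [show Complex.I * ((-y : ℝ) : ℂ) = z y by simp [hz]] at this
  have hQunit : ∀ y, IsUnit (evalC Q (z y)).det := fun y => (hQdet _ (by simp [hz])).isUnit
  -- The bound `j ≤ m` sits inside the existential so that `choose` returns a family over all of
  -- `ℕ`; beyond `m` the kernel is a dummy.
  have hex : ∀ j, ∃ k : ℝ → Mat n, j ≤ m → (∀ a b, IsRapid fun u => k u a b) ∧
      ∀ y, fourierMat k y = z y ^ j • K y - (if j = m then 1 else 0 : ℂ) • 1 := by
    intro j
    by_cases hj : j < m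
    · obtain ⟨k, hk, -, hkf⟩ := exists_isRapid_fourierMat (A := P) (B := Polynomial.X ^ j * Q) hP
        (by rw [hXQ, hPd]; exact_mod_cast (by omega)) hPdet
      refine ⟨k, fun _ => ⟨hk, fun y => ?_⟩⟩
      rw [hkf, evalC_mul, evalC_X_pow, if_neg hj.ne]
      simp [hK, hz]
    · by_cases hj' : j = m
      · subst hj'
        -- `X^m Q` and `P` are monic of the same degree, so subtracting `P`, that is the identity
        -- after division, restores strict properness.
        obtain ⟨k, hk, -, hkf⟩ := exists_isRapid_fourierMat (A := P)
          (B := Polynomial.X ^ j * Q - P) hP (by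
            have h1 : (Polynomial.X ^ j * Q).degree = P.degree := by
              rw [hXQ, hPd]; congr 1; omega
            rw [← h1]
            exact Polynomial.degree_sub_lt_left h1 (hXQm j).ne_zero ((hXQm j).trans hP.symm)) hPdet
        refine ⟨k, fun _ => ⟨hk, fun y => ?_⟩⟩
        rw [hkf, evalC_sub, mul_sub, evalC_mul, evalC_X_pow, if_pos rfl,
          Matrix.nonsing_inv_mul _ (hPunit y)]
        simp [hK, hz]
      · exact ⟨0, fun h => absurd h (by omega)⟩
  choose k hk using hex
  have hkr : ∀ j ≤ m, ∀ a b, IsRapid fun u => k j u a b := fun j hj => (hk j hj).1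
  have hkf : ∀ j ≤ m, ∀ y, fourierMat (k j) y = z y ^ j • K y - (if j = m then 1 else 0 : ℂ) • 1 :=
    fun j hj => (hk j hj).2
  have hm0 : 0 < m := by omega
  have hsucc : ∀ j < m, ∀ a b y, rft (fun u => k (j + 1) u a b) y
      = z y * rft (fun u => k j u a b) y - (if j + 1 = m ∧ a = b then 1 else 0) := by
    intro j hj a b y
    rw [← fourierMat_apply, ← fourierMat_apply, hkf _ hj, hkf _ hj.le, if_neg hj.ne]
    simp only [Matrix.sub_apply, Matrix.smul_apply, smul_eq_mul, zero_mul, sub_zero, pow_succ,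
      Matrix.one_apply, ite_and]
    split_ifs <;> ring
  have hsum : ∀ y, evalC R (z y) = z y ^ m • 1 + ∑ j ∈ Finset.range m,
      z y ^ j • (R.coeff j).map ((↑) : ℝ → ℂ) := by
    intro y
    have hRd : R.natDegree = m := by rw [hR.natDegree, hm]
    rw [evalC_eq_sum (N := m + 1) (by omega), Finset.sum_range_succ, add_comm]
    congr 2
    rw [← hRd, Polynomial.coeff_natDegree, hR.monic]
    exact Matrix.map_one _ Complex.ofReal_zero Complex.ofReal_one
  -- `(R - Q⁻¹P) K = R K - 1`, and the leading term `z^m K - 1` of the right-hand side is the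
  -- transform of `k m`. The mirrored version `hcore2` is needed separately because matrices do not
  -- commute.
  have hcore1 : ∀ y, fourierMat (k m) y + ∑ j ∈ Finset.range m,
      (R.coeff j).map ((↑) : ℝ → ℂ) * fourierMat (k j) y
      = fourierMat f y * fourierMat (k 0) y := by
    intro y
    have h1 : ∑ j ∈ Finset.range m, (R.coeff j).map ((↑) : ℝ → ℂ) * fourierMat (k j) y
        = (evalC R (z y) - z y ^ m • 1) * K y := by
      rw [hsum, add_sub_cancel_left, Finset.sum_mul]
      refine Finset.sum_congr rfl fun j hj => ?_
      rw [hkf j (Finset.mem_range.1 hj).le, if_neg (Finset.mem_range.1 hj).ne]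
      simp
    rw [h1, hkf m le_rfl, hkf 0 hm0.le, if_neg hm0.ne, if_pos rfl, hf.fourier]
    have h2 : (evalC Q (z y))⁻¹ * evalC P (z y) * K y = 1 := by
      simp only [hK]
      rw [mul_assoc, ← mul_assoc (evalC P (z y)), Matrix.mul_nonsing_inv _ (hPunit y), one_mul,
        Matrix.nonsing_inv_mul _ (hQunit y)]
    simp only [pow_zero, one_smul, zero_smul, sub_zero, sub_mul, Matrix.smul_mul, one_mul]
    rw [h2]
    abel
  have hcore2 : ∀ y, fourierMat (k m) y + ∑ j ∈ Finset.range m,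
      fourierMat (k j) y * (R.coeff j).map ((↑) : ℝ → ℂ)
      = fourierMat (k 0) y * fourierMat f y := by
    intro y
    have h1 : ∑ j ∈ Finset.range m, fourierMat (k j) y * (R.coeff j).map ((↑) : ℝ → ℂ)
        = K y * (evalC R (z y) - z y ^ m • 1) := by
      rw [hsum, add_sub_cancel_left, Finset.mul_sum]
      refine Finset.sum_congr rfl fun j hj => ?_
      rw [hkf j (Finset.mem_range.1 hj).le, if_neg (Finset.mem_range.1 hj).ne]
      simp
    rw [h1, hkf m le_rfl, hkf 0 hm0.le, if_neg hm0.ne, if_pos rfl, hf.fourier]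
    have h2 : K y * ((evalC Q (z y))⁻¹ * evalC P (z y)) = 1 := by
      simp only [hK]
      rw [mul_assoc, ← mul_assoc (evalC Q (z y)), Matrix.mul_nonsing_inv _ (hQunit y), one_mul,
        Matrix.nonsing_inv_mul _ (hPunit y)]
    simp only [pow_zero, one_smul, zero_smul, sub_zero, mul_sub, Matrix.mul_smul, mul_one]
    rw [h2]
    abel
  refine ⟨k, ⟨fun a b => (hkr 0 hm0.le a b).memLp_one, fun a b => (hkr 0 hm0.le a b).memLp_two,
    fun y => ?_⟩, ⟨hkr, hfr, hfc, fun a b => ?_, fun a b => ?_, fun j hj h hh a b => ?_,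
    fun a b => ?_, fun a b => ?_⟩⟩
  · rw [hkf 0 hm0.le, if_neg hm0.ne]
    simp [hK, hz]
  · have hr1 : ∀ j ∈ Finset.range m, ∀ c ∈ Finset.univ,
        IsRapid fun u => R.coeff j a c * k j u c b :=
      fun j hj c _ => (hkr j (Finset.mem_range.1 hj).le c b).const_mul _
    have hr2 : IsRapid fun u => ∑ j ∈ Finset.range m, ∑ c, R.coeff j a c * k j u c b :=
      IsRapid.sum _ fun j hj => IsRapid.sum _ (hr1 j hj)
    have hr3 : ∀ c ∈ Finset.univ, IsRapid (cnv (fun u => f u a c) fun u => k 0 u c b) :=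
      fun c _ => (hfr a c).cnv (hkr 0 hm0.le c b)
    refine ae_eq_of_rft ((hkr m le_rfl a b).add hr2).integrable (IsRapid.sum _ hr3).integrable
      fun y _ => ?_
    have := congrFun (congrFun (hcore1 y) a) b
    rw [rft_add (hkr m le_rfl a b).integrable hr2.integrable,
      rft_sum _ (fun j hj => (IsRapid.sum _ (hr1 j hj)).integrable),
      rft_sum _ (fun c hc => (hr3 c hc).integrable)]
    rw [Matrix.add_apply, Matrix.sum_apply, Matrix.mul_apply] at this
    refine (congrArg₂ (· + ·) rfl (Finset.sum_congr rfl fun j hj => ?_)).trans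
      (this.trans (Finset.sum_congr rfl fun c _ => ?_))
    · rw [rft_sum _ (fun c hc => (hr1 j hj c hc).integrable), Matrix.mul_apply]
      exact Finset.sum_congr rfl fun c _ => rft_const_mul _ _ _
    · rw [rft_cnv (hfr _ _).integrable (hkr 0 hm0.le _ _).integrable]
      rfl
  · have hr1 : ∀ j ∈ Finset.range m, ∀ c ∈ Finset.univ,
        IsRapid fun u => R.coeff j c b * k j u a c :=
      fun j hj c _ => (hkr j (Finset.mem_range.1 hj).le a c).const_mul _
    have hr2 : IsRapid fun u => ∑ j ∈ Finset.range m, ∑ c, R.coeff j c b * k j u a c :=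
      IsRapid.sum _ fun j hj => IsRapid.sum _ (hr1 j hj)
    have hr3 : ∀ c ∈ Finset.univ, IsRapid (cnv (fun u => k 0 u a c) fun u => f u c b) :=
      fun c _ => (hkr 0 hm0.le a c).cnv (hfr c b)
    refine ae_eq_of_rft ((hkr m le_rfl a b).add hr2).integrable (IsRapid.sum _ hr3).integrable
      fun y _ => ?_
    have := congrFun (congrFun (hcore2 y) a) b
    rw [rft_add (hkr m le_rfl a b).integrable hr2.integrable,
      rft_sum _ (fun j hj => (IsRapid.sum _ (hr1 j hj)).integrable),
      rft_sum _ (fun c hc => (hr3 c hc).integrable)]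
    rw [Matrix.add_apply, Matrix.sum_apply, Matrix.mul_apply] at this
    refine (congrArg₂ (· + ·) rfl (Finset.sum_congr rfl fun j hj => ?_)).trans
      (this.trans (Finset.sum_congr rfl fun c _ => ?_))
    · rw [rft_sum _ (fun c hc => (hr1 j hj c hc).integrable), Matrix.mul_apply]
      refine Finset.sum_congr rfl fun c _ => ?_
      rw [rft_const_mul, mul_comm]
      rfl
    · rw [rft_cnv (hkr 0 hm0.le _ _).integrable (hfr _ _).integrable]
      rfl
  · have hr0 := hkr j hj.le a b
    have hr1 : IsRapid fun u => (if j + 1 = m ∧ a = b then (1 : ℝ) else 0) * box h u :=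
      (isRapid_box h).const_mul _
    have hr2 := (isRapid_box h).cnv (hkr (j + 1) hj a b)
    refine ae_eq_of_rft (hr0.sub (hr0.shift h)).integrable (hr1.add hr2).integrable fun y hy => ?_
    rw [rft_sub hr0.integrable (hr0.shift h).integrable,
      rft_shift (fun u => k j u a b), rft_add hr1.integrable hr2.integrable, rft_const_mul,
      rft_cnv (isRapid_box h).integrable (hkr (j + 1) hj a b).integrable, hsucc j hj]
    have := rft_box hh hy
    have hc : (((if j + 1 = m ∧ a = b then 1 else 0 : ℝ)) : ℂ)
        = if j + 1 = m ∧ a = b then 1 else 0 := by split_ifs <;> simp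
    rw [hc]
    linear_combination (-rft (fun u => k j u a b) y) * this
  -- The transform of `k 1` at `y` minus its value at `0` is `-iy` times that of `k 0`: the identity
  -- subtracted when `m = 1` cancels.
  · refine ae_eq_of_rft (hkr 0 hm0.le a b).integrable (integrable_stepMix (hkr 1 hm0 a b))
      fun y hy => ?_
    have h1 := rft_stepMix (hkr 1 hm0 a b) hy
    have h2 := hsucc 0 hm0 a b
    have hy' : -(Complex.I * (y : ℂ)) ≠ 0 :=
      neg_ne_zero.2 (mul_ne_zero Complex.I_ne_zero (by exact_mod_cast hy))
    simp only [zero_add] at h2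
    rw [h2 y, h2 0] at h1
    have hz0 : z 0 = 0 := by simp [hz]
    rw [hz0] at h1
    refine mul_left_cancel₀ hy' ?_
    rw [h1]
    ring
  · have h2 := hsucc 0 hm0 a b 0
    have hz0 : z 0 = 0 := by simp [hz]
    rw [hz0, zero_mul, zero_sub, zero_add, rft_zero] at h2
    have h3 : ((∫ u, k 1 u a b : ℝ) : ℂ) = ((-(if 1 = m ∧ a = b then 1 else 0) : ℝ) : ℂ) := by
      rw [h2]; split_ifs <;> simp
    exact_mod_cast h3

end KernelSystem

/-! ### Growth of first moments and temperedness of paths -/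

section Growth

/-- A measurable, even, subadditive function is bounded near zero by Steinhaus' theorem, hence grows
at most linearly. The quadratic bound is weaker but matches the weights in use. -/
lemma exists_growth_of_subadditive {φ : ℝ → ℝ} (hm : Measurable φ) (h0 : ∀ t, 0 ≤ φ t)
    (hadd : ∀ s t, φ (s + t) ≤ φ s + φ t) (hneg : ∀ t, φ (-t) = φ t) :
    ∃ A, 0 ≤ A ∧ ∀ t, φ t ≤ A * (1 + t ^ 2) := by
  obtain ⟨K, hK⟩ : ∃ K : ℕ, 0 < volume {t | φ t ≤ K} := by
    by_contra hcon
    push Not at hcon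
    have hU : (⋃ K : ℕ, {t | φ t ≤ K}) = Set.univ :=
      Set.eq_univ_of_forall fun t => Set.mem_iUnion.2 (exists_nat_ge (φ t))
    have h1 : volume (⋃ K : ℕ, {t | φ t ≤ (K : ℝ)}) = 0 :=
      measure_iUnion_null fun K => le_antisymm (hcon K) bot_le
    rw [hU] at h1
    simp at h1
  -- The differences of a set of positive measure fill a neighbourhood of zero, and on differences
  -- of this sublevel set `φ ≤ 2K`.
  have hS := Measure.sub_mem_nhds_zero_of_addHaar_pos volume {t | φ t ≤ (K : ℝ)}
    (measurableSet_le hm measurable_const) hK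
  obtain ⟨δ, hδ, hball⟩ := Metric.mem_nhds_iff.1 hS
  have hloc : ∀ t, |t| < δ → φ t ≤ 2 * K := fun t ht => by
    obtain ⟨a, ha, b, hb, rfl⟩ := hball (show t ∈ Metric.ball 0 δ by simpa using ht)
    have h1 := hadd a (-b)
    rw [hneg, ← sub_eq_add_neg] at h1
    have ha' : φ a ≤ K := ha
    have hb' : φ b ≤ K := hb
    beta_reduce
    linarith
  have hmul : ∀ (m : ℕ) t, φ ((m + 1 : ℕ) * t) ≤ (m + 1 : ℕ) * φ t := by
    intro m t
    induction m with
    | zero => simp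
    | succ m ih =>
      have := hadd ((m + 1 : ℕ) * t) t
      push_cast at this ih ⊢
      rw [show ((m : ℝ) + 1 + 1) * t = (m + 1) * t + t by ring]
      linarith
  refine ⟨(1 / δ + 2) * (2 * K), by positivity, fun t => ?_⟩
  -- `t` is split into `m + 1` equal steps, each shorter than `δ`.
  set m := ⌊|t| / δ⌋₊ with hmdef
  have h1 : |t| / δ < (m + 1 : ℕ) := by
    push_cast
    exact Nat.lt_floor_add_one _
  have hmpos : (0 : ℝ) < (m + 1 : ℕ) := by positivity
  have h2 : |t / (m + 1 : ℕ)| < δ := by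
    rw [abs_div, abs_of_pos hmpos, div_lt_iff₀ hmpos]
    rwa [div_lt_iff₀ hδ, mul_comm] at h1
  have h3 := hmul m (t / (m + 1 : ℕ))
  rw [mul_div_cancel₀ _ hmpos.ne'] at h3
  have h4 : ((m + 1 : ℕ) : ℝ) ≤ |t| / δ + 1 := by
    push_cast
    linarith [Nat.floor_le (show 0 ≤ |t| / δ by positivity)]
  calc φ t ≤ (m + 1 : ℕ) * φ (t / (m + 1 : ℕ)) := h3
    _ ≤ (|t| / δ + 1) * (2 * K) := by
      gcongr
      · exact h0 _
      · exact hloc _ h2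
    _ ≤ (1 / δ + 2) * (1 + t ^ 2) * (2 * K) := by
      gcongr
      have h5 : |t| ≤ 1 + t ^ 2 := by nlinarith [sq_nonneg (|t| - 1), sq_abs t]
      have h6 : |t| / δ ≤ 1 / δ * (1 + t ^ 2) := by
        rw [div_mul_eq_mul_div, one_mul]
        gcongr
      nlinarith [sq_nonneg t]
    _ = _ := by ring

variable {Ω : Type*} [MeasurableSpace Ω] {Pr : Measure Ω}

/-- A jointly measurable real process whose first absolute moments grow at most quadratically. -/
structure IsModerate (Pr : Measure Ω) (x : ℝ → Ω → ℝ) : Prop where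
  measurable : Measurable fun p : ℝ × Ω => x p.1 p.2
  integrable : ∀ t, Integrable (x t) Pr
  growth : ∃ A, 0 ≤ A ∧ ∀ t, ∫ ω, |x t ω| ∂Pr ≤ A * (1 + t ^ 2)

lemma IsModerate.measurable_path {x : ℝ → Ω → ℝ} (hx : IsModerate Pr x) (ω : Ω) :
    Measurable fun t => x t ω :=
  hx.measurable.comp (measurable_id.prodMk measurable_const)

lemma measurable_integral_abs [SFinite Pr] {x : ℝ → Ω → ℝ}
    (hx : Measurable fun p : ℝ × Ω => x p.1 p.2) : Measurable fun t => ∫ ω, |x t ω| ∂Pr := by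
  have : StronglyMeasurable (Function.uncurry fun t ω => |x t ω|) :=
    (measurable_abs.comp hx).stronglyMeasurable
  exact this.integral_prod_right.measurable

/-- By Tonelli the expected weighted integral of a path is at most `A ∫ (1 + t²) (1 + t²)⁻² dt`,
which is finite. -/
lemma IsModerate.ae_isTempered [SFinite Pr] {x : ℝ → Ω → ℝ} (hx : IsModerate Pr x) :
    ∀ᵐ ω ∂Pr, IsTempered fun t => x t ω := by
  obtain ⟨A, hA0, hA⟩ := hx.growth
  have hm := hx.measurable
  have hmi := measurable_integral_abs (Pr := Pr) hm
  have hi : Integrable (fun p : ℝ × Ω => ‖x p.1 p.2‖ * ((1 + p.1 ^ 2) ^ 2)⁻¹)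
      (volume.prod Pr) := by
    have hmeas : Measurable fun p : ℝ × Ω => ‖x p.1 p.2‖ * ((1 + p.1 ^ 2) ^ 2)⁻¹ :=
      hm.norm.mul (by fun_prop)
    rw [integrable_prod_iff hmeas.aestronglyMeasurable]
    refine ⟨ae_of_all _ fun t => (hx.integrable t).norm.mul_const (((1 + t ^ 2) ^ 2)⁻¹), ?_⟩
    refine (integrable_inv_one_add_sq.const_mul A).mono' ?_ (ae_of_all _ fun t => ?_)
    · exact hmeas.norm.stronglyMeasurable.integral_prod_right'.aestronglyMeasurable
    · simp only [norm_mul, Real.norm_eq_abs, abs_abs]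
      rw [integral_mul_const, abs_mul, abs_abs]
      have h1 : (0 : ℝ) < 1 + t ^ 2 := by positivity
      rw [abs_of_nonneg (integral_nonneg fun ω => abs_nonneg _),
        abs_of_nonneg (a := ((1 + t ^ 2) ^ 2)⁻¹) (by positivity)]
      calc (∫ ω, |x t ω| ∂Pr) * ((1 + t ^ 2) ^ 2)⁻¹
          ≤ A * (1 + t ^ 2) * ((1 + t ^ 2) ^ 2)⁻¹ := by gcongr; exact hA t
        _ = A * (1 + t ^ 2)⁻¹ := by field_simp
  filter_upwards [hi.prod_left_ae] with ω hω
  exact ⟨hx.measurable_path ω, hω⟩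

lemma IsModerate.integrable_prod_cnv [SFinite Pr] {x : ℝ → Ω → ℝ} (hx : IsModerate Pr x)
    {k : ℝ → ℝ} (hk : IsRapid k) (t : ℝ) :
    Integrable (fun p : ℝ × Ω => k p.1 * x (t - p.1) p.2) (volume.prod Pr) := by
  obtain ⟨A, hA0, hA⟩ := hx.growth
  have hm := hx.measurable
  have hkm := hk.1
  have hmeas : Measurable fun p : ℝ × Ω => k p.1 * x (t - p.1) p.2 :=
    (hkm.comp measurable_fst).mul (hm.comp (by fun_prop : Measurable fun p : ℝ × Ω =>
      (t - p.1, p.2)))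
  rw [integrable_prod_iff hmeas.aestronglyMeasurable]
  refine ⟨ae_of_all _ fun s => (hx.integrable (t - s)).const_mul (k s), ?_⟩
  refine (hk.integrable_weight.const_mul (A * (2 * (1 + t ^ 2)))).mono' ?_ (ae_of_all _ fun s => ?_)
  · exact hmeas.norm.stronglyMeasurable.integral_prod_right'.aestronglyMeasurable
  · simp only [norm_mul, Real.norm_eq_abs]
    rw [integral_const_mul, abs_mul, abs_abs,
      abs_of_nonneg (integral_nonneg fun ω => abs_nonneg _)]
    have h1 := one_add_sq_add_le t (-s)
    rw [neg_sq, ← sub_eq_add_neg] at h1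
    calc |k s| * ∫ ω, |x (t - s) ω| ∂Pr ≤ |k s| * (A * (1 + (t - s) ^ 2)) := by
          gcongr; exact hA _
      _ ≤ |k s| * (A * (2 * (1 + t ^ 2) * (1 + s ^ 2) ^ 2)) := by
          gcongr
          refine h1.trans ?_
          gcongr
          nlinarith [sq_nonneg s]
      _ = _ := by ring

lemma IsModerate.integrable_cnv [SFinite Pr] {x : ℝ → Ω → ℝ} (hx : IsModerate Pr x)
    {k : ℝ → ℝ} (hk : IsRapid k) (t : ℝ) :
    Integrable (fun ω => cnv k (fun s => x s ω) t) Pr :=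
  (hx.integrable_prod_cnv hk t).integral_prod_right

lemma measurable_cnv_process {x : ℝ → Ω → ℝ} (hx : Measurable fun p : ℝ × Ω => x p.1 p.2)
    {k : ℝ → ℝ} (hk : Measurable k) :
    Measurable fun p : ℝ × Ω => cnv k (fun s => x s p.2) p.1 := by
  have : StronglyMeasurable (Function.uncurry fun (p : ℝ × Ω) (s : ℝ) => k s * x (p.1 - s) p.2) :=
    Measurable.stronglyMeasurable ((hk.comp measurable_snd).mul (hx.comp (by fun_prop :
      Measurable fun q : (ℝ × Ω) × ℝ => (q.1.1 - q.2, q.1.2))))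
  exact this.integral_prod_right.measurable

variable {n : ℕ}

/-- Stationary increments and the triangle inequality make `t ↦ E|Z_t - Z_0|` subadditive and even.
-/
lemma IsNoise.isModerate [IsProbabilityMeasure Pr] {Z : ℝ → Ω → Fin n → ℝ} (hZ : IsNoise Pr Z)
    (k : Fin n) : IsModerate Pr fun t ω => Z t ω k := by
  have hm : Measurable fun p : ℝ × Ω => Z p.1 p.2 k := (measurable_pi_apply k).comp hZ.measurable
  have hinc : ∀ h t, ∫ ω, |Z (t + h) ω k - Z h ω k| ∂Pr = ∫ ω, |Z t ω k - Z 0 ω k| ∂Pr := by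
    intro h t
    have := (hZ.stationaryIncrements h 1 fun _ => t).comp
      (u := fun v : Fin 1 → Fin n → ℝ => |v 0 k|) (by fun_prop)
    exact this.integral_eq
  have hd : ∀ s t, Integrable (fun ω => |Z s ω k - Z t ω k|) Pr := fun s t =>
    ((hZ.integrable s k).sub (hZ.integrable t k)).abs
  obtain ⟨A, hA0, hA⟩ := exists_growth_of_subadditive
    (φ := fun t => ∫ ω, |Z t ω k - Z 0 ω k| ∂Pr)
    (measurable_integral_abs (x := fun t ω => Z t ω k - Z 0 ω k)
      (hm.sub (hm.comp (by fun_prop : Measurable fun p : ℝ × Ω => ((0 : ℝ), p.2)))))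
    (fun t => integral_nonneg fun ω => abs_nonneg _)
    (fun s t => by
      rw [← hinc t s, ← integral_add (hd _ _) (hd _ _)]
      exact integral_mono (hd _ _) ((hd _ _).add (hd _ _)) fun ω => abs_sub_le _ _ _)
    (fun t => by
      rw [← hinc t (-t), neg_add_cancel]
      exact integral_congr_ae (ae_of_all _ fun ω => abs_sub_comm _ _))
  refine ⟨hm, fun t => hZ.integrable t k, A + ∫ ω, |Z 0 ω k| ∂Pr,
    add_nonneg hA0 (integral_nonneg fun ω => abs_nonneg _), fun t => ?_⟩
  calc ∫ ω, |Z t ω k| ∂Pr ≤ ∫ ω, (|Z t ω k - Z 0 ω k| + |Z 0 ω k|) ∂Pr := by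
        refine integral_mono (hZ.integrable t k).abs ((hd _ _).add (hZ.integrable 0 k).abs)
          fun ω => ?_
        have := abs_sub_le (Z t ω k) (Z 0 ω k) 0
        simpa using this
    _ = (∫ ω, |Z t ω k - Z 0 ω k| ∂Pr) + ∫ ω, |Z 0 ω k| ∂Pr :=
        integral_add (hd _ _) (hZ.integrable 0 k).abs
    _ ≤ A * (1 + t ^ 2) + (∫ ω, |Z 0 ω k| ∂Pr) * (1 + t ^ 2) := by
        gcongr
        · exact hA t
        · refine le_mul_of_one_le_right (integral_nonneg fun ω => abs_nonneg _) ?_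
          nlinarith [sq_nonneg t]
    _ = _ := by ring

lemma isModerate_of_isStationary {X : ℝ → Ω → Fin n → ℝ}
    (hm : Measurable fun x : ℝ × Ω => X x.1 x.2) (hi : ∀ t k, Integrable (fun ω => X t ω k) Pr)
    (hs : IsStationary Pr X) (k : Fin n) : IsModerate Pr fun t ω => X t ω k := by
  refine ⟨(measurable_pi_apply k).comp hm, fun t => hi t k, ∫ ω, |X 0 ω k| ∂Pr,
    integral_nonneg fun ω => abs_nonneg _, fun t => ?_⟩
  have h1 := (hs t 1 fun _ => 0).comp (u := fun v : Fin 1 → Fin n → ℝ => |v 0 k|) (by fun_prop)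
  have h2 := h1.integral_eq
  simp only [Function.comp_def, zero_add] at h2
  rw [h2]
  refine le_mul_of_one_le_right (integral_nonneg fun ω => abs_nonneg _) ?_
  nlinarith [sq_nonneg t]

end Growth

/-! ### Stationarity of moving averages of increments -/

section Stationarity

variable {Ω : Type*} [MeasurableSpace Ω] {Pr : Measure Ω}

/-- Equality in law passes to almost sure limits: test against bounded continuous functions and use
dominated convergence. -/
lemma identDistrib_of_tendsto_ae [IsFiniteMeasure Pr] {E : Type*} [MeasurableSpace E]
    [PseudoEMetricSpace E] [BorelSpace E] [HasOuterApproxClosed E]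
    {A B : ℕ → Ω → E} {a b : Ω → E} (h : ∀ M, IdentDistrib (A M) (B M) Pr Pr)
    (ha : ∀ᵐ ω ∂Pr, Tendsto (fun M => A M ω) atTop (nhds (a ω)))
    (hb : ∀ᵐ ω ∂Pr, Tendsto (fun M => B M ω) atTop (nhds (b ω))) : IdentDistrib a b Pr Pr := by
  have ham := aemeasurable_of_tendsto_metrizable_ae atTop (fun M => (h M).aemeasurable_fst) ha
  have hbm := aemeasurable_of_tendsto_metrizable_ae atTop (fun M => (h M).aemeasurable_snd) hb
  refine ⟨ham, hbm, ?_⟩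
  have := Measure.isFiniteMeasure_map Pr a
  have := Measure.isFiniteMeasure_map Pr b
  refine ext_of_forall_integral_eq_of_IsFiniteMeasure fun f => ?_
  have key : ∀ {D : ℕ → Ω → E} {d : Ω → E}, (∀ M, AEMeasurable (D M) Pr) →
      (∀ᵐ ω ∂Pr, Tendsto (fun M => D M ω) atTop (nhds (d ω))) →
      Tendsto (fun M => ∫ ω, f (D M ω) ∂Pr) atTop (nhds (∫ ω, f (d ω) ∂Pr)) := by
    intro D d hD hd
    refine tendsto_integral_of_dominated_convergence (fun _ => ‖f‖)
      (fun M => (f.continuous.measurable.comp_aemeasurable (hD M)).aestronglyMeasurable)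
      (integrable_const _) (fun M => ae_of_all _ fun ω => f.norm_coe_le_norm _) ?_
    filter_upwards [hd] with ω hω
    exact (f.continuous.tendsto _).comp hω
  rw [integral_map ham f.continuous.measurable.aestronglyMeasurable,
    integral_map hbm f.continuous.measurable.aestronglyMeasurable]
  refine tendsto_nhds_unique (key (fun M => (h M).aemeasurable_fst) ha) ?_
  refine (key (fun M => (h M).aemeasurable_snd) hb).congr fun M => ?_
  exact ((h M).comp f.continuous.measurable).integral_eq.symm

/-- Almost every sample of a law `μ` computes, for almost every `ω`, the integrals `∫ F(r, ω) μ(dr)`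
as limits of averages. -/
lemma ae_sample_tendsto [SFinite Pr] (μ : Measure ℝ) [IsProbabilityMeasure μ] {F : ℝ → Ω → ℝ}
    (hF : Measurable fun p : ℝ × Ω => F p.1 p.2)
    (hi : ∀ᵐ ω ∂Pr, Integrable (fun r => F r ω) μ) :
    ∀ᵐ s ∂(Measure.infinitePi fun _ : ℕ => μ), ∀ᵐ ω ∂Pr,
      Tendsto (fun M : ℕ => (M : ℝ)⁻¹ • ∑ l ∈ Finset.range M, F (s l) ω) atTop
        (nhds (∫ r, F r ω ∂μ)) := by
  have hmeas : MeasurableSet {x : Ω × (ℕ → ℝ) |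
      Tendsto (fun M : ℕ => (M : ℝ)⁻¹ • ∑ l ∈ Finset.range M, F (x.2 l) x.1) atTop
        (nhds (∫ r, F r x.1 ∂μ))} := by
    refine measurableSet_tendsto_fun (fun M => ?_) ?_
    · have h1 : ∀ l ∈ Finset.range M, Measurable fun x : Ω × (ℕ → ℝ) => F (x.2 l) x.1 :=
        fun l _ => hF.comp (by fun_prop : Measurable fun x : Ω × (ℕ → ℝ) => (x.2 l, x.1))
      exact (Finset.measurable_sum _ h1).const_smul (M : ℝ)⁻¹
    · have h1 : StronglyMeasurable (Function.uncurry fun (ω : Ω) (r : ℝ) => F r ω) :=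
        (hF.comp measurable_swap).stronglyMeasurable
      exact h1.integral_prod_right.measurable.comp measurable_fst
  -- For fixed `ω` this is the strong law of large numbers over the samples. Fubini exchanges the
  -- quantifiers, giving one deterministic sample good for almost every `ω`.
  refine (Measure.ae_ae_comm (μ := Pr) (ν := Measure.infinitePi fun _ : ℕ => μ) hmeas).1 ?_
  filter_upwards [hi] with ω hω
  have hFω : Measurable fun r => F r ω := hF.comp (measurable_id.prodMk measurable_const)
  have hmp : ∀ l : ℕ, MeasurePreserving (fun s : ℕ → ℝ => s l)
      (Measure.infinitePi fun _ : ℕ => μ) μ := fun l =>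
    measurePreserving_eval_infinitePi (fun _ : ℕ => μ) l
  have hlaw : ∀ l : ℕ, Measure.map (fun s : ℕ → ℝ => F (s l) ω) (Measure.infinitePi fun _ : ℕ => μ)
      = μ.map fun r => F r ω := fun l => by
    conv_rhs => rw [← (hmp l).map_eq, Measure.map_map hFω (hmp l).measurable]
    rfl
  have hX : ∀ l : ℕ, Measurable fun s : ℕ → ℝ => F (s l) ω :=
    fun l => hFω.comp (measurable_pi_apply l)
  have h1 := strong_law_ae (μ := Measure.infinitePi fun _ : ℕ => μ)
    (fun (l : ℕ) (s : ℕ → ℝ) => F (s l) ω)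
    ((hmp 0).integrable_comp_of_integrable hω)
    (fun i j hij => (iIndepFun_infinitePi (P := fun _ : ℕ => μ)
      (X := fun _ r => F r ω) fun _ => hFω).indepFun hij)
    (fun l => ⟨(hX l).aemeasurable, (hX 0).aemeasurable, by rw [hlaw, hlaw]⟩)
  have h2 : ∫ s, F (s 0) ω ∂(Measure.infinitePi fun _ : ℕ => μ) = ∫ r, F r ω ∂μ := by
    conv_rhs => rw [← (hmp 0).map_eq]
    rw [integral_map (hmp 0).measurable.aemeasurable hFω.aestronglyMeasurable]
  rwa [h2] at h1

lemma HasStationaryIncrements.identDistrib {n : ℕ} {Z : ℝ → Ω → Fin n → ℝ}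
    (hZ : HasStationaryIncrements Pr Z) {ι : Type*} [Fintype ι] (τ : ι → ℝ) (h : ℝ) :
    IdentDistrib (fun ω i => Z (τ i + h) ω - Z h ω) (fun ω i => Z (τ i) ω - Z 0 ω) Pr Pr := by
  let e := Fintype.equivFin ι
  have := (hZ h (Fintype.card ι) fun i => τ (e.symm i)).comp
    (u := fun (v : Fin (Fintype.card ι) → Fin n → ℝ) (i : ι) => v (e i)) (by fun_prop)
  simpa [Function.comp_def] using this

/-- The moving average `∫ K(r) (Z_{t-r} - Z_t) dr` of increments. -/
def incAverage {n : ℕ} (K : ℝ → Mat n) (Z : ℝ → Ω → Fin n → ℝ) (t : ℝ) (ω : Ω) (a : Fin n) : ℝ :=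
  ∑ b, ∫ r, K r a b * (Z (t - r) ω b - Z t ω b)

/-- The integral is an almost sure limit of sample averages at fixed deterministic points. Each
average is a function of finitely many increments of `Z`, so its law is shift invariant, and so is
the law of the limit. No path regularity beyond measurability is needed, unlike for Riemann sums. -/
lemma isStationary_incAverage [IsProbabilityMeasure Pr] {n : ℕ} {Z : ℝ → Ω → Fin n → ℝ}
    (hZ : IsNoise Pr Z) {K : ℝ → Mat n} (hK : ∀ a b, IsRapid fun u => K u a b) :
    IsStationary Pr (incAverage K Z) := by
  intro h N t
  -- Any everywhere positive probability density would do: dividing by it turns the Lebesgue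
  -- integral into an expectation that can be sampled.
  set g : ℝ → ℝ := gaussianPDFReal 0 1 with hg
  have hgpos : ∀ r, 0 < g r := fun r => gaussianPDFReal_pos 0 1 r one_ne_zero
  have hgm : Measurable g := measurable_gaussianPDFReal 0 1
  let F : ℝ → Fin n → Fin n → ℝ → Ω → ℝ := fun t a b r ω =>
    K r a b / g r * (Z (t - r) ω b - Z t ω b)
  have hZm : ∀ b, Measurable fun p : ℝ × Ω => Z p.1 p.2 b :=
    fun b => (measurable_pi_apply b).comp hZ.measurable
  have hFm : ∀ t a b, Measurable fun p : ℝ × Ω => F t a b p.1 p.2 := fun t a b => by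
    have hKm := (hK a b).1
    refine ((hKm.comp measurable_fst).div (hgm.comp measurable_fst)).mul (Measurable.sub ?_ ?_)
    · exact (hZm b).comp (by fun_prop : Measurable fun p : ℝ × Ω => (t - p.1, p.2))
    · exact (hZm b).comp (by fun_prop : Measurable fun p : ℝ × Ω => (t, p.2))
  have hgF : ∀ t a b r ω, g r • F t a b r ω = K r a b * (Z (t - r) ω b - Z t ω b) :=
    fun t a b r ω => by
      simp only [F, smul_eq_mul]
      rw [← mul_assoc, mul_div_cancel₀ _ (hgpos r).ne']
  have hFi : ∀ t a b, ∀ᵐ ω ∂Pr, Integrable (fun r => F t a b r ω) (gaussianReal 0 1) := by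
    intro t a b
    filter_upwards [(hZ.isModerate b).ae_isTempered] with ω hω
    rw [gaussianReal_of_var_ne_zero 0 one_ne_zero,
      integrable_withDensity_iff_integrable_smul' (measurable_gaussianPDF 0 1)
        (ae_of_all _ fun r => gaussianPDF_lt_top)]
    have h1 := (integrable_cnv (hK a b) hω t).sub ((hK a b).integrable.mul_const (Z t ω b))
    refine h1.congr (ae_of_all _ fun r => ?_)
    simp only [toReal_gaussianPDF, Pi.sub_apply]
    rw [← mul_sub]
    exact (hgF t a b r ω).symm
  have hFint : ∀ t a b ω, ∫ r, F t a b r ω ∂(gaussianReal 0 1)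
      = ∫ r, K r a b * (Z (t - r) ω b - Z t ω b) := fun t a b ω => by
    rw [integral_gaussianReal_eq_integral_smul one_ne_zero]
    exact integral_congr_ae (ae_of_all _ fun r => hgF t a b r ω)
  have hall : ∀ᵐ s ∂(Measure.infinitePi fun _ : ℕ => gaussianReal 0 1),
      ∀ (i : Fin N) (a b : Fin n), (∀ᵐ ω ∂Pr,
        Tendsto (fun M : ℕ => (M : ℝ)⁻¹ • ∑ l ∈ Finset.range M, F (t i + h) a b (s l) ω) atTop
          (nhds (∫ r, F (t i + h) a b r ω ∂(gaussianReal 0 1)))) ∧ ∀ᵐ ω ∂Pr,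
        Tendsto (fun M : ℕ => (M : ℝ)⁻¹ • ∑ l ∈ Finset.range M, F (t i) a b (s l) ω) atTop
          (nhds (∫ r, F (t i) a b r ω ∂(gaussianReal 0 1))) := by
    simp only [ae_all_iff]
    intro i a b
    filter_upwards [ae_sample_tendsto (gaussianReal 0 1) (hFm (t i + h) a b) (hFi _ a b),
      ae_sample_tendsto (gaussianReal 0 1) (hFm (t i) a b) (hFi _ a b)] with s h1 h2
    exact ⟨h1, h2⟩
  obtain ⟨s, hs⟩ := hall.exists
  have hlim : ∀ t' : Fin N → ℝ, (∀ i a b, ∀ᵐ ω ∂Pr,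
      Tendsto (fun M : ℕ => (M : ℝ)⁻¹ • ∑ l ∈ Finset.range M, F (t' i) a b (s l) ω) atTop
          (nhds (∫ r, F (t' i) a b r ω ∂(gaussianReal 0 1)))) →
      ∀ᵐ ω ∂Pr, Tendsto (fun (M : ℕ) (i : Fin N) (a : Fin n) =>
        ∑ b, (M : ℝ)⁻¹ • ∑ l ∈ Finset.range M, F (t' i) a b (s l) ω) atTop
        (nhds fun i => incAverage K Z (t' i) ω) := by
    intro t' ht'
    simp only [← ae_all_iff] at ht'
    filter_upwards [ht'] with ω hω
    rw [tendsto_pi_nhds]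
    intro i
    rw [tendsto_pi_nhds]
    intro a
    have := tendsto_finsetSum Finset.univ fun b _ => hω i a b
    simpa only [hFint, incAverage] using this
  refine identDistrib_of_tendsto_ae (fun M => ?_)
    (hlim (fun i => t i + h) fun i a b => (hs i a b).1) (hlim t fun i a b => (hs i a b).2)
  -- The finitely many times involved are `t_i - s_l` and `t_i`; the common reference value `Z_h` or
  -- `Z_0` drops out of the differences.
  have hid := (hZ.stationaryIncrements.identDistrib (ι := (Fin N × Fin M) ⊕ Fin N)
    (Sum.elim (fun x => t x.1 - s x.2) t) h).comp
    (u := fun (v : (Fin N × Fin M) ⊕ Fin N → Fin n → ℝ) (i : Fin N) (a : Fin n) =>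
      ∑ b, (M : ℝ)⁻¹ • ∑ l : Fin M, K (s l) a b / g (s l) * (v (Sum.inl (i, l)) b - v (Sum.inr i) b))
    (by fun_prop)
  convert hid using 1
  · funext ω i a
    simp only [Finset.sum_range, F, Function.comp_def, Sum.elim_inl, Sum.elim_inr, Pi.sub_apply,
      sub_sub_sub_cancel_right]
    refine Finset.sum_congr rfl fun b _ => congrArg _ (Finset.sum_congr rfl fun l _ => ?_)
    rw [sub_add_eq_add_sub]
  · funext ω i a
    simp only [Finset.sum_range, F, Function.comp_def, Sum.elim_inl, Sum.elim_inr, Pi.sub_apply,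
      sub_sub_sub_cancel_right]

end Stationarity

/-! ### The delay equation for a single path -/

section Paths

variable {n : ℕ}

/-- Convolution of a matrix kernel with a vector path. -/
def mcnv (K : ℝ → Mat n) (z : ℝ → Fin n → ℝ) (t : ℝ) (a : Fin n) : ℝ :=
  ∑ b, cnv (fun u => K u a b) (fun s => z s b) t

lemma isTempered_mcnv {K : ℝ → Mat n} (hK : ∀ a b, IsRapid fun u => K u a b)
    {z : ℝ → Fin n → ℝ} (hz : ∀ b, IsTempered fun s => z s b) (a : Fin n) :
    IsTempered fun t => mcnv K z t a :=
  IsTempered.sum _ fun b _ => IsTempered.cnv (hK a b) (hz b)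

/-- The paths `k_{j+1} * z`, with `z` added for `j + 1 = m`: the derivatives of `k_0 * dz`. -/
def derivPath (m : ℕ) (k : ℕ → ℝ → Mat n) (z : ℝ → Fin n → ℝ) (j : ℕ) (t : ℝ) (a : Fin n) : ℝ :=
  mcnv (k (j + 1)) z t a + if j + 1 = m then z t a else 0

lemma intervalIntegral_apply {v : ℝ → Fin n → ℝ} {s t : ℝ} (hst : s ≤ t)
    (hv : ∀ a, IntervalIntegrable (fun u => v u a) volume s t) (a : Fin n) :
    (∫ u in s..t, v u) a = ∫ u in s..t, v u a := by
  rw [intervalIntegral.integral_of_le hst, intervalIntegral.integral_of_le hst]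
  exact eval_integral (fun a => (hv a).1) a

lemma intervalIntegrable_pi {v : ℝ → Fin n → ℝ} {s t : ℝ}
    (hv : ∀ a, IntervalIntegrable (fun u => v u a) volume s t) :
    IntervalIntegrable v volume s t :=
  ⟨Integrable.of_eval fun a => (hv a).1, Integrable.of_eval fun a => (hv a).2⟩

lemma mcnv_mcnv {K L : ℝ → Mat n} (hK : ∀ a b, IsRapid fun u => K u a b)
    (hL : ∀ a b, IsRapid fun u => L u a b) {z : ℝ → Fin n → ℝ}
    (hz : ∀ b, IsTempered fun s => z s b) (t : ℝ) (a : Fin n) :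
    mcnv K (mcnv L z) t a
      = ∑ b, cnv (fun u => ∑ c, cnv (fun u => K u a c) (fun u => L u c b) u)
        (fun s => z s b) t := by
  have h1 : ∀ c, cnv (fun u => K u a c) (fun s => mcnv L z s c) t
      = ∑ b, cnv (cnv (fun u => K u a c) fun u => L u c b) (fun s => z s b) t := by
    intro c
    simp only [mcnv]
    rw [cnv_sum_right _ (hK a c) (fun b _ => IsTempered.cnv (hL c b) (hz b))]
    exact Finset.sum_congr rfl fun b _ => by rw [cnv_assoc (hK a c) (hL c b) (hz b)]
  rw [mcnv, Finset.sum_congr rfl fun c _ => h1 c, Finset.sum_comm]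
  refine Finset.sum_congr rfl fun b _ => ?_
  rw [cnv_sum_left _ (fun c _ => (hK a c).cnv (hL c b)) (hz b)]

/-- Causality of `f` turns the integral over the past into a convolution over the whole line. -/
lemma delay_eq_mcnv {f : ℝ → Mat n} (hf : ∀ a b, IsRapid fun u => f u a b)
    (hc : ∀ u < 0, f u = 0) {x : ℝ → Fin n → ℝ} (hx : ∀ b, IsTempered fun s => x s b) (u : ℝ) :
    ∫ v in Set.Ioi 0, (f v).mulVec (x (u - v)) = mcnv f x u := by
  funext a
  have hi : ∀ a b, Integrable fun v => f v a b * x (u - v) b :=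
    fun a b => integrable_cnv (hf a b) (hx b) u
  have hi' : ∀ a, Integrable fun v => (f v).mulVec (x (u - v)) a := fun a => by
    simp only [Matrix.mulVec, dotProduct]
    exact integrable_finsetSum _ fun b _ => hi a b
  rw [eval_integral (fun a => (hi' a).integrableOn), ← integral_Ici_eq_integral_Ioi,
    setIntegral_eq_integral_of_forall_compl_eq_zero]
  · simp only [Matrix.mulVec, dotProduct, mcnv, cnv]
    exact integral_finsetSum _ fun b _ => hi a b
  · intro v hv
    rw [hc v (by simpa using hv)]
    simp

lemma integrableOn_delay {f : ℝ → Mat n} (hf : ∀ a b, IsRapid fun u => f u a b)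
    {x : ℝ → Fin n → ℝ} (hx : ∀ b, IsTempered fun s => x s b) (s t : ℝ) :
    IntegrableOn (fun p : ℝ × ℝ => (f p.2).mulVec (x (p.1 - p.2)))
      (Set.Ioc s t ×ˢ Set.Ioi 0) (volume.prod volume) := by
  refine Integrable.of_eval fun a => ?_
  simp only [Matrix.mulVec, dotProduct]
  exact integrable_finsetSum _ fun b _ =>
    integrableOn_prod_cnv (hf a b) (hx b) s t measurableSet_Ioi

namespace IsKernelSystem

variable {m : ℕ} {C : ℕ → Mat n} {f : ℝ → Mat n} {k : ℕ → ℝ → Mat n}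

lemma isTempered_derivPath (hk : IsKernelSystem m C f k) {z : ℝ → Fin n → ℝ}
    (hz : ∀ b, IsTempered fun s => z s b) {j : ℕ} (hj : j < m) (a : Fin n) :
    IsTempered fun t => derivPath m k z j t a := by
  refine (isTempered_mcnv (hk.rapid (j + 1) hj) hz a).add ?_
  split_ifs
  · exact hz a
  · exact IsTempered.zero

/-- The step identity of the kernels convolved with the path; the unit jump of `k (m - 1)`
contributes the path itself to the last derivative. -/
lemma mcnv_sub_shift (hk : IsKernelSystem m C f k) {z : ℝ → Fin n → ℝ}
    (hz : ∀ b, IsTempered fun s => z s b) {j : ℕ} (hj : j < m) {h : ℝ} (hh : 0 ≤ h) (t : ℝ)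
    (a : Fin n) :
    mcnv (k j) z t a - mcnv (k j) z (t - h) a
      = cnv (box h) (fun u => derivPath m k z j u a) t := by
  have hb := isRapid_box h
  have h1 : ∀ b, cnv (fun u => k j u a b) (fun s => z s b) t
      - cnv (fun u => k j u a b) (fun s => z s b) (t - h)
      = (if j + 1 = m ∧ a = b then 1 else 0) * cnv (box h) (fun s => z s b) t
        + cnv (box h) (cnv (fun u => k (j + 1) u a b) fun s => z s b) t := by
    intro b
    rw [← cnv_shift_left, ← cnv_sub_left (hk.rapid j hj.le a b) ((hk.rapid j hj.le a b).shift h)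
      (hz b), cnv_congr_ae (hk.step j hj h hh a b),
      cnv_add_left (hb.const_mul _) (hb.cnv (hk.rapid (j + 1) hj a b)) (hz b),
      cnv_const_mul_left, cnv_assoc hb (hk.rapid (j + 1) hj a b) (hz b)]
  have h2 : IsTempered fun u => if j + 1 = m then z u a else 0 := by
    split_ifs
    · exact hz a
    · exact IsTempered.zero
  simp only [derivPath]
  rw [cnv_add_right hb (isTempered_mcnv (hk.rapid (j + 1) hj) hz a) h2]
  simp only [mcnv]
  rw [← Finset.sum_sub_distrib, Finset.sum_congr rfl fun b _ => h1 b, Finset.sum_add_distrib,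
    cnv_sum_right _ hb fun b _ => IsTempered.cnv (hk.rapid (j + 1) hj a b) (hz b), add_comm]
  congr 1
  by_cases hjm : j + 1 = m
  · simp [hjm]
  · simp [hjm, cnv]

lemma mcnv_sub (hk : IsKernelSystem m C f k) {z : ℝ → Fin n → ℝ}
    (hz : ∀ b, IsTempered fun s => z s b) {j : ℕ} (hj : j < m) {s t : ℝ} (hst : s ≤ t)
    (a : Fin n) :
    mcnv (k j) z t a - mcnv (k j) z s a = ∫ u in s..t, derivPath m k z j u a := by
  have := hk.mcnv_sub_shift hz hj (sub_nonneg.2 hst) t a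
  rwa [sub_sub_cancel, cnv_box _ (sub_nonneg.2 hst), sub_sub_cancel] at this

lemma mcnv_left (hk : IsKernelSystem m C f k) (hm : 0 < m) {z : ℝ → Fin n → ℝ}
    (hz : ∀ b, IsTempered fun s => z s b) (t : ℝ) (a : Fin n) :
    mcnv (k m) z t a + ∑ j ∈ Finset.range m, ∑ c, C j a c * mcnv (k j) z t c
      = mcnv f (mcnv (k 0) z) t a := by
  have hr : ∀ j ∈ Finset.range m, ∀ c b, IsRapid fun u => k j u c b :=
    fun j hj => hk.rapid j (Finset.mem_range.1 hj).le
  rw [mcnv_mcnv hk.rapid_delay (hk.rapid 0 hm.le) hz]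
  have h1 : ∀ b, cnv (fun u => ∑ c, cnv (fun u => f u a c) (fun u => k 0 u c b) u)
      (fun s => z s b) t = cnv (fun u => k m u a b) (fun s => z s b) t
        + ∑ j ∈ Finset.range m, ∑ c, C j a c * cnv (fun u => k j u c b) (fun s => z s b) t := by
    intro b
    have hr1 : ∀ j ∈ Finset.range m, ∀ c ∈ Finset.univ, IsRapid fun u => C j a c * k j u c b :=
      fun j hj c _ => (hr j hj c b).const_mul _
    rw [← cnv_congr_ae (hk.left a b), cnv_add_left (hk.rapid m le_rfl a b)
      (IsRapid.sum _ fun j hj => IsRapid.sum _ (hr1 j hj)) (hz b),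
      cnv_sum_left _ (fun j hj => IsRapid.sum _ (hr1 j hj)) (hz b)]
    congr 1
    refine Finset.sum_congr rfl fun j hj => ?_
    rw [cnv_sum_left _ (hr1 j hj) (hz b)]
    exact Finset.sum_congr rfl fun c _ => cnv_const_mul_left _ _ _ _
  rw [Finset.sum_congr rfl fun b _ => h1 b, Finset.sum_add_distrib]
  congr 1
  refine Eq.trans (Finset.sum_congr rfl fun j _ => ?_) Finset.sum_comm
  refine Eq.trans ?_ Finset.sum_comm
  exact Finset.sum_congr rfl fun c _ => by rw [mcnv, Finset.mul_sum]

/-- Convolution with `f` commutes with convolution with `box h`, so the increment formula for `k 0 *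
z` passes through `f`. -/
lemma mcnv_delay_sub (hk : IsKernelSystem m C f k) (hm : 0 < m) {z : ℝ → Fin n → ℝ}
    (hz : ∀ b, IsTempered fun s => z s b) {s t : ℝ} (hst : s ≤ t) (a : Fin n) :
    mcnv f (mcnv (k 0) z) t a - mcnv f (mcnv (k 0) z) s a
      = ∫ u in s..t, mcnv f (derivPath m k z 0) u a := by
  obtain ⟨h, rfl⟩ : ∃ h, s = t - h := ⟨t - s, by ring⟩
  have hh : 0 ≤ h := by linarith
  have hb := isRapid_box h
  have hW := isTempered_mcnv (hk.rapid 0 hm.le) hz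
  have hD := fun b => hk.isTempered_derivPath hz hm b
  rw [← cnv_box _ hh]
  simp only [mcnv]
  rw [← Finset.sum_sub_distrib,
    cnv_sum_right _ hb fun b _ => IsTempered.cnv (hk.rapid_delay a b) (hD b)]
  refine Finset.sum_congr rfl fun b _ => ?_
  have h1 : (fun s => mcnv (k 0) z s b - mcnv (k 0) z (s - h) b)
      = cnv (box h) fun u => derivPath m k z 0 u b :=
    funext fun s => hk.mcnv_sub_shift hz hm hh s b
  have h2 := cnv_sub_right (hk.rapid_delay a b) (hW b) ((hW b).shift h) t
  rw [h1, cnv_shift _ (fun s => mcnv (k 0) z s b)] at h2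
  rw [← cnv_assoc hb (hk.rapid_delay a b) (hD b), cnv_comm (box h),
    cnv_assoc (hk.rapid_delay a b) hb (hD b), h2]
  rfl

/-- Take increments over `[s, t]` in `mcnv_left`: those of `k j * z` are integrals of the `j`-th
derivative, and that of `k m * z` is the increment of the last derivative less that of `z`. -/
lemma derivPath_equation (hk : IsKernelSystem m C f k) (hm : 0 < m) {z : ℝ → Fin n → ℝ}
    (hz : ∀ b, IsTempered fun s => z s b) {s t : ℝ} (hst : s ≤ t) (a : Fin n) :
    derivPath m k z (m - 1) t a - derivPath m k z (m - 1) s a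
      = -(∑ j ∈ Finset.range m, ∑ c, C j a c * ∫ u in s..t, derivPath m k z j u c)
        + (∫ u in s..t, mcnv f (derivPath m k z 0) u a) + (z t a - z s a) := by
  have h1 := hk.mcnv_left hm hz t a
  have h2 := hk.mcnv_left hm hz s a
  have h3 := hk.mcnv_delay_sub hm hz hst a
  have h4 : ∑ j ∈ Finset.range m, ∑ c, C j a c * ∫ u in s..t, derivPath m k z j u c
      = (∑ j ∈ Finset.range m, ∑ c, C j a c * mcnv (k j) z t c)
        - ∑ j ∈ Finset.range m, ∑ c, C j a c * mcnv (k j) z s c := by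
    rw [← Finset.sum_sub_distrib]
    refine Finset.sum_congr rfl fun j hj => ?_
    rw [← Finset.sum_sub_distrib]
    exact Finset.sum_congr rfl fun c _ => by
      rw [← hk.mcnv_sub hz (Finset.mem_range.1 hj) hst, mul_sub]
  rw [h4, ← h3]
  simp only [derivPath, Nat.sub_add_cancel hm, if_true]
  linarith

end IsKernelSystem

end Paths

/-! ### Existence of a solution -/

section Existence

variable {Ω : Type*} [MeasurableSpace Ω] {Pr : Measure Ω} {n m : ℕ} {C : ℕ → Mat n}
  {f : ℝ → Mat n} {k : ℕ → ℝ → Mat n} {Z : ℝ → Ω → Fin n → ℝ}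

lemma measurable_derivPath (hk : IsKernelSystem m C f k)
    (hZ : Measurable fun x : ℝ × Ω => Z x.1 x.2) {j : ℕ} (hj : j < m) :
    Measurable fun x : ℝ × Ω => derivPath m k (fun s => Z s x.2) j x.1 := by
  have hZb : ∀ b, Measurable fun x : ℝ × Ω => Z x.1 x.2 b :=
    fun b => (measurable_pi_apply b).comp hZ
  refine measurable_pi_iff.2 fun a => ?_
  simp only [derivPath, mcnv]
  refine (Finset.measurable_sum _ fun b _ =>
    measurable_cnv_process (x := fun s ω => Z s ω b) (hZb b) (hk.rapid (j + 1) hj a b).1).add ?_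
  split_ifs
  · exact hZb a
  · exact measurable_const

omit [MeasurableSpace Ω] in
-- The total mass of `k 1` is minus the identity for `m = 1` and zero otherwise, so subtracting
-- `Z_t` under the integral accounts exactly for the extra term. The process is thereby seen to
-- depend on increments only.
lemma derivPath_zero_eq_incAverage (hk : IsKernelSystem m C f k) (hm : 0 < m) {ω : Ω}
    (hz : ∀ b, IsTempered fun s => Z s ω b) (t : ℝ) (a : Fin n) :
    derivPath m k (fun s => Z s ω) 0 t a = incAverage (k 1) Z t ω a := by
  simp only [derivPath, incAverage, mcnv, zero_add]
  have h1 : ∀ b, ∫ r, k 1 r a b * (Z (t - r) ω b - Z t ω b)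
      = cnv (fun u => k 1 u a b) (fun s => Z s ω b) t
        + (if 1 = m ∧ a = b then 1 else 0) * Z t ω b := by
    intro b
    simp only [mul_sub]
    rw [integral_sub (integrable_cnv (hk.rapid 1 hm a b) (hz b) t)
      ((hk.rapid 1 hm a b).integrable.mul_const _), integral_mul_const, hk.integral, cnv]
    ring
  rw [Finset.sum_congr rfl fun b _ => h1 b, Finset.sum_add_distrib]
  congr 1
  by_cases hm1 : 1 = m
  · simp [hm1]
  · simp [hm1]

lemma isSolution_derivPath [IsProbabilityMeasure Pr] (hk : IsKernelSystem m C f k) (hm : 0 < m)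
    (hZ : IsNoise Pr Z) :
    IsSolution Pr m C f Z fun t ω => derivPath m k (fun s => Z s ω) 0 t := by
  have hz : ∀ᵐ ω ∂Pr, ∀ b, IsTempered fun s => Z s ω b :=
    ae_all_iff.2 fun b => (hZ.isModerate b).ae_isTempered
  refine ⟨measurable_derivPath hk hZ.measurable hm, fun t a => ?_, ?_, fun s t _ => ?_,
    fun j t ω => derivPath m k (fun s => Z s ω) j t,
    ⟨rfl, fun j hj => measurable_derivPath hk hZ.measurable hj, fun j hj => ?_, fun j hj => ?_⟩,
    fun s t hst => ?_⟩
  · simp only [derivPath, mcnv]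
    refine (integrable_finsetSum _ fun b _ =>
      (hZ.isModerate b).integrable_cnv (hk.rapid (0 + 1) hm a b) t).add ?_
    split_ifs
    · exact hZ.integrable t a
    · exact integrable_const _
  · intro h N t
    have h1 : ∀ t : Fin N → ℝ, (fun ω i => derivPath m k (fun s => Z s ω) 0 (t i))
        =ᵐ[Pr] fun ω i => incAverage (k 1) Z (t i) ω := fun t => by
      filter_upwards [hz] with ω hω
      funext i a
      exact derivPath_zero_eq_incAverage hk hm hω (t i) a
    have h2 := isStationary_incAverage hZ (hk.rapid 1 hm) h N t
    have hm1 : ∀ t : Fin N → ℝ, AEMeasurable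
        (fun ω i => derivPath m k (fun s => Z s ω) 0 (t i)) Pr := fun t => by
      refine (measurable_pi_iff.2 fun i => ?_).aemeasurable
      exact (measurable_derivPath hk hZ.measurable hm).comp
        (by fun_prop : Measurable fun ω : Ω => (t i, ω))
    exact ((IdentDistrib.of_ae_eq (hm1 _) (h1 _)).trans h2).trans
      (IdentDistrib.of_ae_eq (hm1 _) (h1 _)).symm
  · filter_upwards [hz] with ω hω
    exact integrableOn_delay hk.rapid_delay (fun b => hk.isTempered_derivPath hω hm b) s t
  · filter_upwards [hz] with ω hω s t
    exact intervalIntegrable_pi fun a => (hk.isTempered_derivPath hω hj a).intervalIntegrable s t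
  · filter_upwards [hz] with ω hω s t hst
    funext a
    rw [intervalIntegral_apply hst.le
      fun a => (hk.isTempered_derivPath hω hj a).intervalIntegrable s t,
      ← hk.mcnv_sub hω hj hst.le]
    simp [derivPath, (show j + 1 ≠ m by omega)]
  · filter_upwards [hz] with ω hω
    have hD := fun j (hj : j < m) b => hk.isTempered_derivPath hω hj b
    simp only [delay_eq_mcnv hk.rapid_delay hk.causal (hD 0 hm)]
    funext a
    have h1 := hk.derivPath_equation hm hω hst.le a
    simp only [Pi.sub_apply, Pi.add_apply, Pi.neg_apply, Finset.sum_apply]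
    rw [h1, intervalIntegral_apply hst.le fun a =>
      (isTempered_mcnv hk.rapid_delay (hD 0 hm) a).intervalIntegrable s t]
    congr 3
    refine Finset.sum_congr rfl fun j hj => ?_
    have hi := fun c => (hD j (Finset.mem_range.1 hj) c).intervalIntegrable s t
    have hi' : ∀ a c, IntervalIntegrable
        (fun u => C j a c * derivPath m k (fun s => Z s ω) j u c) volume s t :=
      fun a c => (hi c).const_mul _
    rw [intervalIntegral_apply hst.le (fun a => by
      simp only [Matrix.mulVec, dotProduct]
      rw [← Finset.sum_fn]
      exact IntervalIntegrable.sum _ fun c _ => hi' a c)]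
    simp only [Matrix.mulVec, dotProduct]
    rw [intervalIntegral.integral_finsetSum fun c _ => hi' a c]
    simp only [intervalIntegral.integral_const_mul]

end Existence

/-! ### From the stochastic integral to convolutions of paths -/

section StochasticIntegral

variable {Ω : Type*} [MeasurableSpace Ω] {Pr : Measure Ω}

lemma stochInt_congr (I : L1L2 →ₗ[ℝ] Lp ℝ 1 Pr) {φ ψ : ℝ → ℝ} (h : φ =ᵐ[volume] ψ) :
    stochInt I φ = stochInt I ψ := by
  by_cases hφ : MemLp φ 1 volume ∧ MemLp φ 2 volume
  · have hψ : MemLp ψ 1 volume ∧ MemLp ψ 2 volume := ⟨hφ.1.ae_eq h, hφ.2.ae_eq h⟩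
    rw [stochInt, stochInt, dif_pos hφ, dif_pos hψ]
    have : L1L2.mk φ hφ.1 hφ.2 = L1L2.mk ψ hψ.1 hψ.2 := Subtype.ext (AEEqFun.mk_eq_mk.2 h)
    rw [this]
  · have hψ : ¬(MemLp ψ 1 volume ∧ MemLp ψ 2 volume) :=
      fun hψ => hφ ⟨hψ.1.ae_eq h.symm, hψ.2.ae_eq h.symm⟩
    rw [stochInt, stochInt, dif_neg hφ, dif_neg hψ]

lemma stochInt_sub (I : L1L2 →ₗ[ℝ] Lp ℝ 1 Pr) {φ ψ : ℝ → ℝ} (hφ1 : MemLp φ 1 volume)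
    (hφ2 : MemLp φ 2 volume) (hψ1 : MemLp ψ 1 volume) (hψ2 : MemLp ψ 2 volume) :
    stochInt I (fun u => φ u - ψ u) =ᵐ[Pr] fun ω => stochInt I φ ω - stochInt I ψ ω := by
  have e1 : stochInt I φ = I (L1L2.mk φ hφ1 hφ2) := dif_pos ⟨hφ1, hφ2⟩
  have e2 : stochInt I ψ = I (L1L2.mk ψ hψ1 hψ2) := dif_pos ⟨hψ1, hψ2⟩
  have e3 : stochInt I (fun u => φ u - ψ u)
      = I (L1L2.mk (fun u => φ u - ψ u) (hφ1.sub hψ1) (hφ2.sub hψ2)) :=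
    dif_pos ⟨hφ1.sub hψ1, hφ2.sub hψ2⟩
  rw [e1, e2, e3]
  have : L1L2.mk (fun u => φ u - ψ u) (hφ1.sub hψ1) (hφ2.sub hψ2)
      = L1L2.mk φ hφ1 hφ2 - L1L2.mk ψ hψ1 hψ2 := rfl
  rw [this, map_sub]
  exact Lp.coeFn_sub _ _

lemma memLp_stepMix {l : ℝ → ℝ} (hl : IsRapid l) (t : ℝ) :
    MemLp (fun u => stepMix l (t - u)) 1 volume ∧ MemLp (fun u => stepMix l (t - u)) 2 volume := by
  have hi : Integrable fun u => stepMix l (t - u) := (integrable_stepMix hl).comp_sub_left t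
  refine ⟨memLp_one_iff_integrable.2 hi, ?_⟩
  have hb : ∀ u, ‖stepMix l (t - u)‖ ≤ ∫ r, ‖l r‖ := fun u => by
    refine norm_integral_le_of_norm_le hl.integrable.norm (ae_of_all _ fun r => ?_)
    rw [norm_mul]
    exact mul_le_of_le_one_left (norm_nonneg _) (abs_stepDiff_le _ _)
  rw [memLp_two_iff_integrable_sq_norm hi.1]
  refine (hi.norm.const_mul (∫ r, ‖l r‖)).mono' (hi.1.norm.pow 2) (ae_of_all _ fun u => ?_)
  rw [norm_pow, norm_norm, sq]
  gcongr
  exact hb u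

variable {n : ℕ} {Z : ℝ → Ω → Fin n → ℝ} {I : Fin n → (L1L2 →ₗ[ℝ] Lp ℝ 1 Pr)}

/-- The Fubini property of the integrator, applied to the finite measure `l(r) dr`. -/
lemma IsRegularIntegrator.stochInt_stepMix_of_nonneg (hI : IsRegularIntegrator Pr Z I) {l : ℝ → ℝ}
    (hl : IsRapid l) (h0 : ∀ u, 0 ≤ l u) (b : Fin n) (t : ℝ) :
    stochInt (I b) (fun u => stepMix l (t - u))
      =ᵐ[Pr] fun ω => ∫ r, l r * (Z (t - r) ω b - Z t ω b) := by
  have hlm := hl.1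
  have hfin := isFiniteMeasure_withDensity_ofReal hl.integrable.2
  have hint : ∀ F : ℝ → ℝ, ∫ r, F r ∂(volume.withDensity fun r => ENNReal.ofReal (l r))
      = ∫ r, l r * F r := fun F => by
    rw [integral_withDensity_eq_integral_toReal_smul (by fun_prop)
      (ae_of_all _ fun u => ENNReal.ofReal_lt_top)]
    exact integral_congr_ae (ae_of_all _ fun r => by
      simp only [ENNReal.toReal_ofReal (h0 r), smul_eq_mul])
  have h1 := hI.fubini b (volume.withDensity fun r => ENNReal.ofReal (l r)) (by
    rw [integrable_withDensity_iff_integrable_smul' (by fun_prop)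
      (ae_of_all _ fun u => ENNReal.ofReal_lt_top)]
    refine hl.integrable_mul_self.mono (by fun_prop) (ae_of_all _ fun r => ?_)
    simp only [ENNReal.toReal_ofReal (h0 r), smul_eq_mul, norm_mul, Real.norm_eq_abs, abs_abs]
    rw [mul_comm]) t
  simp only [hint] at h1
  convert h1 using 2
  funext u
  exact integral_congr_ae (ae_of_all _ fun r => mul_comm _ _)

lemma IsRegularIntegrator.stochInt_stepMix [IsProbabilityMeasure Pr]
    (hI : IsRegularIntegrator Pr Z I) (hZ : IsNoise Pr Z) {l : ℝ → ℝ} (hl : IsRapid l)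
    (b : Fin n) (t : ℝ) :
    stochInt (I b) (fun u => stepMix l (t - u))
      =ᵐ[Pr] fun ω => ∫ r, l r * (Z (t - r) ω b - Z t ω b) := by
  -- Positive and negative parts, written so that rapid decay is inherited from sums and norms.
  set p : ℝ → ℝ := fun u => 1 / 2 * (‖l u‖ + l u) with hp
  set q : ℝ → ℝ := fun u => 1 / 2 * (‖l u‖ - l u) with hq
  have hpr : IsRapid p := (hl.norm.add hl).const_mul _
  have hqr : IsRapid q := (hl.norm.sub hl).const_mul _
  have hpq : ∀ u, l u = p u - q u := fun u => by simp only [hp, hq]; ring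
  have hp0 : ∀ u, 0 ≤ p u := fun u => by
    simp only [hp, Real.norm_eq_abs]; linarith [neg_abs_le (l u)]
  have hq0 : ∀ u, 0 ≤ q u := fun u => by
    simp only [hq, Real.norm_eq_abs]; linarith [le_abs_self (l u)]
  have hmix : (fun u => stepMix l (t - u)) = fun u => stepMix p (t - u) - stepMix q (t - u) := by
    funext u
    have hi : ∀ {l : ℝ → ℝ}, IsRapid l → Integrable fun r => stepDiff r (t - u) * l r := fun hl =>
      hl.integrable.bdd_mul (c := 1) (measurable_stepDiff_left _).aestronglyMeasurable
        (ae_of_all _ fun r => abs_stepDiff_le _ _)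
    simp only [stepMix]
    rw [← integral_sub (hi hpr) (hi hqr)]
    exact integral_congr_ae (ae_of_all _ fun r => by simp only [hpq r, mul_sub])
  rw [hmix]
  obtain ⟨hp1, hp2⟩ := memLp_stepMix hpr t
  obtain ⟨hq1, hq2⟩ := memLp_stepMix hqr t
  filter_upwards [stochInt_sub (I b) hp1 hp2 hq1 hq2, hI.stochInt_stepMix_of_nonneg hpr hp0 b t,
    hI.stochInt_stepMix_of_nonneg hqr hq0 b t, (hZ.isModerate b).ae_isTempered] with ω h1 h2 h3 hω
  have hi : ∀ {l : ℝ → ℝ}, IsRapid l → Integrable fun r => l r * (Z (t - r) ω b - Z t ω b) :=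
    fun hl => by
      simp only [mul_sub]
      exact (integrable_cnv hl hω t).sub (hl.integrable.mul_const _)
  rw [h1, h2, h3, ← integral_sub (hi hpr) (hi hqr)]
  exact integral_congr_ae (ae_of_all _ fun r => by simp only [hpq r, sub_mul])

lemma IsKernel.ae_eq {P Q : Polynomial (Mat n)} {g g' : ℝ → Mat n} (hg : IsKernel P Q g)
    (hg' : IsKernel P Q g') (a b : Fin n) : (fun u => g u a b) =ᵐ[volume] fun u => g' u a b :=
  ae_eq_of_rft (memLp_one_iff_integrable.1 (hg.memL1 a b))
    (memLp_one_iff_integrable.1 (hg'.memL1 a b)) fun y _ => by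
      rw [← fourierMat_apply, ← fourierMat_apply, hg.fourier, hg'.fourier]

lemma IsDelayKernel.ae_eq {P Q R : Polynomial (Mat n)} {f f' : ℝ → Mat n}
    (hf : IsDelayKernel P Q R f) (hf' : IsDelayKernel P Q R f') : f' =ᵐ[volume] f := by
  have h : ∀ a b, ∀ᵐ u, f' u a b = f u a b := fun a b =>
    ae_eq_of_rft (hf'.integrable a b) (hf.integrable a b) fun y _ => by
      rw [← fourierMat_apply, ← fourierMat_apply, hf.fourier, hf'.fourier]
  simp only [← ae_all_iff] at h
  filter_upwards [h] with u hu
  ext a b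
  exact hu a b

/-- Any admissible kernel agrees almost everywhere with `k 0`, which is the mixture of the `f_r`
weighted by `k 1`; the integrator then acts path by path. -/
lemma IsMCARMA.ae_eq_derivPath [IsProbabilityMeasure Pr] {P Q : Polynomial (Mat n)}
    {X : ℝ → Ω → Fin n → ℝ} (hX : IsMCARMA P Q I X) (hI : IsRegularIntegrator Pr Z I)
    (hZ : IsNoise Pr Z) {m : ℕ} (hm : 0 < m) {C : ℕ → Mat n} {f : ℝ → Mat n} {k : ℕ → ℝ → Mat n}
    (hk : IsKernelSystem m C f k) (hk0 : IsKernel P Q (k 0)) (t : ℝ) :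
    (fun ω => derivPath m k (fun s => Z s ω) 0 t) =ᵐ[Pr] X t := by
  obtain ⟨g, hg, hgX⟩ := hX
  have hz : ∀ᵐ ω ∂Pr, ∀ b, IsTempered fun s => Z s ω b :=
    ae_all_iff.2 fun b => (hZ.isModerate b).ae_isTempered
  have h1 : ∀ a b, stochInt (I b) (fun u => g (t - u) a b)
      =ᵐ[Pr] fun ω => ∫ r, k 1 r a b * (Z (t - r) ω b - Z t ω b) := fun a b => by
    have h2 : (fun u => g u a b) =ᵐ[volume] stepMix fun r => k 1 r a b :=
      (hg.ae_eq hk0 a b).trans (hk.mix a b)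
    have h3 : (fun u => g (t - u) a b) =ᵐ[volume] fun u => stepMix (fun r => k 1 r a b) (t - u) :=
      (quasiMeasurePreserving_sub_left_of_right_invariant volume t).ae_eq h2
    rw [stochInt_congr (I b) h3]
    exact hI.stochInt_stepMix hZ (hk.rapid 1 hm a b) b t
  have h4 := fun a => hgX t a
  simp only [EventuallyEq, ← ae_all_iff] at h1 h4
  filter_upwards [hz, h1, h4] with ω hω h1 h4
  funext a
  rw [derivPath_zero_eq_incAverage hk hm hω, h4]
  exact Finset.sum_congr rfl fun b _ => (h1 a b).symm

end StochasticIntegral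

/-! ### Moving integrals and backward differences -/

section AveragingOperators

variable {n : ℕ}

/-- The moving integral `∫_{t-h}^t w`. -/
def movInt (h : ℝ) (w : ℝ → Fin n → ℝ) (t : ℝ) (a : Fin n) : ℝ := ∫ u in (t - h)..t, w u a

/-- The backward difference `w_t - w_{t-h}`. -/
def backDiff (h : ℝ) (w : ℝ → Fin n → ℝ) (t : ℝ) (a : Fin n) : ℝ := w t a - w (t - h) a

/-- Componentwise local integrability. -/
def IsLocInt (w : ℝ → Fin n → ℝ) : Prop :=
  ∀ a s t, IntervalIntegrable (fun u => w u a) volume s t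

/-- Componentwise temperedness. -/
def IsVecTempered (w : ℝ → Fin n → ℝ) : Prop := ∀ a, IsTempered fun u => w u a

namespace IsLocInt

lemma add {w w' : ℝ → Fin n → ℝ} (hw : IsLocInt w) (hw' : IsLocInt w') : IsLocInt (w + w') :=
  fun a s t => (hw a s t).add (hw' a s t)

lemma zero : IsLocInt (0 : ℝ → Fin n → ℝ) := fun _ _ _ => intervalIntegrable_const

lemma sum {ι : Type*} (S : Finset ι) {w : ι → ℝ → Fin n → ℝ} (hw : ∀ i ∈ S, IsLocInt (w i)) :
    IsLocInt (∑ i ∈ S, w i) := by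
  classical
  induction S using Finset.induction_on with
  | empty => simpa using zero
  | insert i S hi ih =>
    rw [Finset.sum_insert hi]
    exact (hw i (by simp)).add (ih fun j hj => hw j (by simp [hj]))

lemma mulVec {w : ℝ → Fin n → ℝ} (hw : IsLocInt w) (A : Mat n) :
    IsLocInt fun t => A.mulVec (w t) := fun a s t => by
  simp only [Matrix.mulVec, dotProduct]
  rw [← Finset.sum_fn]
  exact IntervalIntegrable.sum _ fun c _ => (hw c s t).const_mul _

lemma continuous_movInt {w : ℝ → Fin n → ℝ} (hw : IsLocInt w) (h : ℝ) (a : Fin n) :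
    Continuous fun t => movInt h w t a := by
  have h1 : (fun t => movInt h w t a)
      = fun t => (∫ u in (0 : ℝ)..t, w u a) - ∫ u in (0 : ℝ)..(t - h), w u a := by
    funext t
    exact (intervalIntegral.integral_interval_sub_left (hw a 0 t) (hw a 0 (t - h))).symm
  rw [h1]
  have h2 := intervalIntegral.continuous_primitive (fun s t => hw a s t) 0
  exact h2.sub (h2.comp (by fun_prop))

lemma movInt {w : ℝ → Fin n → ℝ} (hw : IsLocInt w) (h : ℝ) : IsLocInt (movInt h w) :=
  fun a s t => (hw.continuous_movInt h a).intervalIntegrable s t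

lemma backDiff {w : ℝ → Fin n → ℝ} (hw : IsLocInt w) (h : ℝ) : IsLocInt (backDiff h w) :=
  fun a s t => (hw a s t).sub (by
    simpa using (hw a (s - h) (t - h)).comp_sub_right h)

lemma movInt_iterate {w : ℝ → Fin n → ℝ} (hw : IsLocInt w) (h : ℝ) (i : ℕ) :
    IsLocInt ((MCARMA.movInt h)^[i] w) := by
  induction i with
  | zero => exact hw
  | succ i ih => rw [Function.iterate_succ_apply']; exact ih.movInt h

end IsLocInt

lemma movInt_backDiff {w : ℝ → Fin n → ℝ} (hw : IsLocInt w) (h : ℝ) :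
    movInt h (backDiff h w) = backDiff h (movInt h w) := by
  funext t a
  simp only [movInt, backDiff]
  rw [intervalIntegral.integral_sub (hw a _ _) (by
    simpa using (hw a (t - h - h) (t - h)).comp_sub_right h)]
  rw [intervalIntegral.integral_comp_sub_right (fun u => w u a)]

lemma movInt_iterate_backDiff {w : ℝ → Fin n → ℝ} (hw : IsLocInt w) (h : ℝ) (i : ℕ) :
    (movInt h)^[i] (backDiff h w) = backDiff h ((movInt h)^[i] w) := by
  induction i with
  | zero => rfl
  | succ i ih =>
    rw [Function.iterate_succ_apply', ih, movInt_backDiff (hw.movInt_iterate h i),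
      Function.iterate_succ_apply']

lemma movInt_congr_ae {w w' : ℝ → Fin n → ℝ} (hw : w =ᵐ[volume] w') (h : ℝ) :
    movInt h w = movInt h w' := by
  funext t a
  exact intervalIntegral.integral_congr_ae (hw.mono fun u hu _ => by rw [hu])

lemma movInt_iterate_congr_ae {w w' : ℝ → Fin n → ℝ} (hw : w =ᵐ[volume] w') (h : ℝ) (i : ℕ) :
    (movInt h)^[i] w =ᵐ[volume] (movInt h)^[i] w' := by
  cases i with
  | zero => exact hw
  | succ i => rw [Function.iterate_succ_apply, Function.iterate_succ_apply, movInt_congr_ae hw]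

lemma movInt_add {w w' : ℝ → Fin n → ℝ} (hw : IsLocInt w) (hw' : IsLocInt w') (h : ℝ) :
    movInt h (w + w') = movInt h w + movInt h w' := by
  funext t a
  exact intervalIntegral.integral_add (hw a _ _) (hw' a _ _)

lemma movInt_iterate_add {w w' : ℝ → Fin n → ℝ} (hw : IsLocInt w) (hw' : IsLocInt w') (h : ℝ)
    (i : ℕ) : (movInt h)^[i] (w + w') = (movInt h)^[i] w + (movInt h)^[i] w' := by
  induction i with
  | zero => rfl
  | succ i ih =>
    simp only [Function.iterate_succ_apply', ih]
    exact movInt_add (hw.movInt_iterate h i) (hw'.movInt_iterate h i) h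

lemma movInt_zero (h : ℝ) : movInt h (0 : ℝ → Fin n → ℝ) = 0 := by
  funext t a
  simp [movInt]

lemma movInt_iterate_sum {ι : Type*} (S : Finset ι) {w : ι → ℝ → Fin n → ℝ}
    (hw : ∀ i ∈ S, IsLocInt (w i)) (h : ℝ) (i : ℕ) :
    (movInt h)^[i] (∑ j ∈ S, w j) = ∑ j ∈ S, (movInt h)^[i] (w j) := by
  classical
  induction S using Finset.induction_on with
  | empty =>
    simp only [Finset.sum_empty]
    exact Function.iterate_fixed (movInt_zero h) i
  | insert j S hj ih =>
    rw [Finset.sum_insert hj, Finset.sum_insert hj, movInt_iterate_add (hw j (by simp))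
      (IsLocInt.sum S fun j hj => hw j (by simp [hj])), ih fun j hj => hw j (by simp [hj])]

lemma movInt_mulVec {w : ℝ → Fin n → ℝ} (hw : IsLocInt w) (A : Mat n) (h : ℝ) :
    movInt h (fun t => A.mulVec (w t)) = fun t => A.mulVec (movInt h w t) := by
  funext t a
  simp only [movInt, Matrix.mulVec, dotProduct]
  rw [intervalIntegral.integral_finsetSum fun c _ => (hw c _ _).const_mul _]
  simp only [intervalIntegral.integral_const_mul]

lemma movInt_iterate_mulVec {w : ℝ → Fin n → ℝ} (hw : IsLocInt w) (A : Mat n) (h : ℝ) (i : ℕ) :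
    (movInt h)^[i] (fun t => A.mulVec (w t)) = fun t => A.mulVec ((movInt h)^[i] w t) := by
  induction i with
  | zero => rfl
  | succ i ih =>
    simp only [Function.iterate_succ_apply', ih]
    exact movInt_mulVec (hw.movInt_iterate h i) A h

lemma backDiff_iterate_mulVec (w : ℝ → Fin n → ℝ) (A : Mat n) (h : ℝ) (i : ℕ) :
    (backDiff h)^[i] (fun t => A.mulVec (w t)) = fun t => A.mulVec ((backDiff h)^[i] w t) := by
  induction i with
  | zero => rfl
  | succ i ih =>
    simp only [Function.iterate_succ_apply', ih]
    funext t a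
    simp only [backDiff, Matrix.mulVec, dotProduct, mul_sub, Finset.sum_sub_distrib]

namespace IsVecTempered

lemma isLocInt {w : ℝ → Fin n → ℝ} (hw : IsVecTempered w) : IsLocInt w :=
  fun a s t => (hw a).intervalIntegrable s t

lemma sum {ι : Type*} (S : Finset ι) {w : ι → ℝ → Fin n → ℝ} (hw : ∀ i ∈ S, IsVecTempered (w i)) :
    IsVecTempered (∑ i ∈ S, w i) := fun a => by
  simp only [Finset.sum_apply]
  exact IsTempered.sum S fun i hi => hw i hi a

lemma mulVec {w : ℝ → Fin n → ℝ} (hw : IsVecTempered w) (A : Mat n) :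
    IsVecTempered fun t => A.mulVec (w t) := fun a => by
  simp only [Matrix.mulVec, dotProduct]
  exact IsTempered.sum _ fun c _ => (hw c).const_mul _

lemma mcnv {w : ℝ → Fin n → ℝ} (hw : IsVecTempered w) {K : ℝ → Mat n}
    (hK : ∀ a b, IsRapid fun u => K u a b) : IsVecTempered (mcnv K w) :=
  fun a => isTempered_mcnv hK hw a

lemma movInt {w : ℝ → Fin n → ℝ} (hw : IsVecTempered w) {h : ℝ} (hh : 0 ≤ h) :
    IsVecTempered (movInt h w) := fun a => by
  have := IsTempered.cnv (isRapid_box h) (hw a)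
  rwa [show cnv (box h) (fun u => w u a) = fun t => MCARMA.movInt h w t a from
    funext fun t => cnv_box _ hh t] at this

lemma backDiff {w : ℝ → Fin n → ℝ} (hw : IsVecTempered w) (h : ℝ) :
    IsVecTempered (backDiff h w) := fun a => (hw a).sub ((hw a).shift h)

lemma movInt_iterate {w : ℝ → Fin n → ℝ} (hw : IsVecTempered w) {h : ℝ} (hh : 0 ≤ h) (i : ℕ) :
    IsVecTempered ((MCARMA.movInt h)^[i] w) := by
  induction i with
  | zero => exact hw
  | succ i ih => rw [Function.iterate_succ_apply']; exact ih.movInt hh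

lemma backDiff_iterate {w : ℝ → Fin n → ℝ} (hw : IsVecTempered w) (h : ℝ) (i : ℕ) :
    IsVecTempered ((MCARMA.backDiff h)^[i] w) := by
  induction i with
  | zero => exact hw
  | succ i ih => rw [Function.iterate_succ_apply']; exact ih.backDiff h

end IsVecTempered

section Commutation

variable {K : ℝ → Mat n}

/-- A moving integral is itself a convolution, with `box h`, and convolutions commute. -/
lemma mcnv_movInt (hK : ∀ a b, IsRapid fun u => K u a b) {w : ℝ → Fin n → ℝ}
    (hw : IsVecTempered w) {h : ℝ} (hh : 0 ≤ h) : mcnv K (movInt h w) = movInt h (mcnv K w) := by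
  have hb := isRapid_box h
  funext t a
  have h1 : ∀ b, (fun s => movInt h w s b) = cnv (box h) fun s => w s b :=
    fun b => funext fun t => (cnv_box _ hh t).symm
  simp only [movInt]
  rw [← cnv_box _ hh]
  simp only [mcnv]
  rw [cnv_sum_right _ hb fun b _ => IsTempered.cnv (hK a b) (hw b)]
  refine Finset.sum_congr rfl fun b _ => ?_
  rw [← cnv_assoc hb (hK a b) (hw b), cnv_comm (box h), cnv_assoc (hK a b) hb (hw b), ← h1]

lemma mcnv_backDiff (hK : ∀ a b, IsRapid fun u => K u a b) {w : ℝ → Fin n → ℝ}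
    (hw : IsVecTempered w) (h : ℝ) : mcnv K (backDiff h w) = backDiff h (mcnv K w) := by
  funext t a
  simp only [backDiff, mcnv]
  rw [← Finset.sum_sub_distrib]
  refine Finset.sum_congr rfl fun b _ => ?_
  rw [cnv_sub_right (hK a b) (hw b) ((hw b).shift h), cnv_shift _ (fun s => w s b)]

lemma mcnv_movInt_iterate (hK : ∀ a b, IsRapid fun u => K u a b) {w : ℝ → Fin n → ℝ}
    (hw : IsVecTempered w) {h : ℝ} (hh : 0 ≤ h) (i : ℕ) :
    mcnv K ((movInt h)^[i] w) = (movInt h)^[i] (mcnv K w) := by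
  induction i with
  | zero => rfl
  | succ i ih =>
    simp only [Function.iterate_succ_apply']
    rw [mcnv_movInt hK (hw.movInt_iterate hh i) hh, ih]

lemma mcnv_backDiff_iterate (hK : ∀ a b, IsRapid fun u => K u a b) {w : ℝ → Fin n → ℝ}
    (hw : IsVecTempered w) (h : ℝ) (i : ℕ) :
    mcnv K ((backDiff h)^[i] w) = (backDiff h)^[i] (mcnv K w) := by
  induction i with
  | zero => rfl
  | succ i ih =>
    simp only [Function.iterate_succ_apply']
    rw [mcnv_backDiff hK (hw.backDiff_iterate h i) h, ih]

lemma mcnv_add (hK : ∀ a b, IsRapid fun u => K u a b) {w w' : ℝ → Fin n → ℝ}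
    (hw : IsVecTempered w) (hw' : IsVecTempered w') : mcnv K (w + w') = mcnv K w + mcnv K w' := by
  funext t a
  simp only [mcnv, Pi.add_apply]
  rw [← Finset.sum_add_distrib]
  exact Finset.sum_congr rfl fun b _ => cnv_add_right (hK a b) (hw b) (hw' b) t

lemma mcnv_sum (hK : ∀ a b, IsRapid fun u => K u a b) {ι : Type*} (S : Finset ι)
    {w : ι → ℝ → Fin n → ℝ} (hw : ∀ i ∈ S, IsVecTempered (w i)) :
    mcnv K (∑ i ∈ S, w i) = ∑ i ∈ S, mcnv K (w i) := by
  funext t a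
  simp only [mcnv, Finset.sum_apply]
  rw [Finset.sum_comm]
  exact Finset.sum_congr rfl fun b _ => cnv_sum_right S (hK a b) (fun i hi => hw i hi b) t

lemma mcnv_congr_ae {w w' : ℝ → Fin n → ℝ} (h : w =ᵐ[volume] w') : mcnv K w = mcnv K w' := by
  funext t a
  simp only [mcnv]
  exact Finset.sum_congr rfl fun b _ => by
    rw [cnv_congr_ae_right (h.mono fun s hs => congrFun hs b :
      (fun s => w s b) =ᵐ[volume] fun s => w' s b)]

end Commutation

/-- Each moving integral looks back by `h`, so the interval of positivity loses a length `h` at its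
left end. -/
lemma movInt_iterate_pos {w : ℝ → Fin n → ℝ} (hw : IsLocInt w) {h : ℝ} (hh : 0 < h) {a : Fin n}
    {x y : ℝ} (hpos : ∀ u ∈ Set.Icc x y, 0 < w u a) (i : ℕ) :
    ∀ u ∈ Set.Icc (x + i * h) y, 0 < (movInt h)^[i] w u a := by
  induction i with
  | zero => simpa using hpos
  | succ i ih =>
    intro u hu
    rw [Function.iterate_succ_apply']
    have h1 : x + i * h ≤ u - h := by
      have := hu.1
      push_cast at this
      linarith
    exact intervalIntegral.intervalIntegral_pos_of_pos_on (hw.movInt_iterate h i a _ _)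
      (fun v hv => ih v ⟨h1.trans hv.1.le, hv.2.le.trans hu.2⟩) (by linarith)

/-- If `w` were positive at a point it would be so nearby, and `m` moving integrals over a window
with `m h ≤ δ / 2` would stay positive there. A single `h` is not enough, since functions of period
`h` with mean zero are annihilated when `m ≥ 1`. -/
lemma eq_zero_of_movInt_iterate {w : ℝ → Fin n → ℝ} (hw : ∀ a, Continuous fun t => w t a) {m : ℕ}
    (h : ∀ N : ℕ, (movInt (1 / ((N : ℝ) + 1)))^[m] w = 0) : w = 0 := by
  have key : ∀ w : ℝ → Fin n → ℝ, (∀ a, Continuous fun t => w t a) →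
      (∀ N : ℕ, (movInt (1 / ((N : ℝ) + 1)))^[m] w = 0) → ∀ t a, w t a ≤ 0 := by
    intro w hw h t a
    by_contra! hpos
    have hev : ∀ᶠ u in nhds t, 0 < w u a := (hw a).continuousAt.eventually (lt_mem_nhds hpos)
    obtain ⟨δ, hδ, hball⟩ := Metric.eventually_nhds_iff.1 hev
    obtain ⟨N, hN⟩ := exists_nat_gt (2 * m / δ)
    have hN1 : (0 : ℝ) < (N : ℝ) + 1 := by positivity
    have hmh : (m : ℝ) * (1 / ((N : ℝ) + 1)) ≤ δ / 2 := by
      rw [mul_one_div, div_le_iff₀ hN1]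
      rw [div_lt_iff₀ hδ] at hN
      nlinarith
    have h1 := movInt_iterate_pos (w := w) (fun a s t => (hw a).intervalIntegrable s t)
      (one_div_pos.2 hN1) (a := a) (x := t - δ / 2) (y := t) (fun u hu => hball (by
        rw [Real.dist_eq, abs_lt]
        constructor <;> linarith [hu.1, hu.2])) m t ⟨by linarith, le_rfl⟩
    rw [h N] at h1
    exact lt_irrefl _ h1
  have hneg : ∀ h i, (movInt h)^[i] (-w) = -(movInt h)^[i] w := by
    intro h i
    induction i with
    | zero => rfl
    | succ i ih =>
      simp only [Function.iterate_succ_apply', ih]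
      funext t a
      simp [movInt]
  funext t a
  refine le_antisymm (key w hw h t a) ?_
  have := key (-w) (fun a => (hw a).neg) (fun N => by rw [hneg, h N, neg_zero]) t a
  simpa using this

/-- Each moving integral of `w` is continuous and satisfies the same hypothesis, because moving
integrals commute; so it vanishes. Lebesgue differentiation of the primitive, which is therefore
zero, gives the claim. -/
lemma ae_eq_zero_of_movInt_iterate {w : ℝ → Fin n → ℝ} (hw : IsVecTempered w) {m : ℕ}
    (h : ∀ N : ℕ, (movInt (1 / ((N : ℝ) + 1)))^[m] w = 0) : w =ᵐ[volume] 0 := by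
  have h1 : ∀ c : ℝ, 0 ≤ c → movInt c w = 0 := by
    intro c hc
    refine eq_zero_of_movInt_iterate (hw.isLocInt.continuous_movInt c) (m := m) fun N => ?_
    have hcomm : ∀ h : ℝ, 0 ≤ h → ∀ i, (movInt h)^[i] (movInt c w) = movInt c ((movInt h)^[i] w) := by
      intro h hh i
      induction i with
      | zero => rfl
      | succ i ih =>
        simp only [Function.iterate_succ_apply', ih]
        have ht := hw.movInt_iterate hh i
        have hbox : ∀ {h : ℝ}, 0 ≤ h → ∀ w : ℝ → Fin n → ℝ, ∀ a,
            (fun s => movInt h w s a) = cnv (box h) fun s => w s a :=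
          fun hh w a => funext fun t => (cnv_box _ hh t).symm
        funext t a
        refine (congrFun (hbox hh (movInt c ((movInt h)^[i] w)) a) t).trans ?_
        refine Eq.trans ?_ (congrFun (hbox hc (movInt h ((movInt h)^[i] w)) a) t).symm
        rw [hbox hc, hbox hh, ← cnv_assoc (isRapid_box h) (isRapid_box c) (ht a),
          ← cnv_assoc (isRapid_box c) (isRapid_box h) (ht a), cnv_comm (box h)]
    rw [hcomm _ (by positivity), h N, movInt_zero]
  have h2 : ∀ a, ∀ᵐ t, w t a = 0 := fun a => by
    filter_upwards [LocallyIntegrable.ae_hasDerivAt_integral (hw a).locallyIntegrable] with t ht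
    have h3 : (fun x => ∫ u in (0 : ℝ)..x, w u a) = fun _ => 0 := by
      funext x
      rcases le_total 0 x with hx | hx
      · have := congrFun (congrFun (h1 x hx) x) a
        simpa [movInt] using this
      · have := congrFun (congrFun (h1 (-x) (by linarith)) 0) a
        rw [intervalIntegral.integral_symm]
        simpa [movInt] using this
    have h4 := ht 0
    rw [h3] at h4
    exact h4.unique (hasDerivAt_const t 0)
  simp only [← ae_all_iff] at h2
  filter_upwards [h2] with t ht
  funext a
  exact ht a

end AveragingOperators

/-! ### Uniqueness for a single path -/

section PathwiseUniqueness

variable {n m : ℕ} {C : ℕ → Mat n} {f : ℝ → Mat n} {k : ℕ → ℝ → Mat n}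

namespace IsKernelSystem

lemma backDiff_mcnv (hk : IsKernelSystem m C f k) {w : ℝ → Fin n → ℝ} (hw : IsVecTempered w)
    {j : ℕ} (hj : j < m) {h : ℝ} (hh : 0 ≤ h) :
    backDiff h (mcnv (k j) w) = movInt h (derivPath m k w j) := by
  funext t a
  exact hk.mcnv_sub hw hj (by linarith) a

/-- Integrated form of "the `j`-th derivative of `k 0 * w` is `k j * w`", usable when `w` is only
tempered. -/
lemma backDiff_iterate_mcnv (hk : IsKernelSystem m C f k) {w : ℝ → Fin n → ℝ}
    (hw : IsVecTempered w) {h : ℝ} (hh : 0 ≤ h) {j : ℕ} (hj : j < m) :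
    (backDiff h)^[j] (mcnv (k 0) w) = (movInt h)^[j] (mcnv (k j) w) := by
  induction j with
  | zero => rfl
  | succ j ih =>
    have hjr := (hw.mcnv (hk.rapid j (by omega))).isLocInt
    rw [Function.iterate_succ_apply', ih (by omega), ← movInt_iterate_backDiff hjr,
      hk.backDiff_mcnv hw (by omega) hh, Function.iterate_succ_apply]
    congr 2
    funext t a
    simp [derivPath, hj.ne]

/-- The last differentiation meets the unit jump of `k (m - 1)`. The resulting bare `w` is what
survives in the uniqueness argument. -/
lemma backDiff_iterate_mcnv_last (hk : IsKernelSystem m C f k) (hm : 0 < m) {w : ℝ → Fin n → ℝ}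
    (hw : IsVecTempered w) {h : ℝ} (hh : 0 ≤ h) :
    (backDiff h)^[m] (mcnv (k 0) w) = (movInt h)^[m] (mcnv (k m) w + w) := by
  obtain ⟨j, hj⟩ : ∃ j, m = j + 1 := ⟨m - 1, by omega⟩
  have hjr := (hw.mcnv (hk.rapid j (by omega))).isLocInt
  conv_lhs => rw [hj]
  rw [Function.iterate_succ_apply', hk.backDiff_iterate_mcnv hw hh (by omega),
    ← movInt_iterate_backDiff hjr, hk.backDiff_mcnv hw (by omega) hh, ← Function.iterate_succ_apply]
  congr 1
  · rw [hj]
  · funext t a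
    simp [derivPath, hj]

/-- The kernel identity with the `C j` on the right: here the equation is hit by `k 0` from the
left, after the coefficients have acted on the path. -/
lemma mcnv_right (hk : IsKernelSystem m C f k) (hm : 0 < m) {z : ℝ → Fin n → ℝ}
    (hz : IsVecTempered z) :
    mcnv (k m) z + ∑ j ∈ Finset.range m, mcnv (k j) (fun t => (C j).mulVec (z t))
      = mcnv (k 0) (mcnv f z) := by
  funext t a
  have hr : ∀ j ∈ Finset.range m, ∀ c b, IsRapid fun u => k j u c b :=
    fun j hj => hk.rapid j (Finset.mem_range.1 hj).le
  rw [mcnv_mcnv (hk.rapid 0 hm.le) hk.rapid_delay hz]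
  have h1 : ∀ b, cnv (fun u => ∑ c, cnv (fun u => k 0 u a c) (fun u => f u c b) u)
      (fun s => z s b) t = cnv (fun u => k m u a b) (fun s => z s b) t
        + ∑ j ∈ Finset.range m, ∑ c, C j c b * cnv (fun u => k j u a c) (fun s => z s b) t := by
    intro b
    have hr1 : ∀ j ∈ Finset.range m, ∀ c ∈ Finset.univ, IsRapid fun u => C j c b * k j u a c :=
      fun j hj c _ => (hr j hj a c).const_mul _
    rw [← cnv_congr_ae (hk.right a b), cnv_add_left (hk.rapid m le_rfl a b)
      (IsRapid.sum _ fun j hj => IsRapid.sum _ (hr1 j hj)) (hz b),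
      cnv_sum_left _ (fun j hj => IsRapid.sum _ (hr1 j hj)) (hz b)]
    congr 1
    refine Finset.sum_congr rfl fun j hj => ?_
    rw [cnv_sum_left _ (hr1 j hj) (hz b)]
    exact Finset.sum_congr rfl fun c _ => cnv_const_mul_left _ _ _ _
  rw [Finset.sum_congr rfl fun b _ => h1 b, Finset.sum_add_distrib]
  simp only [Pi.add_apply, Finset.sum_apply]
  congr 1
  refine Eq.trans (Finset.sum_congr rfl fun j hj => ?_) Finset.sum_comm
  refine Eq.trans (Finset.sum_congr rfl fun c _ => ?_) Finset.sum_comm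
  simp only [Matrix.mulVec, dotProduct]
  rw [cnv_sum_right _ (hr j hj a c) fun b _ => (hz b).const_mul _]
  exact Finset.sum_congr rfl fun b _ => cnv_const_mul_right _ _ _ _

/-- Solutions of the homogeneous delay equation with tempered paths vanish. -/
lemma ae_eq_zero_of_homogeneous (hk : IsKernelSystem m C f k) (hm : 0 < m)
    {D : ℕ → ℝ → Fin n → ℝ} (hD : ∀ j < m, IsLocInt (D j)) (h0 : IsVecTempered (D 0))
    (hderiv : ∀ j, j + 1 < m → ∀ h, 0 ≤ h → backDiff h (D j) = movInt h (D (j + 1)))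
    (heq : ∀ N : ℕ, (backDiff (1 / ((N : ℝ) + 1)) (D (m - 1)) + ∑ j ∈ Finset.range m,
        fun t => (C j).mulVec (movInt (1 / ((N : ℝ) + 1)) (D j) t))
      =ᵐ[volume] movInt (1 / ((N : ℝ) + 1)) (mcnv f (D 0))) :
    D 0 =ᵐ[volume] 0 := by
  refine ae_eq_zero_of_movInt_iterate h0 (m := m) fun N => ?_
  set h : ℝ := 1 / ((N : ℝ) + 1) with hdef
  have hh : 0 ≤ h := by positivity
  -- After `j` moving integrals the `j`-th derivative is expressed by `D 0`, the only function known
  -- to be tempered.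
  have hA : ∀ j < m, (movInt h)^[j] (D j) = (backDiff h)^[j] (D 0) := by
    intro j hj
    induction j with
    | zero => rfl
    | succ j ih =>
      rw [Function.iterate_succ_apply, ← hderiv j hj h hh,
        movInt_iterate_backDiff (hD j (by omega)), ih (by omega), Function.iterate_succ_apply']
  have hF := h0.mcnv hk.rapid_delay
  have hCJ : ∀ j ∈ Finset.range m, IsLocInt fun t => (C j).mulVec (movInt h (D j) t) :=
    fun j hj => ((hD j (Finset.mem_range.1 hj)).movInt h).mulVec (C j)
  have hm1 : (m - 1) + 1 = m := by omega
  -- With `J` the moving integral and `Δ` the backward difference, `m - 1` further integrations turn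
  -- the equation into `Δ^m D₀ + ∑ J^{m-j} Δ^j C_j D₀ = J^m (f * D₀)`.
  have hB := movInt_iterate_congr_ae (heq N) h (m - 1)
  rw [movInt_iterate_add ((hD (m - 1) (by omega)).backDiff h) (IsLocInt.sum _ hCJ),
    movInt_iterate_backDiff (hD (m - 1) (by omega)), hA (m - 1) (by omega),
    ← Function.iterate_succ_apply' (backDiff h), ← Function.iterate_succ_apply (movInt h),
    Nat.succ_eq_add_one, hm1, movInt_iterate_sum _ hCJ] at hB
  have hterm : ∀ j ∈ Finset.range m, (movInt h)^[m - 1] (fun t => (C j).mulVec (movInt h (D j) t))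
      = (movInt h)^[m - j] ((backDiff h)^[j] fun t => (C j).mulVec (D 0 t)) := by
    intro j hj
    have hjm := Finset.mem_range.1 hj
    rw [movInt_iterate_mulVec ((hD j hjm).movInt h), backDiff_iterate_mulVec,
      movInt_iterate_mulVec (h0.backDiff_iterate h j).isLocInt, ← Function.iterate_succ_apply,
      Nat.succ_eq_add_one, hm1, ← hA j hjm, ← Function.iterate_add_apply,
      Nat.sub_add_cancel hjm.le]
  rw [Finset.sum_congr rfl hterm] at hB
  have hC0 : ∀ j, IsVecTempered fun t => (C j).mulVec (D 0 t) := fun j => h0.mulVec (C j)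
  have hVT : ∀ j, IsVecTempered
      ((movInt h)^[m - j] ((backDiff h)^[j] fun t => (C j).mulVec (D 0 t))) :=
    fun j => ((hC0 j).backDiff_iterate h j).movInt_iterate hh _
  have hk0 := hk.rapid 0 hm.le
  -- Convolution with `k 0` makes every term a `J^m`: the left side becomes `J^m (k_m * D₀ + D₀ + ∑
  -- k_j * C_j D₀)`, the right side `J^m (k_0 * f * D₀)`. By `mcnv_right` only `J^m D₀ = 0` remains.
  have hG := mcnv_congr_ae (K := k 0) hB
  rw [mcnv_add hk0 (h0.backDiff_iterate h m) (IsVecTempered.sum _ fun j _ => hVT j),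
    mcnv_sum hk0 _ (fun j _ => hVT j), mcnv_backDiff_iterate hk0 h0,
    hk.backDiff_iterate_mcnv_last hm h0 hh, mcnv_movInt_iterate hk0 hF hh] at hG
  have hterm2 : ∀ j ∈ Finset.range m,
      mcnv (k 0) ((movInt h)^[m - j] ((backDiff h)^[j] fun t => (C j).mulVec (D 0 t)))
      = (movInt h)^[m] (mcnv (k j) fun t => (C j).mulVec (D 0 t)) := by
    intro j hj
    have hjm := Finset.mem_range.1 hj
    rw [mcnv_movInt_iterate hk0 ((hC0 j).backDiff_iterate h j) hh,
      mcnv_backDiff_iterate hk0 (hC0 j), hk.backDiff_iterate_mcnv (hC0 j) hh hjm,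
      ← Function.iterate_add_apply, Nat.sub_add_cancel hjm.le]
  have hkm : IsLocInt (mcnv (k m) (D 0)) := (h0.mcnv (hk.rapid m le_rfl)).isLocInt
  have hkj : ∀ j ∈ Finset.range m, IsLocInt (mcnv (k j) fun t => (C j).mulVec (D 0 t)) :=
    fun j hj => ((hC0 j).mcnv (hk.rapid j (Finset.mem_range.1 hj).le)).isLocInt
  rw [Finset.sum_congr rfl hterm2, ← hk.mcnv_right hm h0, movInt_iterate_add hkm h0.isLocInt,
    movInt_iterate_add hkm (IsLocInt.sum _ hkj), movInt_iterate_sum _ hkj, add_assoc,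
    add_right_inj, add_eq_right] at hG
  exact hG

end IsKernelSystem

end PathwiseUniqueness

/-! ### Uniqueness up to modification -/

section Uniqueness

variable {n m : ℕ} {C : ℕ → Mat n} {f : ℝ → Mat n}

/-- The increment over `(t - h, t]` of the noise which drives the delay equation with solution
`D 0` and derivatives `D 1, D 2, …`. -/
def drivingIncrement (m : ℕ) (C : ℕ → Mat n) (f : ℝ → Mat n) (D : ℕ → ℝ → Fin n → ℝ) (h t : ℝ) :
    Fin n → ℝ :=
  backDiff h (D (m - 1)) t + ∑ j ∈ Finset.range m, (C j).mulVec (movInt h (D j) t)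
    - movInt h (mcnv f (D 0)) t

lemma movInt_sub {w w' : ℝ → Fin n → ℝ} (hw : IsLocInt w) (hw' : IsLocInt w') (h : ℝ) :
    movInt h (w - w') = movInt h w - movInt h w' := by
  funext t a
  exact intervalIntegral.integral_sub (hw a _ _) (hw' a _ _)

lemma drivingIncrement_sub (hf : ∀ a b, IsRapid fun u => f u a b)
    {D D' : ℕ → ℝ → Fin n → ℝ} (hD : ∀ j < m, IsLocInt (D j)) (hD' : ∀ j < m, IsLocInt (D' j))
    (h0 : IsVecTempered (D 0)) (h0' : IsVecTempered (D' 0)) (h t : ℝ) :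
    drivingIncrement m C f (D - D') h t
      = drivingIncrement m C f D h t - drivingIncrement m C f D' h t := by
  have h1 : mcnv f (D 0 - D' 0) = mcnv f (D 0) - mcnv f (D' 0) := by
    funext t a
    simp only [mcnv, Pi.sub_apply]
    rw [← Finset.sum_sub_distrib]
    exact Finset.sum_congr rfl fun b _ => cnv_sub_right (hf a b) (h0 b) (h0' b) t
  have h2 : ∀ j ∈ Finset.range m, (C j).mulVec (movInt h ((D - D') j) t)
      = (C j).mulVec (movInt h (D j) t) - (C j).mulVec (movInt h (D' j) t) := fun j hj => by
    have hj := Finset.mem_range.1 hj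
    rw [Pi.sub_apply, movInt_sub (hD j hj) (hD' j hj), Pi.sub_apply, Matrix.mulVec_sub]
  have h3 : backDiff h ((D - D') (m - 1)) t = backDiff h (D (m - 1)) t - backDiff h (D' (m - 1)) t := by
    funext a
    simp only [backDiff, Pi.sub_apply]
    ring
  simp only [drivingIncrement]
  rw [Finset.sum_congr rfl h2, Finset.sum_sub_distrib, h3, Pi.sub_apply, h1,
    movInt_sub (h0.mcnv hf).isLocInt (h0'.mcnv hf).isLocInt, Pi.sub_apply]
  abel

variable {Ω : Type*} [MeasurableSpace Ω]

lemma measurable_movInt {w : ℝ → Ω → Fin n → ℝ} (hw : Measurable fun p : ℝ × Ω => w p.1 p.2)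
    {h : ℝ} (hh : 0 ≤ h) : Measurable fun p : ℝ × Ω => movInt h (fun s => w s p.2) p.1 := by
  refine measurable_pi_iff.2 fun a => ?_
  have h1 : ∀ p : ℝ × Ω, movInt h (fun s => w s p.2) p.1 a
      = cnv (box h) (fun s => w s p.2 a) p.1 := fun p => (cnv_box _ hh p.1).symm
  simp only [h1]
  exact measurable_cnv_process (x := fun s ω => w s ω a) ((measurable_pi_apply a).comp hw)
    (isRapid_box h).1

lemma measurable_mcnv_process {w : ℝ → Ω → Fin n → ℝ}
    (hw : Measurable fun p : ℝ × Ω => w p.1 p.2) {K : ℝ → Mat n}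
    (hK : ∀ a b, IsRapid fun u => K u a b) :
    Measurable fun p : ℝ × Ω => mcnv K (fun s => w s p.2) p.1 := by
  refine measurable_pi_iff.2 fun a => ?_
  simp only [mcnv]
  exact Finset.measurable_sum _ fun b _ => measurable_cnv_process (x := fun s ω => w s ω b)
    ((measurable_pi_apply b).comp hw) (hK a b).1

lemma measurable_drivingIncrement (hm : 0 < m) (hf : ∀ a b, IsRapid fun u => f u a b)
    {D : ℕ → ℝ → Ω → Fin n → ℝ} (hD : ∀ j < m, Measurable fun p : ℝ × Ω => D j p.1 p.2)
    {h : ℝ} (hh : 0 ≤ h) :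
    Measurable fun p : ℝ × Ω => drivingIncrement m C f (fun j s => D j s p.2) h p.1 := by
  simp only [drivingIncrement]
  refine (Measurable.add ?_ (Finset.measurable_sum _ fun j hj => ?_)).sub ?_
  · have h1 := hD (m - 1) (by omega)
    exact h1.sub (h1.comp (by fun_prop : Measurable fun p : ℝ × Ω => (p.1 - h, p.2)))
  · have h1 := measurable_movInt (hD j (Finset.mem_range.1 hj)) hh
    refine measurable_pi_iff.2 fun a => ?_
    simp only [Matrix.mulVec, dotProduct]
    exact Finset.measurable_sum _ fun c _ => ((measurable_pi_apply c).comp h1).const_mul _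
  · exact measurable_movInt (w := fun t ω => mcnv f (fun s => D 0 s ω) t)
      (measurable_mcnv_process (hD 0 hm) hf) hh

variable {Pr : Measure Ω} {Z X X' : ℝ → Ω → Fin n → ℝ}

lemma IsSolution.ae_isVecTempered [IsProbabilityMeasure Pr] (hX : IsSolution Pr m C f Z X) :
    ∀ᵐ ω ∂Pr, IsVecTempered fun s => X s ω :=
  ae_all_iff.2 fun a =>
    (isModerate_of_isStationary hX.measurable hX.integrable hX.stationary a).ae_isTempered

lemma IsDerivChain.ae_isLocInt {D : ℕ → ℝ → Ω → Fin n → ℝ} (hD : IsDerivChain Pr m X D) :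
    ∀ᵐ ω ∂Pr, ∀ j < m, IsLocInt fun s => D j s ω := by
  refine ae_all_iff.2 fun j => ?_
  by_cases hj : j < m
  · filter_upwards [hD.integrable j hj] with ω hω _ a s t
    exact ⟨(hω s t).1.eval a, (hω s t).2.eval a⟩
  · exact ae_of_all _ fun ω h => absurd h hj

lemma IsDerivChain.ae_backDiff_eq {D : ℕ → ℝ → Ω → Fin n → ℝ} (hD : IsDerivChain Pr m X D) :
    ∀ᵐ ω ∂Pr, ∀ j, j + 1 < m → ∀ h, 0 ≤ h →
      backDiff h (fun s => D j s ω) = movInt h (fun s => D (j + 1) s ω) := by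
  refine ae_all_iff.2 fun j => ?_
  by_cases hj : j + 1 < m
  · filter_upwards [hD.deriv j hj, hD.ae_isLocInt] with ω hω hi _ h hh
    funext t a
    rcases hh.eq_or_lt with rfl | hh
    · simp [backDiff, movInt]
    · have h1 := congrFun (hω (t - h) t (by linarith)) a
      rwa [intervalIntegral_apply (by linarith) fun a => hi (j + 1) hj a _ _] at h1
  · exact ae_of_all _ fun ω h => absurd h hj

lemma ae_drivingIncrement_eq (hf : ∀ a b, IsRapid fun u => f u a b)
    (hfc : ∀ u < 0, f u = 0) {D : ℕ → ℝ → Ω → Fin n → ℝ} (hD : IsDerivChain Pr m X D)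
    (hX : ∀ᵐ ω ∂Pr, IsVecTempered fun s => X s ω)
    (heq : ∀ s t : ℝ, s < t → ∀ᵐ ω ∂Pr, D (m - 1) t ω - D (m - 1) s ω =
      -(∑ j ∈ Finset.range m, ∫ u in s..t, (C j).mulVec (D j u ω))
        + (∫ u in s..t, ∫ v in Set.Ioi 0, (f v).mulVec (X (u - v) ω)) + (Z t ω - Z s ω))
    {h : ℝ} (hh : 0 < h) (t : ℝ) :
    ∀ᵐ ω ∂Pr, drivingIncrement m C f (fun j s => D j s ω) h t = Z t ω - Z (t - h) ω := by
  filter_upwards [heq (t - h) t (by linarith), hD.ae_isLocInt, hX] with ω hω hi hx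
  have hle : t - h ≤ t := by linarith
  simp only [delay_eq_mcnv hf hfc hx] at hω
  have h1 : ∀ j ∈ Finset.range m, ∫ u in (t - h)..t, (C j).mulVec (D j u ω)
      = (C j).mulVec (movInt h (fun s => D j s ω) t) := fun j hj => by
    have hj := hi j (Finset.mem_range.1 hj)
    rw [← congrFun (movInt_mulVec hj (C j) h) t]
    funext a
    exact intervalIntegral_apply hle (fun a => hj.mulVec (C j) a _ _) a
  have h2 : ∫ u in (t - h)..t, mcnv f (fun s => X s ω) u
      = movInt h (mcnv f fun s => X s ω) t := by
    funext a
    exact intervalIntegral_apply hle (fun a => (IsVecTempered.mcnv hx hf).isLocInt a _ _) a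
  rw [Finset.sum_congr rfl h1, h2] at hω
  have h3 : backDiff h (fun s => D (m - 1) s ω) t = D (m - 1) t ω - D (m - 1) (t - h) ω := rfl
  simp only [drivingIncrement, hD.zero]
  rw [h3, hω]
  abel

/-- `w` is a constant plus a primitive of `v`, hence continuous, and continuous functions vanishing
almost everywhere vanish. -/
lemma eq_zero_of_ae_eq_zero_of_backDiff {w v : ℝ → Fin n → ℝ} (hv : IsLocInt v)
    (h : ∀ h, 0 ≤ h → backDiff h w = movInt h v) (h0 : w =ᵐ[volume] 0) : w = 0 := by
  have hc : ∀ a, Continuous fun t => w t a := fun a => by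
    have h1 : (fun t => w t a) = fun t => w 0 a + ∫ u in (0 : ℝ)..t, v u a := by
      funext t
      rcases le_total 0 t with ht | ht
      · have := congrFun (congrFun (h t ht) t) a
        simp only [backDiff, movInt, sub_self] at this
        linarith
      · have := congrFun (congrFun (h (-t) (by linarith)) 0) a
        simp only [backDiff, movInt, zero_sub, neg_neg] at this
        rw [intervalIntegral.integral_symm]
        linarith
    rw [h1]
    exact continuous_const.add (intervalIntegral.continuous_primitive (fun s t => hv a s t) 0)
  funext t a
  have h1 : (fun t => w t a) =ᵐ[volume] fun _ => 0 := h0.mono fun t ht => congrFun ht a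
  exact congrFun ((hc a).ae_eq_iff_eq volume continuous_const |>.1 h1) t

/-- Solutions of the delay equation are unique up to modification. -/
lemma IsSolution.ae_eq [IsProbabilityMeasure Pr] {k : ℕ → ℝ → Mat n}
    (hk : IsKernelSystem m C f k) (hm : 0 < m)
    (hX : IsSolution Pr m C f Z X) (hX' : IsSolution Pr m C f Z X') (t : ℝ) :
    X t =ᵐ[Pr] X' t := by
  obtain ⟨D, hD, heq⟩ := hX.equation
  obtain ⟨D', hD', heq'⟩ := hX'.equation
  have hf := hk.rapid_delay
  have hm1 : m - 1 < m := by omega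
  have hdiff : ∀ h t : ℝ, 0 < h → ∀ᵐ ω ∂Pr, drivingIncrement m C f (fun j s => D j s ω) h t
      = drivingIncrement m C f (fun j s => D' j s ω) h t := fun h t hh => by
    filter_upwards [ae_drivingIncrement_eq hf hk.causal hD hX.ae_isVecTempered heq hh t,
      ae_drivingIncrement_eq hf hk.causal hD' hX'.ae_isVecTempered heq' hh t] with ω h1 h2
    rw [h1, h2]
  -- The exceptional set of the equation depends on the endpoints. Fubini and countably many window
  -- lengths yield one null set of `ω`, at the price of losing a null set of times.
  have hdiff' : ∀ᵐ ω ∂Pr, ∀ N : ℕ, ∀ᵐ t : ℝ,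
      drivingIncrement m C f (fun j s => D j s ω) (1 / ((N : ℝ) + 1)) t
        = drivingIncrement m C f (fun j s => D' j s ω) (1 / ((N : ℝ) + 1)) t := by
    refine ae_all_iff.2 fun N => ?_
    have hN : (0 : ℝ) < 1 / ((N : ℝ) + 1) := by positivity
    refine (Measure.ae_ae_comm (μ := volume) (ν := Pr) ?_).1
      (ae_of_all _ fun t => hdiff _ t hN)
    exact measurableSet_eq_fun (measurable_drivingIncrement hm hf hD.measurable hN.le)
      (measurable_drivingIncrement hm hf hD'.measurable hN.le)
  have hV : ∀ᵐ ω ∂Pr, (fun s => X s ω) =ᵐ[volume] fun s => X' s ω := by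
    filter_upwards [hdiff', hX.ae_isVecTempered, hX'.ae_isVecTempered, hD.ae_isLocInt,
      hD'.ae_isLocInt, hD.ae_backDiff_eq, hD'.ae_backDiff_eq] with ω hω hx hx' hi hi' hb hb'
    rw [← hD.zero] at hx ⊢
    rw [← hD'.zero] at hx' ⊢
    have h1 := hk.ae_eq_zero_of_homogeneous hm
      (D := (fun j s => D j s ω) - fun j s => D' j s ω)
      (fun j hj a s t => (hi j hj a s t).sub (hi' j hj a s t))
      (fun a => (hx a).sub (hx' a))
      (fun j hj h hh => by
        rw [Pi.sub_apply, Pi.sub_apply, movInt_sub (hi _ hj) (hi' _ hj), ← hb j hj h hh,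
          ← hb' j hj h hh]
        funext t a
        simp only [backDiff, Pi.sub_apply]
        ring)
      (fun N => by
        filter_upwards [hω N] with t ht
        have h2 := drivingIncrement_sub (C := C) hf hi hi' hx hx' (1 / ((N : ℝ) + 1)) t
        rw [ht, sub_self, drivingIncrement, sub_eq_zero] at h2
        simpa only [Pi.add_apply, Finset.sum_apply] using h2)
    filter_upwards [h1] with s hs
    exact sub_eq_zero.1 hs
  have hVs : ∀ᵐ s : ℝ, X s =ᵐ[Pr] X' s :=
    (Measure.ae_ae_comm (μ := volume) (ν := Pr) (p := fun s ω => X s ω = X' s ω)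
      (measurableSet_eq_fun hX.measurable hX'.measurable)).2 hV
  -- For `m ≥ 2` the difference of the paths is continuous, so equality at almost every time is
  -- equality at all times. For `m = 1` paths may jump and the equation itself is needed.
  rcases Nat.lt_or_ge 1 m with h1m | h1m
  · filter_upwards [hV, hD.ae_isLocInt, hD'.ae_isLocInt, hD.ae_backDiff_eq, hD'.ae_backDiff_eq]
      with ω hω hi hi' hb hb'
    have h0 := eq_zero_of_ae_eq_zero_of_backDiff
      (w := (fun s => D 0 s ω) - fun s => D' 0 s ω)
      (v := (fun s => D 1 s ω) - fun s => D' 1 s ω)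
      (fun a s t => (hi 1 h1m a s t).sub (hi' 1 h1m a s t))
      (fun h hh => by
        rw [movInt_sub (hi 1 h1m) (hi' 1 h1m), ← hb 0 h1m h hh, ← hb' 0 h1m h hh]
        funext t a
        simp only [backDiff, Pi.sub_apply]
        ring)
      (by
        rw [hD.zero, hD'.zero]
        filter_upwards [hω] with s hs
        exact sub_eq_zero.2 hs)
    rw [hD.zero, hD'.zero] at h0
    exact sub_eq_zero.1 (congrFun h0 t)
  · obtain rfl : m = 1 := by omega
    -- Starting from a time `s < t` at which the solutions agree almost surely, the equation over
    -- `[s, t]` transports the agreement to `t`: its integrals depend only on the almost everywhere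
    -- classes of the paths.
    obtain ⟨s, hs, hst⟩ : ∃ s, X s =ᵐ[Pr] X' s ∧ s < t := by
      have h1 : ∃ᵐ s : ℝ, s < t := by
        rw [frequently_ae_iff]
        exact (by simp : volume (Set.Iio t) ≠ 0)
      obtain ⟨s, hs⟩ := (h1.and_eventually hVs).exists
      exact ⟨s, hs.2, hs.1⟩
    filter_upwards [hdiff (t - s) t (by linarith), hs, hV] with ω h1 h2 h3
    simp only [drivingIncrement, Finset.sum_range_one, hD.zero, hD'.zero,
      movInt_congr_ae h3, mcnv_congr_ae h3, Nat.sub_self, add_left_inj, sub_left_inj] at h1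
    funext a
    have h4 := congrFun h1 a
    simp only [backDiff, sub_sub_cancel, h2] at h4
    linarith

end Uniqueness

end MCARMA

end

theorem mainTheorem3 {Ω : Type*} [MeasurableSpace Ω] (Pr : Measure Ω) [IsProbabilityMeasure Pr]
    (n p q : ℕ) (hqp : q < p)
    (P Q : Polynomial (MCARMA.Mat n))
    (hP : P.Monic) (hPdeg : P.natDegree = p)
    (hQ : Q.Monic) (hQdeg : Q.natDegree = q)
    (hPdet : ∀ y : ℝ, (MCARMA.evalC P (Complex.I * y)).det ≠ 0)
    (hQdet : ∀ z : ℂ, 0 ≤ z.re → (MCARMA.evalC Q z).det ≠ 0)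
    (Z : ℝ → Ω → Fin n → ℝ) (hZ : MCARMA.IsNoise Pr Z)
    (I : Fin n → (MCARMA.L1L2 →ₗ[ℝ] Lp ℝ 1 Pr)) (hI : MCARMA.IsRegularIntegrator Pr Z I) :
    ∃ R : Polynomial (MCARMA.Mat n),
      (MCARMA.IsResidue p q P Q R ∧ ∀ R', MCARMA.IsResidue p q P Q R' → R' = R) ∧
      ∃ f : ℝ → MCARMA.Mat n,
        (MCARMA.IsDelayKernel P Q R f ∧
          ∀ f', MCARMA.IsDelayKernel P Q R f' → f' =ᵐ[volume] f) ∧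
        (∀ j k, MemLp (fun u => f u j k) 2 volume) ∧
        (∀ u < 0, f u = 0) ∧
        (∀ j k, Integrable (fun u => u ^ 2 * f u j k) volume) ∧
        (∃ X : ℝ → Ω → Fin n → ℝ, MCARMA.IsMCARMA P Q I X) ∧
        ∀ X : ℝ → Ω → Fin n → ℝ, MCARMA.IsMCARMA P Q I X →
          (∃ Y : ℝ → Ω → Fin n → ℝ, (∀ t, Y t =ᵐ[Pr] X t) ∧
            MCARMA.IsSolution Pr (p - q) R.coeff f Z Y) ∧
          (∀ Y : ℝ → Ω → Fin n → ℝ,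
            MCARMA.IsSolution Pr (p - q) R.coeff f Z Y → ∀ t, Y t =ᵐ[Pr] X t) := by
  have hnt : Nontrivial (MCARMA.Mat n) := MCARMA.nontrivial_mat_of_natDegree_pos (P := P) (by omega)
  obtain ⟨R, hR, hRu⟩ := MCARMA.exists_isResidue hqp hP hPdeg hQ hQdeg
  obtain ⟨f, hf, hfr, hfc⟩ := MCARMA.exists_isDelayKernel hQ hQdeg hQdet hR
  obtain ⟨k, hk0, hk⟩ :=
    MCARMA.exists_isKernelSystem hqp hP hPdeg hQ hQdeg hPdet hQdet hR hf hfr hfc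
  have hm : 0 < p - q := by omega
  have hsol := MCARMA.isSolution_derivPath hk hm hZ
  refine ⟨R, ⟨hR, hRu⟩, f, ⟨hf, fun f' hf' => hf.ae_eq hf'⟩, fun a b => (hfr a b).memLp_two, hfc,
    fun a b => (hfr a b).integrable_sq_mul, ⟨fun t ω j =>
      ∑ l, MCARMA.stochInt (I l) (fun u => k 0 (t - u) j l) ω, k 0, hk0, fun t j => ae_eq_refl _⟩,
    fun X hX => ⟨⟨_, fun t => hX.ae_eq_derivPath hI hZ hm hk hk0 t, hsol⟩, fun Y hY t => ?_⟩⟩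
  -- Both an arbitrary solution and an arbitrary version of the MCARMA process are compared with the
  -- same pathwise solution.
  exact (hY.ae_eq hk hm hsol t).trans (hX.ae_eq_derivPath hI hZ hm hk hk0 t)
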